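/- **Setting.** Consider spin-1 chains: to a finite interval $\Lambda\subset\mathbb Z$ belongs the Hilbert space $\mathcal H_\Lambda=\bigotimes_{x\in\Lambda}\mathbb C^3$, where $\mathbb C^3$ has the orthonormal basis $|+\rangle,|0\rangle,|-\rangle$ of eigenvectors of $S^z$. The AKLT interaction $h(x,x+1)=P_2(\boldsymbol S_x+\boldsymbol S_{x+1})$ is the orthogonal projection onto the states in which the sites $x,x+1$ have total spin $2$. For $a\le b$ let $H(a,b)=\sum_{a\le x<b}h(x,x+1)$, let $\mathcal G(a,b)=\operatorname{Ker}H(a,b)$, and let $G(a,b)$ be the orthogonal projection onto $\mathcal G(a,b)$. For $N\ge2$ the spectral gap $\gamma(N)$ is the largest real $\gamma$ with $H(1,N)\ge\gamma\,(1-G(1,N))$, and $\gamma_N=\min_{2\le n\le N}\gamma(n)$. For $m,n\ge1$ put $$\varepsilon(m,n)=\sup\{\langle\psi,G(0,n)\psi\rangle:\psi\in\mathcal G(-m,0)\cap\mathcal G(-m,n)^\perp,\ \|\psi\|=1\},\qquad \varepsilon_{m,n}=\sup_{m'\ge m}\varepsilon(m',n).$$ Let $U=\prod_{j<k}\exp(i\pi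 S^z_jS^x_k)$ be the Kennedy–Tasaki transformation of a chain, let $\phi_{1,2}=(|0\rangle\pm\sqrt2\,|+\rangle)/\sqrt3$ and $\phi_{3,4}=(|0\rangle\pm\sqrt2\,|-\rangle)/\sqrt3$, and let $\Phi_i(a,b)=\bigotimes_{x=a}^b(\phi_i)_x$. Let $M(a,b)=[\langle\Phi_i(a,b),\Phi_j(a,b)\rangle]_{i,j=1}^4$, let $W(a,b)=M(a,b)^{-1}$ (for $b>a$), let $\Theta_{ij}=\Phi_i(-m,0)\otimes\Phi_j(1,n)$, and let $\mathcal A=\mathcal A_{m,n}$ be the $16\times16$ matrix with entries $$\mathcal A(ij,rk)=\sum_{l,s}W(0,n)_{kl}M(0,0)_{li}M(1,n)_{lj}W(-m,0)_{rs}M(0,0)_{sk}M(-m,-1)_{si}.$$ Finally put $D=(1-(-\frac13)^{m+1})(1-(-\frac13)^{n+1})$ and $$\lambda_5=\frac{(1-(-\frac13)^m)(1-(-\frac13)^n)}{9D},\qquad \lambda_1=\frac{(1-(-\frac13)^{m-1})(1-(-\frac13)^{n-1})}{9D},$$ $$\lambda_{3\pm}=\frac{1+(-\frac13)^m+(-\frac13)^n-19(-\frac13)^{m+n+2}\pm2\sqrt{R}}{9D},$$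 $$R=[(-\tfrac13)^m-(-\tfrac13)^n]^2-128(-\tfrac13)^{2m+2n+4}+4(-\tfrac13)^{m+n+2}(1+(-\tfrac13)^m)(1+(-\tfrac13)^n).$$ **Theorem.** 1. For every $N\ge2$ the operator $U$ on $N$ sites is unitary, the product states $\Phi_1(1,N),\dots,\Phi_4(1,N)$ are linearly independent, and $U\,\mathcal G(1,N)$ is their span. 2. Let $m,n\ge1$, and let $\widetilde K=U\,G(-m,0)\,G(0,n)\,G(-m,0)\,U^*$ on the interval $[-m,n]$. Then $\widetilde K\Theta_{ij}=\sum_{r,k}\mathcal A(ij,rk)\,\Theta_{rk}$ for all $i,j$, the range of $\widetilde K$ is contained in the span of the $\Theta_{ij}$, and the $\Theta_{ij}$ are linearly independent if $n\ge2$. Moreover $R\ge0$, and the eigenvalues of $\mathcal A$ with their algebraic multiplicities are $1$ (four times), $\lambda_5$ (five times), $\lambda_1$ (once), $\lambda_{3+}$ and $\lambda_{3-}$ (three times each), i.e. its characteristic polynomial is $(X-1)^4(X-\lambda_5)^5(X-\lambda_1)(X-\lambda_{3+})^3(X-\lambda_{3-})^3$. All of $\lambda_5,\lambda_1,\lambda_{3\pm}$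 are less than $1$, and $\varepsilon(m,n)=\max(\lambda_5,\lambda_1,\lambda_{3+})$ is the fifth largest eigenvalue of $\mathcal A$. 3. $\varepsilon_{1,1}=\varepsilon(1,1)=\lambda_5(1,1)=\frac14$, $\gamma(2)=1$, and $$\inf_{N\ge2}\gamma(N)\ \ge\ 1-\frac{\sqrt3}{2}.$$ 4. $\varepsilon_{3,3}=\varepsilon(3,3)=\lambda_5(3,3)=(7/20)^2$, and $$\inf_{N\ge2}\gamma(N)\ \ge\ \gamma_6\,\bigl(1-2\sqrt{\varepsilon_{3,3}(1-\varepsilon_{3,3})}\bigr),\qquad \inf_{N\ge2}\gamma(N)\ \ge\ 0.137194.$$ -/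

import Mathlib

noncomputable section

namespace AKLT

open Complex

/-- The Hilbert space `⨂_{x < L} ℂ³` of a spin-1 chain with sites `0, …, L - 1`, written in the
product basis of configurations. At each site the index `0, 1, 2` stands for `|+⟩, |0⟩, |-⟩`. -/
abbrev Chain (L : ℕ) : Type := EuclideanSpace ℂ (Fin L → Fin 3)

/-- Operators on the chain Hilbert space. -/
abbrev Op (L : ℕ) : Type := Chain L →L[ℂ] Chain L

/-- The spin-1 matrices. -/
def spinX : Matrix (Fin 3) (Fin 3) ℂ :=
  ((Real.sqrt 2 : ℝ) : ℂ)⁻¹ • !![0, 1, 0; 1, 0, 1; 0, 1, 0]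

def spinY : Matrix (Fin 3) (Fin 3) ℂ :=
  ((Real.sqrt 2 : ℝ) : ℂ)⁻¹ • !![0, -I, 0; I, 0, -I; 0, I, 0]

def spinZ : Matrix (Fin 3) (Fin 3) ℂ :=
  !![1, 0, 0; 0, 0, 0; 0, 0, -1]

/-- The one-site matrix `A` acting at the site `x`, tensored with the identity elsewhere. -/
def siteOp {L : ℕ} (x : Fin L) (A : Matrix (Fin 3) (Fin 3) ℂ) : Op L :=
  LinearMap.toContinuousLinearMap
    { toFun := fun ψ => WithLp.toLp 2 fun σ =>
        ∑ s : Fin 3, A (σ x) s * ψ (Function.update σ x s)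
      map_add' := by
        intro ψ χ
        ext σ
        simp [mul_add, Finset.sum_add_distrib]
      map_smul' := by
        intro c ψ
        ext σ
        simp only [PiLp.smul_apply, smul_eq_mul, RingHom.id_apply, Finset.mul_sum]
        exact Finset.sum_congr rfl fun s _ => by ring }

/-- `(S_x + S_y)²`, the square of the total spin of the sites `x` and `y`. -/
def totalSpinSq {L : ℕ} (x y : Fin L) : Op L :=
  (siteOp x spinX + siteOp y spinX) ^ 2 + (siteOp x spinY + siteOp y spinY) ^ 2
    + (siteOp x spinZ + siteOp y spinZ) ^ 2

/-- The AKLT interaction `P₂(S_x + S_y)`: the orthogonal projection onto the states in which the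
sites `x` and `y` have total spin 2, i.e. onto the eigenspace of `(S_x + S_y)²` for `2(2+1)`. -/
def bond {L : ℕ} (x y : Fin L) : Op L :=
  (Module.End.eigenspace ((totalSpinSq x y : Op L) : Chain L →ₗ[ℂ] Chain L) 6).starProjection

/-- The Hamiltonian `H(a, b) = ∑_{a ≤ x, x + 1 ≤ b} h(x, x + 1)` of the sub-interval `[a, b]`,
as an operator on the chain with sites `0, …, L - 1`. -/
def ham (L a b : ℕ) : Op L :=
  ∑ p : Fin L × Fin L with
    (a ≤ (p.1 : ℕ) ∧ (p.2 : ℕ) = (p.1 : ℕ) + 1 ∧ (p.2 : ℕ) ≤ b), bond p.1 p.2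

/-- The ground state space `𝒢(a, b) = Ker H(a, b)`. -/
def groundSpace (L a b : ℕ) : Submodule ℂ (Chain L) :=
  LinearMap.ker (ham L a b : Chain L →ₗ[ℂ] Chain L)

/-- The orthogonal projection `G(a, b)` onto `𝒢(a, b)`. -/
def groundProj (L a b : ℕ) : Op L := (groundSpace L a b).starProjection

/-- The spectral gap `γ(N)` of the chain of `N ≥ 2` sites: the largest real `g` with
`H ≥ g (1 - G)`. -/
def gap (N : ℕ) : ℝ :=
  sSup {g : ℝ | (g : ℂ) • (1 - groundProj N 0 (N - 1)) ≤ ham N 0 (N - 1)}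

/-- `γ_N = min_{2 ≤ n ≤ N} γ(n)`. -/
def minGap (N : ℕ) : ℝ := ⨅ n : Set.Icc (2 : ℕ) N, gap n

/-- `inf_{N ≥ 2} γ(N)`. -/
def infGap : ℝ := ⨅ N : Set.Ici (2 : ℕ), gap N

/-- `ε(m, n)`: the supremum of `⟨ψ, G(0, n) ψ⟩` over unit vectors `ψ ∈ 𝒢(-m, 0) ∩ 𝒢(-m, n)ᗮ`.
The interval `[-m, n]` is shifted to `[0, m + n]`, so that the common site `0` becomes `m`. -/
def eps (m n : ℕ) : ℝ :=
  sSup {r : ℝ | ∃ ψ : Chain (m + n + 1), ψ ∈ groundSpace (m + n + 1) 0 m ∧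
    ψ ∈ (groundSpace (m + n + 1) 0 (m + n))ᗮ ∧ ‖ψ‖ = 1 ∧
    r = (inner ℂ ψ (groundProj (m + n + 1) m (m + n) ψ)).re}

/-- `ε_{m,n} = sup_{m' ≥ m} ε(m', n)`. -/
def epsSup (m n : ℕ) : ℝ := ⨆ k : Set.Ici m, eps k n

/-- `K(-m, n) = G(-m, 0) G(0, n) G(-m, 0)`, on the shifted interval `[0, m + n]`. -/
def K (m n : ℕ) : Op (m + n + 1) :=
  groundProj (m + n + 1) 0 m * groundProj (m + n + 1) m (m + n) * groundProj (m + n + 1) 0 m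

/-- The Kennedy–Tasaki transformation `U = ∏_{j < k} exp(iπ S_j^z S_k^x)`. (The factors commute;
they are multiplied in lexicographic order.) -/
def kennedyTasaki (L : ℕ) : Op L :=
  (((List.finRange L ×ˢ List.finRange L).filter fun p => p.1 < p.2).map fun p =>
    NormedSpace.exp (((Real.pi : ℂ) * I) • (siteOp p.1 spinZ * siteOp p.2 spinX))).prod

/-- The one-site vectors `φ_{1,2} = (|0⟩ ± √2 |+⟩)/√3` and `φ_{3,4} = (|0⟩ ± √2 |-⟩)/√3`. -/
def phi (i : Fin 4) (s : Fin 3) : ℂ :=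
  (![![(Real.sqrt 2 : ℂ), 1, 0], ![-(Real.sqrt 2 : ℂ), 1, 0],
     ![0, 1, (Real.sqrt 2 : ℂ)], ![0, 1, -(Real.sqrt 2 : ℂ)]] i s) / (Real.sqrt 3 : ℂ)

/-- The product state `Φ_i = φ_i ⊗ ⋯ ⊗ φ_i` on `N` sites. -/
def Phi (N : ℕ) (i : Fin 4) : Chain N :=
  WithLp.toLp 2 fun σ => ∏ x : Fin N, phi i (σ x)

/-- `Θ_{ij}(-m, n) = Φ_i(-m, 0) ⊗ Φ_j(1, n)`, on the shifted interval `[0, m + n]`. -/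
def Theta (m n : ℕ) (ij : Fin 4 × Fin 4) : Chain (m + n + 1) :=
  WithLp.toLp 2 fun σ => ∏ x : Fin (m + n + 1), if (x : ℕ) ≤ m then phi ij.1 (σ x) else phi ij.2 (σ x)

/-- The Gram matrix of the four product states on `N` sites. -/
def M (N : ℕ) : Matrix (Fin 4) (Fin 4) ℂ :=
  Matrix.of fun i j => inner ℂ (Phi N i) (Phi N j)

/-- The inverse Gram matrix. -/
def W (N : ℕ) : Matrix (Fin 4) (Fin 4) ℂ := (M N)⁻¹

/-- The `16 × 16` matrix with entries
`𝒜(ij, rk) = ∑_{l,s} W(0,n)_{kl} M(0,0)_{li} M(1,n)_{lj} W(-m,0)_{rs} M(0,0)_{sk} M(-m,-1)_{si}`;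
`M` and `W` depend only on the number of sites of the interval. -/
def A (m n : ℕ) : Matrix (Fin 4 × Fin 4) (Fin 4 × Fin 4) ℂ :=
  Matrix.of fun ij rk => ∑ l, ∑ s,
    W (n + 1) rk.2 l * M 1 l ij.1 * M n l ij.2 * W (m + 1) rk.1 s * M 1 s rk.2 * M m s ij.1

/-- The common denominator `(1 - (-1/3)^{m+1}) (1 - (-1/3)^{n+1})`. -/
def lamDen (m n : ℕ) : ℝ := (1 - (-1 / 3) ^ (m + 1)) * (1 - (-1 / 3) ^ (n + 1))

def lam5 (m n : ℕ) : ℝ :=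
  1 / 9 * ((1 - (-1 / 3) ^ m) * (1 - (-1 / 3) ^ n) / lamDen m n)

/-- Used for `m, n ≥ 1` only. -/
def lam1 (m n : ℕ) : ℝ :=
  1 / 9 * ((1 - (-1 / 3) ^ (m - 1)) * (1 - (-1 / 3) ^ (n - 1)) / lamDen m n)

def lamR (m n : ℕ) : ℝ :=
  ((-1 / 3) ^ m - (-1 / 3) ^ n) ^ 2 - 128 * (-1 / 3) ^ (2 * m + 2 * n + 4)
    + 4 * (-1 / 3) ^ (m + n + 2) * (1 + (-1 / 3) ^ m) * (1 + (-1 / 3) ^ n)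

def lam3plus (m n : ℕ) : ℝ :=
  1 / 9 * ((1 + (-1 / 3) ^ m + (-1 / 3) ^ n - 19 * (-1 / 3) ^ (m + n + 2)
    + 2 * Real.sqrt (lamR m n)) / lamDen m n)

def lam3minus (m n : ℕ) : ℝ :=
  1 / 9 * ((1 + (-1 / 3) ^ m + (-1 / 3) ^ n - 19 * (-1 / 3) ^ (m + n + 2)
    - 2 * Real.sqrt (lamR m n)) / lamDen m n)

end AKLT

end

/-!
The Kennedy–Tasaki transformation is a signed permutation of the basis configurations. It turns the
kernel equation of a bond, whatever the string of spins to its left, into conditions on the two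
sites of that bond; the joint solutions of these conditions along a chain are the combinations of
the four product states `Φ_i`. The Gram matrix of the `Φ_i` on `N` sites depends, up to signs, only
on `(-1/3) ^ N`, and inverting it gives the action of the ground state projections on products of
the `Φ_i`, that is, the matrix `𝒜`.

Up to signs, `𝒜` is invariant under permutations of the four indices. In a basis adapted to this
symmetry it consists of a `2 × 2` block, a `3 × 3` block taken three times and a scalar block of
size five. The number `ε(m, n)` is the largest eigenvalue other than `1` of the operator
`G(-m, 0) G(0, n) G(-m, 0)`, hence of `𝒜`.

For the gap, write `H = ∑ P_k` with `P_k` the projection at the `k`-th bond. In `H ^ 2` the products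
`P_j P_k` of bonds without a common site are nonnegative. Those at distance at least three are
dropped; those at distance two help to compensate the products of neighbouring bonds, which happens
inside windows of three consecutive bonds and rests on an estimate of the angle between the range of
a bond projection and the joint kernel of its two neighbours. The result is `H ^ 2 ≥ 0.18 H`, so
every gap is at least `0.18`. This exceeds `1 - √3 / 2` and `0.137194`, and it exceeds
`γ_6 (1 - 2 √(ε_{3,3} (1 - ε_{3,3})))` because `γ(3) ≤ 1/2` and `ε_{3,3} = (7/20) ^ 2`.
-/

noncomputable section

namespace AKLT

open Complex
open scoped Kronecker Finset

section Update

variable {ι α β : Type*} [DecidableEq ι] {x y : ι}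

/-- The configuration `σ` with the values at the two sites `x`, `y` replaced by `s`, `t`. -/
def upd2 (σ : ι → α) (x y : ι) (s t : α) : ι → α :=
  Function.update (Function.update σ x s) y t

@[simp] lemma upd2_right (σ : ι → α) (s t : α) : upd2 σ x y s t y = t := by
  simp [upd2]

lemma upd2_left (hxy : x ≠ y) (σ : ι → α) (s t : α) : upd2 σ x y s t x = s := by
  simp [upd2, hxy]

lemma upd2_of_ne {z : ι} (hx : z ≠ x) (hy : z ≠ y) (σ : ι → α) (s t : α) :
    upd2 σ x y s t z = σ z := by
  simp [upd2, hx, hy]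

lemma upd2_upd2 (hxy : x ≠ y) (σ : ι → α) (s t s' t' : α) :
    upd2 (upd2 σ x y s t) x y s' t' = upd2 σ x y s' t' := by
  simp only [upd2, Function.update_comm hxy, Function.update_idem]

lemma upd2_self (σ : ι → α) : upd2 σ x y (σ x) (σ y) = σ := by
  simp [upd2]

lemma upd2_comm {z w : ι} (hxz : x ≠ z) (hxw : x ≠ w) (hyz : y ≠ z) (hyw : y ≠ w)
    (σ : ι → α) (s t s' t' : α) :
    upd2 (upd2 σ x y s t) z w s' t' = upd2 (upd2 σ z w s' t') x y s t := by
  simp only [upd2]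
  rw [Function.update_comm hyz, Function.update_comm hyw, Function.update_comm hxz,
    Function.update_comm hxw]

variable [Fintype ι] [Fintype α] [AddCommMonoid β]

/-- `(σ, s) ↦ (σ[x ↦ s], σ x)` is an involution. -/
lemma sum_update_swap (x : ι) (F : (ι → α) → (ι → α) → β) :
    ∑ σ, ∑ s, F σ (Function.update σ x s) = ∑ σ, ∑ s, F (Function.update σ x s) σ := by
  let swap : (ι → α) × α → (ι → α) × α := fun p => (Function.update p.1 x p.2, p.1 x)
  have hswap : Function.Involutive swap := fun p => by simp [swap]
  rw [← Fintype.sum_prod_type', ← Fintype.sum_prod_type']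
  exact Fintype.sum_equiv hswap.toPerm _ _ fun p => by simp [swap]

lemma sum_upd2_swap (hxy : x ≠ y) (F : (ι → α) → (ι → α) → β) :
    ∑ σ, ∑ s, ∑ t, F σ (upd2 σ x y s t) = ∑ σ, ∑ s, ∑ t, F (upd2 σ x y s t) σ :=
  calc ∑ σ, ∑ s, ∑ t, F σ (upd2 σ x y s t)
      = ∑ σ, ∑ s, ∑ t, F (Function.update σ x s) (Function.update σ y t) :=
        sum_update_swap x fun σ τ => ∑ t, F σ (Function.update τ y t)
    _ = ∑ σ, ∑ t, ∑ s, F (Function.update σ x s) (Function.update σ y t) :=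
        Finset.sum_congr rfl fun _ _ => Finset.sum_comm
    _ = ∑ σ, ∑ t, ∑ s, F (Function.update (Function.update σ y t) x s) σ :=
        sum_update_swap y fun σ τ => ∑ s, F (Function.update σ x s) τ
    _ = ∑ σ, ∑ s, ∑ t, F (upd2 σ x y s t) σ := by
        simp only [upd2, Function.update_comm hxy]
        exact Finset.sum_congr rfl fun _ _ => Finset.sum_comm

end Update

/-- Matrices of operators on two spins 1. -/
abbrev PairMat : Type := Matrix (Fin 3 × Fin 3) (Fin 3 × Fin 3) ℂ

/-- The two-site matrix `B` acting at the sites `x` and `y`, tensored with the identity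
elsewhere; meaningful for `x ≠ y` only. -/
def pairOp {L : ℕ} (x y : Fin L) (B : PairMat) : Op L :=
  LinearMap.toContinuousLinearMap
    { toFun := fun ψ => WithLp.toLp 2 fun σ =>
        ∑ s : Fin 3, ∑ t : Fin 3, B (σ x, σ y) (s, t) * ψ (upd2 σ x y s t)
      map_add' := fun ψ χ => by
        ext σ
        simp [mul_add, Finset.sum_add_distrib]
      map_smul' := fun c ψ => by
        ext σ
        simp only [PiLp.smul_apply, smul_eq_mul, RingHom.id_apply, Finset.mul_sum]
        exact Finset.sum_congr rfl fun s _ => Finset.sum_congr rfl fun t _ => by ring }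

section PairOp

variable {L : ℕ} {x y : Fin L}

lemma siteOp_apply (A : Matrix (Fin 3) (Fin 3) ℂ) (ψ : Chain L) (σ : Fin L → Fin 3) :
    siteOp x A ψ σ = ∑ s : Fin 3, A (σ x) s * ψ (Function.update σ x s) := rfl

lemma pairOp_apply (B : PairMat) (ψ : Chain L) (σ : Fin L → Fin 3) :
    pairOp x y B ψ σ = ∑ s : Fin 3, ∑ t : Fin 3, B (σ x, σ y) (s, t) * ψ (upd2 σ x y s t) := rfl

lemma pairOp_add (B C : PairMat) : pairOp x y (B + C) = pairOp x y B + pairOp x y C := by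
  ext ψ σ
  simp [pairOp_apply, add_mul, Finset.sum_add_distrib]

lemma pairOp_smul (c : ℂ) (B : PairMat) : pairOp x y (c • B) = c • pairOp x y B := by
  ext ψ σ
  simp [pairOp_apply, Finset.mul_sum, mul_assoc]

lemma pairOp_mul (hxy : x ≠ y) (B C : PairMat) :
    pairOp x y (B * C) = pairOp x y B * pairOp x y C := by
  ext ψ σ
  rw [mul_apply_eq_comp, pairOp_apply, pairOp_apply]
  simp only [pairOp_apply, upd2_upd2 hxy, upd2_left hxy, upd2_right, Matrix.mul_apply,
    Fintype.sum_prod_type, Fin.sum_univ_three]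
  ring

lemma inner_pairOp_left (hxy : x ≠ y) (B : PairMat) (ψ χ : Chain L) :
    inner ℂ (pairOp x y B ψ) χ = inner ℂ ψ (pairOp x y B.conjTranspose χ) := by
  simp only [PiLp.inner_apply, pairOp_apply, RCLike.inner_apply, map_sum, map_mul,
    Finset.mul_sum, Finset.sum_mul, Matrix.conjTranspose_apply]
  have h := sum_upd2_swap hxy (fun σ τ : Fin L → Fin 3 =>
    χ σ * ((starRingEnd ℂ) (B (σ x, σ y) (τ x, τ y)) * (starRingEnd ℂ) (ψ τ)))
  simp only [upd2_left hxy, upd2_right] at h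
  rw [h]
  refine Finset.sum_congr rfl fun σ _ => Finset.sum_congr rfl fun s _ =>
    Finset.sum_congr rfl fun t _ => ?_
  simp only [RCLike.star_def]
  ring

lemma siteOp_eq_pairOp_left (hxy : x ≠ y) (A : Matrix (Fin 3) (Fin 3) ℂ) :
    siteOp x A = pairOp x y (A ⊗ₖ 1) := by
  ext ψ σ
  rw [siteOp_apply, pairOp_apply]
  refine Finset.sum_congr rfl fun s _ => ?_
  rw [Finset.sum_eq_single (σ y) (fun t _ ht => by simp [Matrix.one_apply_ne ht.symm]) (by simp)]
  simp [upd2, Function.update_comm hxy]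

lemma siteOp_eq_pairOp_right (A : Matrix (Fin 3) (Fin 3) ℂ) :
    siteOp y A = pairOp x y (1 ⊗ₖ A) := by
  ext ψ σ
  rw [siteOp_apply, pairOp_apply]
  symm
  rw [Finset.sum_eq_single (σ x) (fun s _ hs => by simp [Matrix.one_apply_ne hs.symm]) (by simp)]
  simp [upd2]

lemma siteOp_mul_siteOp (hxy : x ≠ y) (A B : Matrix (Fin 3) (Fin 3) ℂ) :
    siteOp x A * siteOp y B = pairOp x y (A ⊗ₖ B) := by
  rw [siteOp_eq_pairOp_left hxy, siteOp_eq_pairOp_right (x := x), ← pairOp_mul hxy,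
    ← Matrix.mul_kronecker_mul, mul_one, one_mul]

end PairOp

section Spin

lemma inv_sqrt_two_mul_self :
    (((Real.sqrt 2 : ℝ) : ℂ)⁻¹) * ((Real.sqrt 2 : ℝ) : ℂ)⁻¹ = 1 / 2 := by
  rw [← mul_inv, ← Complex.ofReal_mul, Real.mul_self_sqrt (by norm_num)]
  norm_num

lemma spinX_mul_self : spinX * spinX = (1 / 2 : ℂ) • !![1, 0, 1; 0, 2, 0; 1, 0, 1] := by
  simp only [spinX, Matrix.smul_mul, Matrix.mul_smul, smul_smul, inv_sqrt_two_mul_self]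
  congr 1
  ext i j
  fin_cases i <;> fin_cases j <;> simp [Matrix.mul_apply, Fin.sum_univ_three]; norm_num

lemma spinY_mul_self : spinY * spinY = (1 / 2 : ℂ) • !![1, 0, -1; 0, 2, 0; -1, 0, 1] := by
  simp only [spinY, Matrix.smul_mul, Matrix.mul_smul, smul_smul, inv_sqrt_two_mul_self]
  congr 1
  ext i j
  fin_cases i <;> fin_cases j <;> simp [Matrix.mul_apply, Fin.sum_univ_three]; norm_num

lemma spinZ_mul_self : spinZ * spinZ = !![1, 0, 0; 0, 0, 0; 0, 0, 1] := by
  ext i j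
  fin_cases i <;> fin_cases j <;> simp [spinZ, Matrix.mul_apply, Fin.sum_univ_three]

lemma spinX_kronecker_self :
    spinX ⊗ₖ spinX
      = (1 / 2 : ℂ) • (!![0, 1, 0; 1, 0, 1; 0, 1, 0] ⊗ₖ !![0, 1, 0; 1, 0, 1; 0, 1, 0]) := by
  rw [spinX, Matrix.smul_kronecker, Matrix.kronecker_smul, smul_smul, inv_sqrt_two_mul_self]

lemma spinY_kronecker_self :
    spinY ⊗ₖ spinY
      = (1 / 2 : ℂ) • (!![0, -I, 0; I, 0, -I; 0, I, 0] ⊗ₖ !![0, -I, 0; I, 0, -I; 0, I, 0]) := by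
  rw [spinY, Matrix.smul_kronecker, Matrix.kronecker_smul, smul_smul, inv_sqrt_two_mul_self]

lemma sq_kronecker_one_add_one_kronecker {n : Type*} [Fintype n] [DecidableEq n]
    (A : Matrix n n ℂ) :
    (A ⊗ₖ 1 + 1 ⊗ₖ A) ^ 2 = (A * A) ⊗ₖ 1 + 1 ⊗ₖ (A * A) + (2 : ℂ) • (A ⊗ₖ A) := by
  simp only [sq, add_mul, mul_add, ← Matrix.mul_kronecker_mul, mul_one, one_mul, two_smul]
  abel

/-- The Casimir matrix `(S ⊗ 1 + 1 ⊗ S)²` of two spins 1. -/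
def casimir : PairMat :=
  (spinX ⊗ₖ 1 + 1 ⊗ₖ spinX) ^ 2 + (spinY ⊗ₖ 1 + 1 ⊗ₖ spinY) ^ 2
    + (spinZ ⊗ₖ 1 + 1 ⊗ₖ spinZ) ^ 2

/-- The entries of `casimir`: by `S⃗² = 2` at each site, it is
`4 + 2 Sᶻ ⊗ Sᶻ + S⁺ ⊗ S⁻ + S⁻ ⊗ S⁺`. -/
def casimirInt : Matrix (Fin 3 × Fin 3) (Fin 3 × Fin 3) ℤ :=
  Matrix.of fun p q =>
    (if p = q then 4 + 2 * (1 - (p.1 : ℤ)) * (1 - (p.2 : ℤ)) else 0) +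
    (if (p.1 : ℤ) = q.1 + 1 ∧ (q.2 : ℤ) = p.2 + 1 then 2 else 0) +
    (if (q.1 : ℤ) = p.1 + 1 ∧ (p.2 : ℤ) = q.2 + 1 then 2 else 0)

/-- The coefficients of the spin-2 vectors of two spins 1: for each value of `p.1 + p.2`, that is,
of the total `Sᶻ`, there is exactly one such vector. They are `|++⟩`, `|+0⟩ + |0+⟩`,
`|+-⟩ + 2 |00⟩ + |-+⟩`, `|0-⟩ + |-0⟩` and `|--⟩`. -/
def spinTwoCoeff (p : Fin 3 × Fin 3) : ℤ := if p = (1, 1) then 2 else 1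

/-- The projection onto total spin 2, multiplied by 6 to make it integral. The square norms of the
vectors of `spinTwoCoeff` are `1, 2, 6, 2, 1`. -/
def spinTwoInt (p q : Fin 3 × Fin 3) : ℤ :=
  if (p.1 : ℕ) + p.2 = q.1 + q.2 then
    ![6, 3, 1, 3, 6] (Fin.ofNat 5 (p.1 + p.2)) * spinTwoCoeff p * spinTwoCoeff q
  else 0

/-- The orthogonal projection of two spins 1 onto total spin 2. -/
def spinTwo : PairMat := Matrix.of fun p q => (spinTwoInt p q : ℂ) / 6

lemma casimir_eq : casimir = casimirInt.map (fun z : ℤ => (z : ℂ)) := by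
  rw [casimir, sq_kronecker_one_add_one_kronecker, sq_kronecker_one_add_one_kronecker,
    sq_kronecker_one_add_one_kronecker, spinX_mul_self, spinY_mul_self, spinZ_mul_self,
    spinX_kronecker_self, spinY_kronecker_self]
  ext ⟨a, b⟩ ⟨c, d⟩
  simp only [Matrix.add_apply, Matrix.smul_apply, Matrix.kronecker_apply, Matrix.map_apply,
    casimirInt, Matrix.of_apply, smul_eq_mul]
  fin_cases a <;> fin_cases b <;> fin_cases c <;> fin_cases d <;>
    simp [spinZ] <;> norm_num

lemma casimir_mul_spinTwo : casimir * spinTwo = (6 : ℂ) • spinTwo := by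
  have h : ∀ p q, ∑ r, casimirInt p r * spinTwoInt r q = 6 * spinTwoInt p q := by decide
  rw [casimir_eq]
  ext p q
  have hpq := congrArg (Int.cast (R := ℂ)) (h p q)
  push_cast at hpq
  simp only [Matrix.mul_apply, Matrix.map_apply, spinTwo, Matrix.of_apply, Matrix.smul_apply,
    smul_eq_mul, ← mul_div_assoc, ← Finset.sum_div]
  rw [hpq]

/-- The eigenvalues of the Casimir matrix are `0, 2, 6`, and `c² - 2c = 0, 0, 24` there. -/
lemma casimir_mul_self : casimir * casimir = (2 : ℂ) • casimir + (24 : ℂ) • spinTwo := by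
  have h : ∀ p q, ∑ r, casimirInt p r * casimirInt r q
      = 2 * casimirInt p q + 4 * spinTwoInt p q := by decide
  rw [casimir_eq]
  ext p q
  have hpq := congrArg (Int.cast (R := ℂ)) (h p q)
  push_cast at hpq
  simp only [Matrix.mul_apply, Matrix.map_apply, spinTwo, Matrix.of_apply, Matrix.smul_apply,
    smul_eq_mul, Matrix.add_apply]
  rw [hpq]
  ring

lemma spinTwo_conjTranspose : spinTwo.conjTranspose = spinTwo := by
  have h : ∀ p q, spinTwoInt q p = spinTwoInt p q := by decide
  ext p q
  simp [Matrix.conjTranspose_apply, spinTwo, h p q]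

end Spin

section Bond

variable {L : ℕ} {x y : Fin L}

lemma totalSpinSq_eq (hxy : x ≠ y) : totalSpinSq x y = pairOp x y casimir := by
  simp only [totalSpinSq, casimir, pairOp_add, sq, pairOp_mul hxy, siteOp_eq_pairOp_left hxy,
    siteOp_eq_pairOp_right (x := x) (y := y)]

lemma pairOp_spinTwo_eq_self (hxy : x ≠ y) {ψ : Chain L}
    (h : pairOp x y casimir ψ = (6 : ℂ) • ψ) : pairOp x y spinTwo ψ = ψ := by
  have hsq := congrArg (fun T : Op L => T ψ) (congrArg (pairOp x y) casimir_mul_self)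
  simp only [pairOp_mul hxy, pairOp_add, pairOp_smul, mul_apply_eq_comp,
    add_apply, smul_apply, h, map_smul, smul_smul] at hsq
  rw [← sub_eq_iff_eq_add', ← sub_smul] at hsq
  refine smul_right_injective _ (by norm_num : (24 : ℂ) ≠ 0) (hsq.symm.trans ?_)
  norm_num

lemma bond_eq_pairOp_spinTwo (hxy : x ≠ y) : bond x y = pairOp x y spinTwo := by
  have hmem : ∀ ψ : Chain L, ψ ∈ Module.End.eigenspace
      ((totalSpinSq x y : Op L) : Chain L →ₗ[ℂ] Chain L) 6 ↔
      pairOp x y casimir ψ = (6 : ℂ) • ψ := fun ψ => by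
    rw [Module.End.mem_eigenspace_iff, totalSpinSq_eq hxy]
    rfl
  ext1 ψ
  rw [bond]
  refine Submodule.eq_starProjection_of_mem_orthogonal ?_ ?_
  · rw [hmem]
    have h := congrArg (fun T : Op L => T ψ) (congrArg (pairOp x y) casimir_mul_spinTwo)
    simpa only [pairOp_mul hxy, pairOp_smul, mul_apply_eq_comp, smul_apply] using h
  · rw [Submodule.mem_orthogonal]
    intro χ hχ
    rw [inner_sub_right, ← spinTwo_conjTranspose, ← inner_pairOp_left hxy,
      pairOp_spinTwo_eq_self hxy ((hmem χ).1 hχ), sub_self]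

lemma bond_apply (hxy : x ≠ y) (ψ : Chain L) (σ : Fin L → Fin 3) :
    bond x y ψ σ = ∑ s, ∑ t, (spinTwoInt (σ x, σ y) (s, t) : ℂ) / 6 * ψ (upd2 σ x y s t) := by
  rw [bond_eq_pairOp_spinTwo hxy, pairOp_apply]
  rfl

lemma bond_eq_zero_iff (hxy : x ≠ y) (ψ : Chain L) :
    bond x y ψ = 0 ↔ ∀ σ, ψ (upd2 σ x y 0 0) = 0 ∧ ψ (upd2 σ x y 2 2) = 0 ∧
      ψ (upd2 σ x y 0 1) + ψ (upd2 σ x y 1 0) = 0 ∧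
      ψ (upd2 σ x y 2 1) + ψ (upd2 σ x y 1 2) = 0 ∧
      ψ (upd2 σ x y 0 2) + ψ (upd2 σ x y 2 0) + 2 * ψ (upd2 σ x y 1 1) = 0 := by
  constructor
  · intro h σ
    have eval : ∀ s t, ∑ s', ∑ t',
        (spinTwoInt (s, t) (s', t') : ℂ) / 6 * ψ (upd2 σ x y s' t') = 0 := fun s t => by
      have hst := bond_apply hxy ψ (upd2 σ x y s t)
      simpa only [h, upd2_left hxy, upd2_right, upd2_upd2 hxy, PiLp.zero_apply, eq_comm] using hst
    simp only [Fin.sum_univ_three, spinTwoInt, spinTwoCoeff] at eval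
    refine ⟨by simpa [Fin.ofNat] using eval 0 0, by simpa [Fin.ofNat] using eval 2 2, ?_, ?_, ?_⟩
    · have h01 : 3 / 6 * ψ (upd2 σ x y 0 1) + 3 / 6 * ψ (upd2 σ x y 1 0) = 0 := by
        simpa [Fin.ofNat] using eval 0 1
      linear_combination 2 * h01
    · have h21 : 3 / 6 * ψ (upd2 σ x y 1 2) + 3 / 6 * ψ (upd2 σ x y 2 1) = 0 := by
        simpa [Fin.ofNat] using eval 2 1
      linear_combination 2 * h21
    · have h11 : 2 / 6 * ψ (upd2 σ x y 0 2) + 4 / 6 * ψ (upd2 σ x y 1 1)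
          + 2 / 6 * ψ (upd2 σ x y 2 0) = 0 := by
        simpa [Fin.ofNat] using eval 1 1
      linear_combination 3 * h11
  · intro h
    ext σ
    obtain ⟨h00, h22, h01, h21, h11⟩ := h σ
    rw [← eq_neg_iff_add_eq_zero] at h01 h21
    rw [add_assoc, ← eq_neg_iff_add_eq_zero] at h11
    rw [bond_apply hxy]
    generalize σ x = s, σ y = t
    fin_cases s <;> fin_cases t <;>
      simp [Fin.sum_univ_three, spinTwoInt, spinTwoCoeff, Fin.ofNat, h00, h22, h01, h21, h11] <;>
      ring

end Bond

section GroundSpace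

variable {L : ℕ}

lemma inner_bond_left (x y : Fin L) (ψ χ : Chain L) :
    inner ℂ (bond x y ψ) χ = inner ℂ ψ (bond x y χ) :=
  Submodule.inner_starProjection_left_eq_right _ _ _

lemma bond_bond (x y : Fin L) (ψ : Chain L) : bond x y (bond x y ψ) = bond x y ψ := by
  rw [bond, Submodule.starProjection_eq_self_iff]
  exact Submodule.starProjection_apply_mem _ _

lemma inner_bond_self (x y : Fin L) (ψ : Chain L) :
    inner ℂ ψ (bond x y ψ) = ((‖bond x y ψ‖ ^ 2 : ℝ) : ℂ) := by
  rw [← bond_bond, ← inner_bond_left, bond_bond, inner_self_eq_norm_sq_to_K]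
  simp

lemma ham_apply (L a b : ℕ) (ψ : Chain L) :
    ham L a b ψ = ∑ p : Fin L × Fin L with
      (a ≤ (p.1 : ℕ) ∧ (p.2 : ℕ) = (p.1 : ℕ) + 1 ∧ (p.2 : ℕ) ≤ b), bond p.1 p.2 ψ := by
  simp [ham, sum_apply]

lemma mem_groundSpace_iff_ham {a b : ℕ} {ψ : Chain L} :
    ψ ∈ groundSpace L a b ↔ ham L a b ψ = 0 := by
  rw [groundSpace, LinearMap.mem_ker]
  rfl

/-- The AKLT Hamiltonian is frustration free: its terms are nonnegative, so a zero-energy state has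
zero energy on each bond. -/
lemma mem_groundSpace_iff {a b : ℕ} {ψ : Chain L} :
    ψ ∈ groundSpace L a b ↔ ∀ x y : Fin L, a ≤ (x : ℕ) → (y : ℕ) = x + 1 → (y : ℕ) ≤ b →
      bond x y ψ = 0 := by
  rw [mem_groundSpace_iff_ham]
  refine ⟨fun h x y hx hxy hy => ?_, fun h => ?_⟩
  · have energy : inner ℂ ψ (ham L a b ψ) = 0 := by rw [h, inner_zero_right]
    simp only [ham_apply, inner_sum, inner_bond_self, ← Complex.ofReal_sum] at energy
    rw [Complex.ofReal_eq_zero, Finset.sum_eq_zero_iff_of_nonneg (fun _ _ => by positivity)]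
      at energy
    simpa using energy (x, y) (by simp [hx, hxy]; omega)
  · rw [ham_apply]
    refine Finset.sum_eq_zero fun p hp => ?_
    simp only [Finset.mem_filter, Finset.mem_univ, true_and] at hp
    exact h p.1 p.2 hp.1 hp.2.1 hp.2.2

end GroundSpace

section Exponential

variable {𝔸 : Type*} [NormedRing 𝔸] [NormedAlgebra ℂ 𝔸] [CompleteSpace 𝔸]

lemma exp_smul_of_cube_eq_self (c : ℂ) {T : 𝔸} (hT : T ^ 3 = T) :
    NormedSpace.exp (c • T) = 1 + (Complex.cosh c - 1) • T ^ 2 + Complex.sinh c • T := by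
  have odd_pow : ∀ n : ℕ, T ^ (2 * n + 1) = T := fun n => by
    induction n with
    | zero => simp
    | succ n ih => rw [show 2 * (n + 1) + 1 = 2 + (2 * n + 1) by ring, pow_add, ih, ← pow_succ, hT]
  have heven : HasSum (fun n : ℕ => ((2 * n).factorial⁻¹ : ℂ) • (c • T) ^ (2 * n))
      (Complex.cosh c • T ^ 2 + (1 - T ^ 2)) := by
    convert ((Complex.hasSum_cosh c).smul_const (T ^ 2)).add
      (hasSum_ite_eq 0 (1 - T ^ 2)) using 2 with n
    cases n with
    | zero => simp
    | succ n =>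
      rw [smul_pow, mul_add, mul_one, pow_succ T, odd_pow, ← sq, smul_smul, div_eq_inv_mul]
      simp
  have hodd : HasSum (fun n : ℕ => ((2 * n + 1).factorial⁻¹ : ℂ) • (c • T) ^ (2 * n + 1))
      (Complex.sinh c • T) := by
    convert (Complex.hasSum_sinh c).smul_const T using 2 with n
    rw [smul_pow, odd_pow, smul_smul, div_eq_inv_mul]
  rw [(NormedSpace.exp_series_hasSum_exp' (𝕂 := ℂ) (c • T)).unique (heven.even_add_odd hodd),
    sub_smul, one_smul]
  abel

lemma exp_pi_mul_I_smul_of_cube_eq_self {T : 𝔸} (hT : T ^ 3 = T) :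
    NormedSpace.exp (((Real.pi : ℂ) * I) • T) = 1 - (2 : ℂ) • T ^ 2 := by
  rw [exp_smul_of_cube_eq_self _ hT, Complex.cosh_mul_I, Complex.sinh_mul_I, Complex.cos_pi,
    Complex.sin_pi]
  rw [zero_mul, zero_smul, add_zero, sub_eq_add_neg (1 : 𝔸), ← neg_smul]
  norm_num

end Exponential

section KennedyTasaki

variable {L : ℕ}

lemma rev_iterate_eq_one_iff (n : ℕ) {s : Fin 3} : Fin.rev^[n] s = 1 ↔ s = 1 := by
  have rev_eq_one : ∀ s : Fin 3, Fin.rev s = 1 ↔ s = 1 := by decide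
  induction n with
  | zero => rfl
  | succ n ih => exact Function.iterate_succ_apply' Fin.rev n s ▸ (rev_eq_one _).trans ih

lemma rev_iterate_rev_iterate (n : ℕ) (s : Fin 3) : Fin.rev^[n] (Fin.rev^[n] s) = s := by
  have rev_involutive : Function.Involutive (Fin.rev : Fin 3 → Fin 3) := Fin.rev_rev
  rw [← Function.iterate_add_apply, rev_involutive.iterate_even (Even.add_self n)]
  rfl

lemma rev_iterate_congr {m n : ℕ} (h : m % 2 = n % 2) :
    (Fin.rev : Fin 3 → Fin 3)^[m] = Fin.rev^[n] := by
  have rev_involutive : Function.Involutive (Fin.rev : Fin 3 → Fin 3) := Fin.rev_rev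
  rw [← Nat.mod_add_div m 2, ← Nat.mod_add_div n 2, Function.iterate_add, Function.iterate_add,
    rev_involutive.iterate_two_mul, rev_involutive.iterate_two_mul, h]

lemma spinX_pow_three : spinX ^ 3 = spinX := by
  rw [pow_succ, sq, spinX_mul_self, spinX, Matrix.smul_mul, Matrix.mul_smul, smul_smul, mul_comm,
    ← smul_smul]
  congr 1
  ext i j
  fin_cases i <;> fin_cases j <;> simp <;> norm_num

lemma spinZ_pow_three : spinZ ^ 3 = spinZ := by
  rw [pow_succ, sq, spinZ_mul_self]
  ext i j
  fin_cases i <;> fin_cases j <;> simp [spinZ, Matrix.mul_apply, Fin.sum_univ_three]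

/-- The factor `exp(iπ S_j^z S_k^x)` of the Kennedy–Tasaki transformation, for `p = (j, k)`. -/
def ktFactor (p : Fin L × Fin L) : Op L :=
  NormedSpace.exp (((Real.pi : ℂ) * I) • (siteOp p.1 spinZ * siteOp p.2 spinX))

lemma ktFactor_apply {j k : Fin L} (hjk : j ≠ k) (ψ : Chain L) (σ : Fin L → Fin 3) :
    ktFactor (j, k) ψ σ =
      if σ j = 1 then ψ σ else -ψ (Function.update σ k (Fin.rev (σ k))) := by
  have hcube : pairOp j k (spinZ ⊗ₖ spinX) ^ 3 = pairOp j k (spinZ ⊗ₖ spinX) := by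
    rw [pow_succ, sq, ← pairOp_mul hjk, ← pairOp_mul hjk, ← Matrix.mul_kronecker_mul,
      ← Matrix.mul_kronecker_mul, ← sq, ← sq, ← pow_succ, ← pow_succ, spinX_pow_three,
      spinZ_pow_three]
  have entries : ∀ (s t : Fin 3) (f : Fin 3 → Fin 3 → ℂ),
      f s t - 2 * ∑ s', ∑ t', ((!![1, 0, 0; 0, 0, 0; 0, 0, 1] : Matrix (Fin 3) (Fin 3) ℂ) ⊗ₖ
        ((1 / 2 : ℂ) • !![1, 0, 1; 0, 2, 0; 1, 0, 1])) (s, t) (s', t') * f s' t'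
      = if s = 1 then f s t else -f s (Fin.rev t) := by
    intro s t f
    fin_cases s <;> fin_cases t <;> simp [Fin.sum_univ_three, Fin.rev] <;> ring
  have h := entries (σ j) (σ k) fun s t => ψ (upd2 σ j k s t)
  rw [upd2_self, show upd2 σ j k (σ j) (Fin.rev (σ k))
    = Function.update σ k (Fin.rev (σ k)) by simp [upd2]] at h
  rw [ktFactor, siteOp_mul_siteOp hjk, exp_pi_mul_I_smul_of_cube_eq_self hcube, sq,
    ← pairOp_mul hjk, ← Matrix.mul_kronecker_mul, spinX_mul_self, spinZ_mul_self, ← h]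
  rfl

/-- The indicator of a nonzero spin. -/
def occ (s : Fin 3) : ℕ := if s = 1 then 0 else 1

lemma occ_rev_iterate (n : ℕ) (s : Fin 3) : occ (Fin.rev^[n] s) = occ s := by
  simp [occ, rev_iterate_eq_one_iff]

lemma occ_update_rev (σ : Fin L → Fin 3) (k j : Fin L) :
    occ (Function.update σ k (Fin.rev (σ k)) j) = occ (σ j) := by
  rcases eq_or_ne j k with rfl | hjk
  · simpa using occ_rev_iterate 1 (σ j)
  · simp [hjk]

lemma prod_ktFactor_apply (l : List (Fin L × Fin L)) (hl : ∀ p ∈ l, p.1 ≠ p.2)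
    (ψ : Chain L) (σ : Fin L → Fin 3) :
    (l.map ktFactor).prod ψ σ = (-1) ^ (l.map fun p => occ (σ p.1)).sum *
      ψ (fun k => Fin.rev^[(l.map fun p => if p.2 = k then occ (σ p.1) else 0).sum] (σ k)) := by
  induction l generalizing σ with
  | nil => simp
  | cons p l ih =>
    have ih' := ih fun q hq => hl q (List.mem_cons_of_mem _ hq)
    rw [List.map_cons, List.prod_cons, mul_apply_eq_comp, show p = (p.1, p.2) from rfl,
      ktFactor_apply (hl p List.mem_cons_self)]
    by_cases hp : σ p.1 = 1
    · simp [hp, ih', occ]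
    · have hocc : occ (σ p.1) = 1 := by simp [occ, hp]
      have hconfig : (fun k => Fin.rev^[(l.map fun q => if q.2 = k then occ (σ q.1) else 0).sum]
          (Function.update σ p.2 (Fin.rev (σ p.2)) k))
          = fun k => Fin.rev^[(if p.2 = k then 1 else 0)
            + (l.map fun q => if q.2 = k then occ (σ q.1) else 0).sum] (σ k) := by
        funext k
        rcases eq_or_ne p.2 k with rfl | hk
        · simp [Nat.add_comm 1]
        · simp [hk, hk.symm]
      simp only [hp, if_false, ih', occ_update_rev, List.map_cons, List.sum_cons, hocc, pow_add,
        hconfig]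
      ring

/-- The number of nonzero spins to the left of `k`. -/
def leftOcc (σ : Fin L → Fin 3) (k : Fin L) : ℕ := ∑ j, if j < k then occ (σ j) else 0

/-- The configuration to which the Kennedy–Tasaki transformation, a signed permutation of the
product basis, moves `σ`: each spin is reversed once for each nonzero spin to its left. -/
def ktConfig (σ : Fin L → Fin 3) (k : Fin L) : Fin 3 := Fin.rev^[leftOcc σ k] (σ k)

lemma leftOcc_ktConfig (σ : Fin L → Fin 3) : leftOcc (ktConfig σ) = leftOcc σ := by
  funext k
  simp [leftOcc, ktConfig, occ_rev_iterate]

lemma ktConfig_involutive : Function.Involutive (ktConfig : (Fin L → Fin 3) → Fin L → Fin 3) :=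
  fun σ => funext fun k => by
    rw [ktConfig, leftOcc_ktConfig, ktConfig, rev_iterate_rev_iterate]

lemma sum_map_finRange_product_filter_lt {β : Type*} [AddCommMonoid β] (f : Fin L × Fin L → β) :
    (((List.finRange L ×ˢ List.finRange L).filter fun p => p.1 < p.2).map f).sum
      = ∑ k, ∑ j, if j < k then f (j, k) else 0 := by
  have hnodup : ((List.finRange L ×ˢ List.finRange L).filter fun p => p.1 < p.2).Nodup :=
    (List.Nodup.product (List.nodup_finRange L) (List.nodup_finRange L)).filter _
  rw [Finset.sum_comm, ← Fintype.sum_prod_type' (fun j k => if j < k then f (j, k) else 0),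
    ← Finset.sum_filter (p := fun p : Fin L × Fin L => p.1 < p.2), ← List.sum_toFinset _ hnodup]
  congr 1
  ext ⟨j, k⟩
  simp only [Finset.mem_filter, Finset.mem_univ, true_and, List.mem_toFinset, List.mem_filter,
    decide_eq_true_eq]
  exact and_iff_right (List.pair_mem_product.2 ⟨List.mem_finRange _, List.mem_finRange _⟩)

lemma kennedyTasaki_apply (ψ : Chain L) (σ : Fin L → Fin 3) :
    kennedyTasaki L ψ σ = (-1) ^ (∑ k, leftOcc σ k) * ψ (ktConfig σ) := by
  have h := prod_ktFactor_apply ((List.finRange L ×ˢ List.finRange L).filter fun p => p.1 < p.2)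
    (fun p hp => (of_decide_eq_true (List.mem_filter.1 hp).2).ne) ψ σ
  simp only [sum_map_finRange_product_filter_lt] at h
  refine h.trans ?_
  congr 1
  refine congrArg ψ.ofLp (funext fun k => ?_)
  rw [ktConfig, leftOcc, Finset.sum_eq_single k (fun k' _ hk' => by simp [hk']) (by simp)]
  simp

lemma kennedyTasaki_mul_self (L : ℕ) : kennedyTasaki L * kennedyTasaki L = 1 := by
  ext ψ σ
  rw [mul_apply_eq_comp, kennedyTasaki_apply, kennedyTasaki_apply, ktConfig_involutive,
    leftOcc_ktConfig, ← mul_assoc, ← pow_add, Even.neg_one_pow (Even.add_self _), one_mul]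
  rfl

lemma kennedyTasaki_kennedyTasaki (ψ : Chain L) :
    kennedyTasaki L (kennedyTasaki L ψ) = ψ := by
  rw [← mul_apply_eq_comp, kennedyTasaki_mul_self]
  rfl

lemma inner_kennedyTasaki_left (ψ χ : Chain L) :
    inner ℂ (kennedyTasaki L ψ) χ = inner ℂ ψ (kennedyTasaki L χ) := by
  simp only [PiLp.inner_apply, RCLike.inner_apply, kennedyTasaki_apply, map_mul, map_pow, map_neg,
    map_one]
  refine Fintype.sum_equiv ktConfig_involutive.toPerm _ _ fun σ => ?_
  rw [Function.Involutive.coe_toPerm, ktConfig_involutive, leftOcc_ktConfig]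
  ring

lemma star_kennedyTasaki (L : ℕ) : star (kennedyTasaki L) = kennedyTasaki L := by
  rw [ContinuousLinearMap.star_eq_adjoint, eq_comm, ContinuousLinearMap.eq_adjoint_iff]
  exact inner_kennedyTasaki_left

lemma kennedyTasaki_mem_unitary (L : ℕ) : kennedyTasaki L ∈ unitary (Op L) := by
  rw [Unitary.mem_iff, star_kennedyTasaki, kennedyTasaki_mul_self]
  exact ⟨rfl, rfl⟩

end KennedyTasaki

section StringCond

variable {L : ℕ} {x y : Fin L}

lemma leftOcc_upd2 (hne : x ≠ y) (σ : Fin L → Fin 3) (s t : Fin 3) (k : Fin L) :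
    leftOcc (upd2 σ x y s t) k = leftOcc (upd2 σ x y 1 1) k
      + (if x < k then occ s else 0) + (if y < k then occ t else 0) := by
  have hterm : ∀ j, (if j < k then occ (upd2 σ x y s t j) else 0)
      = (if j < k then occ (upd2 σ x y 1 1 j) else 0)
        + (if j = x then (if x < k then occ s else 0) else 0)
        + (if j = y then (if y < k then occ t else 0) else 0) := fun j => by
    by_cases hx : j = x
    · subst hx; simp [upd2_left hne, hne, occ]
    by_cases hy : j = y
    · subst hy; simp [hne.symm, occ]
    · simp [upd2_of_ne hx hy, hx, hy]
  simp only [leftOcc, hterm, Finset.sum_add_distrib, Finset.sum_ite_eq', Finset.mem_univ, if_true]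

/-- The sites to the right of both `x` and `y` see the pair through `occ s + occ t`; in addition,
`y` sees `x`. -/
lemma sum_leftOcc_upd2 (hxy : (y : ℕ) = x + 1) (σ : Fin L → Fin 3) (s t : Fin 3) :
    ∑ k, leftOcc (upd2 σ x y s t) k
      = ∑ k, leftOcc (upd2 σ x y 1 1) k + occ s + #{k | y < k} * (occ s + occ t) := by
  have hx : ∀ k : Fin L, (if x < k then occ s else 0)
      = (if k = y then occ s else 0) + (if y < k then occ s else 0) := fun k => by
    simp only [Fin.lt_def, Fin.ext_iff, hxy]
    split_ifs <;> omega
  have hne : x ≠ y := by rintro rfl; omega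
  simp only [leftOcc_upd2 hne σ s t, hx, Finset.sum_add_distrib, Finset.sum_ite_eq',
    Finset.mem_univ, if_true, ← Finset.sum_filter, Finset.sum_const, smul_eq_mul]
  ring

lemma leftOcc_upd2_one_one (hxy : (y : ℕ) = x + 1) (σ : Fin L → Fin 3) :
    leftOcc (upd2 σ x y 1 1) y = leftOcc (upd2 σ x y 1 1) x := by
  have hne : x ≠ y := by rintro rfl; omega
  refine Finset.sum_congr rfl fun j _ => ?_
  rcases eq_or_ne j x with rfl | hj
  · simp [upd2_left hne, occ]
  · have hlt : j < y ↔ j < x := by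
      have := Fin.val_ne_of_ne hj
      rw [Fin.lt_def, Fin.lt_def]
      omega
    simp [hlt]

lemma ktConfig_upd2 (hxy : (y : ℕ) = x + 1) (σ : Fin L → Fin 3) {s t : Fin 3} {q : ℕ}
    (hq : (occ s + occ t) % 2 = q % 2) :
    ktConfig (upd2 σ x y s t) = upd2
      (fun k => Fin.rev^[leftOcc (upd2 σ x y 1 1) k + if y < k then q else 0] (σ k)) x y
      (Fin.rev^[leftOcc (upd2 σ x y 1 1) x] s)
      (Fin.rev^[leftOcc (upd2 σ x y 1 1) x] (Fin.rev^[occ s] t)) := by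
  have hne : x ≠ y := by rintro rfl; omega
  funext k
  rw [ktConfig, leftOcc_upd2 hne]
  rcases eq_or_ne k x with rfl | hx
  · have hyk : ¬ y < k := by rw [Fin.lt_def]; omega
    simp [upd2_left hne, hyk]
  rcases eq_or_ne k y with rfl | hy
  · have hxk : x < k := by rw [Fin.lt_def]; omega
    simp [upd2_right, hxk, leftOcc_upd2_one_one hxy, Function.iterate_add_apply]
  · have hlt : x < k ↔ y < k := by
      have := Fin.val_ne_of_ne hy
      rw [Fin.lt_def, Fin.lt_def]
      omega
    rw [upd2_of_ne hx hy, upd2_of_ne hx hy]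
    refine congrFun (rev_iterate_congr ?_) _
    simp only [hlt]
    split_ifs <;> omega

/-- The signed permutation at two neighbouring sites acts on the pairs of a given parity `q` of
`occ s + occ t` by one and the same sign and configuration of the other sites. -/
lemma exists_kennedyTasaki_upd2 (hxy : (y : ℕ) = x + 1) (σ : Fin L → Fin 3) (q : ℕ) :
    ∃ (ε : ℂ) (τ : Fin L → Fin 3) (f : Fin 3 → Fin 3), (f = id ∨ f = Fin.rev) ∧
      ∀ s t : Fin 3, (occ s + occ t) % 2 = q % 2 → ∀ ψ : Chain L,
        kennedyTasaki L ψ (upd2 σ x y s t)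
          = ε * (-1) ^ occ s * ψ (upd2 τ x y (f s) (f (Fin.rev^[occ s] t))) := by
  refine ⟨(-1) ^ (∑ k, leftOcc (upd2 σ x y 1 1) k + #{k | y < k} * q),
    fun k => Fin.rev^[leftOcc (upd2 σ x y 1 1) k + if y < k then q else 0] (σ k),
    Fin.rev^[leftOcc (upd2 σ x y 1 1) x], ?_, fun s t hst ψ => ?_⟩
  · have rev_involutive : Function.Involutive (Fin.rev : Fin 3 → Fin 3) := Fin.rev_rev
    exact (Nat.even_or_odd _).imp rev_involutive.iterate_even rev_involutive.iterate_odd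
  · rw [kennedyTasaki_apply, ktConfig_upd2 hxy σ hst, sum_leftOcc_upd2 hxy]
    congr 1
    rw [pow_add, pow_add, pow_add, mul_comm _ q, mul_comm _ (occ s + occ t), pow_mul, pow_mul,
      neg_one_pow_eq_pow_mod_two (n := occ s + occ t), hst, ← neg_one_pow_eq_pow_mod_two]
    ring

/-- The equations satisfied by the Kennedy–Tasaki transforms of the states of two sites with total
spin at most 1. -/
def PairCond (F : Fin 3 → Fin 3 → ℂ) : Prop :=
  F 0 2 = 0 ∧ F 2 0 = 0 ∧ F 0 1 = F 1 0 ∧ F 2 1 = F 1 2 ∧ F 0 0 + F 2 2 = 2 * F 1 1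

/-- `PairCond` at the sites `x, y` of a chain, for all configurations of the other sites. -/
def StringCond (x y : Fin L) (χ : Chain L) : Prop :=
  ∀ σ, PairCond fun s t => χ (upd2 σ x y s t)

lemma kennedyTasaki_exchange_bond_stringCond (hxy : (y : ℕ) = x + 1) (ψ : Chain L) :
    (bond x y ψ = 0 → StringCond x y (kennedyTasaki L ψ)) ∧
      (StringCond x y ψ → bond x y (kennedyTasaki L ψ) = 0) := by
  have hne : x ≠ y := by rintro rfl; omega
  rw [bond_eq_zero_iff hne, bond_eq_zero_iff hne]
  simp only [StringCond, PairCond]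
  constructor <;> intro h σ <;>
  · obtain ⟨ε₀, τ₀, f₀, hf₀, even⟩ := exists_kennedyTasaki_upd2 hxy σ 0
    obtain ⟨ε₁, τ₁, f₁, hf₁, odd⟩ := exists_kennedyTasaki_upd2 hxy σ 1
    rw [even 0 2 rfl, even 2 0 rfl, even 0 0 rfl, even 2 2 rfl, even 1 1 rfl, odd 0 1 rfl,
      odd 1 0 rfl, odd 2 1 rfl, odd 1 2 rfl]
    obtain ⟨h1, h2, -, -, h5⟩ := h τ₀
    obtain ⟨-, -, h3, h4, -⟩ := h τ₁
    rcases hf₀ with rfl | rfl <;> rcases hf₁ with rfl | rfl <;>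
      refine ⟨?_, ?_, ?_, ?_, ?_⟩ <;>
      first
        | (simp [occ, Fin.rev, h1, h2]; done)
        | (simp [occ, Fin.rev]; linear_combination (-ε₁) * h3)
        | (simp [occ, Fin.rev]; linear_combination (-ε₁) * h4)
        | (simp [occ, Fin.rev]; linear_combination (-ε₀) * h5)

lemma stringCond_kennedyTasaki_iff (hxy : (y : ℕ) = x + 1) {ψ : Chain L} :
    StringCond x y (kennedyTasaki L ψ) ↔ bond x y ψ = 0 :=
  ⟨fun h => by
    simpa only [kennedyTasaki_kennedyTasaki]
      using (kennedyTasaki_exchange_bond_stringCond hxy _).2 h,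
    (kennedyTasaki_exchange_bond_stringCond hxy ψ).1⟩

/-- The image of the ground state space under the Kennedy–Tasaki transformation. -/
def stringSpace (L a b : ℕ) : Submodule ℂ (Chain L) :=
  (groundSpace L a b).map (kennedyTasaki L : Chain L →ₗ[ℂ] Chain L)

lemma kennedyTasaki_mem_stringSpace_iff {a b : ℕ} {ψ : Chain L} :
    kennedyTasaki L ψ ∈ stringSpace L a b ↔ ψ ∈ groundSpace L a b := by
  refine ⟨fun ⟨χ, hχ, h⟩ => ?_, fun h => ⟨ψ, h, rfl⟩⟩
  have : χ = ψ := Function.LeftInverse.injective kennedyTasaki_kennedyTasaki h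
  exact this ▸ hχ

lemma mem_stringSpace_iff {a b : ℕ} {χ : Chain L} :
    χ ∈ stringSpace L a b ↔ ∀ x y : Fin L, a ≤ (x : ℕ) → (y : ℕ) = x + 1 → (y : ℕ) ≤ b →
      StringCond x y χ := by
  rw [← kennedyTasaki_kennedyTasaki χ, kennedyTasaki_mem_stringSpace_iff, mem_groundSpace_iff]
  exact forall₅_congr fun x y _ hxy _ => (stringCond_kennedyTasaki_iff hxy).symm

end StringCond

section ProductVector

variable {L : ℕ}

/-- The product vector with one-site factors `f x`. -/
def prodVec (f : Fin L → Fin 3 → ℂ) : Chain L :=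
  WithLp.toLp 2 fun σ => ∏ x, f x (σ x)

lemma prodVec_apply (f : Fin L → Fin 3 → ℂ) (σ : Fin L → Fin 3) :
    prodVec f σ = ∏ x, f x (σ x) := rfl

/-- The inner product of one-site vectors. -/
def siteInner (u v : Fin 3 → ℂ) : ℂ := ∑ s, (starRingEnd ℂ) (u s) * v s

lemma inner_prodVec (f g : Fin L → Fin 3 → ℂ) :
    inner ℂ (prodVec f) (prodVec g) = ∏ x, siteInner (f x) (g x) := by
  simp only [PiLp.inner_apply, RCLike.inner_apply, prodVec_apply, map_prod,
    ← Finset.prod_mul_distrib, siteInner]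
  rw [Fintype.prod_sum (fun x s => (starRingEnd ℂ) (f x s) * g x s)]
  exact Finset.sum_congr rfl fun σ _ => Finset.prod_congr rfl fun x _ => mul_comm _ _

lemma prodVec_upd2 {x y : Fin L} (hxy : x ≠ y) (f : Fin L → Fin 3 → ℂ) (σ : Fin L → Fin 3)
    (s t : Fin 3) : prodVec f (upd2 σ x y s t)
      = (∏ z ∈ (Finset.univ.erase x).erase y, f z (σ z)) * (f x s * f y t) := by
  have hy : y ∈ Finset.univ.erase x := Finset.mem_erase.2 ⟨hxy.symm, Finset.mem_univ y⟩
  rw [prodVec_apply, ← Finset.mul_prod_erase _ _ (Finset.mem_univ x),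
    ← Finset.mul_prod_erase _ _ hy, upd2_left hxy, upd2_right, ← mul_assoc, mul_comm]
  congr 1
  refine Finset.prod_congr rfl fun z hz => ?_
  simp only [Finset.mem_erase] at hz
  rw [upd2_of_ne hz.2.1 hz.1]

end ProductVector

section PairCond

lemma sqrt_two_mul_self : (Real.sqrt 2 : ℂ) * (Real.sqrt 2 : ℂ) = 2 := by
  rw [← Complex.ofReal_mul, Real.mul_self_sqrt zero_le_two, Complex.ofReal_ofNat]

lemma sqrt_three_mul_self : (Real.sqrt 3 : ℂ) * (Real.sqrt 3 : ℂ) = 3 := by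
  rw [← Complex.ofReal_mul, Real.mul_self_sqrt zero_le_three, Complex.ofReal_ofNat]

lemma sqrt_two_ne_zero : (Real.sqrt 2 : ℂ) ≠ 0 :=
  left_ne_zero_of_mul (sqrt_two_mul_self.trans_ne two_ne_zero)

lemma sqrt_three_ne_zero : (Real.sqrt 3 : ℂ) ≠ 0 :=
  left_ne_zero_of_mul (sqrt_three_mul_self.trans_ne three_ne_zero)

lemma phi_one (i : Fin 4) : phi i 1 = (Real.sqrt 3 : ℂ)⁻¹ := by
  fin_cases i <;> simp [phi]

lemma phi_add_two (i : Fin 4) (s : Fin 3) : phi (i + 2) s = phi i s.rev := by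
  fin_cases i <;> fin_cases s <;> simp [phi]

variable {F : Fin 3 → Fin 3 → ℂ}

lemma PairCond.const_mul (h : PairCond F) (c : ℂ) : PairCond fun s t => c * F s t := by
  obtain ⟨h1, h2, h3, h4, h5⟩ := h
  refine ⟨?_, ?_, ?_, ?_, ?_⟩ <;> simp only [h1, h2, h3, h4, mul_zero]
  linear_combination c * h5

lemma PairCond.rev (h : PairCond F) : PairCond fun s t => F s.rev t.rev := by
  obtain ⟨h1, h2, h3, h4, h5⟩ := h
  exact ⟨h2, h1, h4, h3, (add_comm _ _).trans h5⟩

lemma pairCond_phi (i : Fin 4) : PairCond fun s t => phi i s * phi i t := by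
  fin_cases i <;> simp [PairCond, phi, div_mul_div_comm, sqrt_two_mul_self] <;> ring_nf <;> simp

/-- The coefficients of a solution of `PairCond` in the product states `φ_i ⊗ φ_i`. -/
def pairCoeff (F : Fin 3 → Fin 3 → ℂ) : Fin 4 → ℂ :=
  ![3 / 4 * F 0 0 + 3 / 2 / (Real.sqrt 2 : ℂ) * F 0 1,
    3 / 4 * F 0 0 - 3 / 2 / (Real.sqrt 2 : ℂ) * F 0 1,
    3 / 4 * F 2 2 + 3 / 2 / (Real.sqrt 2 : ℂ) * F 2 1,
    3 / 4 * F 2 2 - 3 / 2 / (Real.sqrt 2 : ℂ) * F 2 1]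

lemma PairCond.eq_sum (h : PairCond F) (s t : Fin 3) :
    F s t = ∑ i, pairCoeff F i * (phi i s * phi i t) := by
  obtain ⟨h1, h2, h3, h4, h5⟩ := h
  have n2 := sqrt_two_ne_zero
  have h6 : F 1 1 = (F 0 0 + F 2 2) / 2 := by rw [h5]; ring
  fin_cases s <;> fin_cases t <;>
    simp [pairCoeff, Fin.sum_univ_four, phi, div_mul_div_comm, sqrt_two_mul_self,
      sqrt_three_mul_self, h1, h2, ← h3, ← h4, h6] <;>
    field_simp <;> ring_nf

/-- When a site is appended to an interval whose first spin is `+`, only `φ_1` and `φ_2` contribute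
on the interval, and the new site has to be in the same state. -/
lemma PairCond.append_plus {c : Fin 4 → Fin 3 → ℂ}
    (h : PairCond fun t s => ∑ i, c i s * (phi i 0 * phi i t)) (s : Fin 3) :
    c 0 s = (Real.sqrt 3 : ℂ) * c 0 1 * phi 0 s ∧ c 1 s = (Real.sqrt 3 : ℂ) * c 1 1 * phi 1 s := by
  have e2 := sqrt_two_mul_self
  have n2 := sqrt_two_ne_zero
  have := sqrt_three_ne_zero
  obtain ⟨h1, -, h3, h4, h5⟩ := h
  have h1 : c 0 2 * (2 / 3) + c 1 2 * (2 / 3) = 0 := by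
    simpa [Fin.sum_univ_four, phi, div_mul_div_comm, e2, sqrt_three_mul_self] using h1
  have h3 : c 0 1 * (2 / 3) + c 1 1 * (2 / 3)
      = c 0 0 * ((Real.sqrt 2 : ℂ) / 3) + c 1 0 * (-(Real.sqrt 2 : ℂ) / 3) := by
    simpa [Fin.sum_univ_four, phi, div_mul_div_comm, e2, sqrt_three_mul_self] using h3
  have h4 : 0 = c 0 2 * ((Real.sqrt 2 : ℂ) / 3) + c 1 2 * (-(Real.sqrt 2 : ℂ) / 3) := by
    simpa [Fin.sum_univ_four, phi, div_mul_div_comm, e2, sqrt_three_mul_self] using h4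
  have h5 : c 0 0 * (2 / 3) + c 1 0 * (2 / 3)
      = 2 * (c 0 1 * ((Real.sqrt 2 : ℂ) / 3) + c 1 1 * (-(Real.sqrt 2 : ℂ) / 3)) := by
    simpa [Fin.sum_univ_four, phi, div_mul_div_comm, e2, sqrt_three_mul_self] using h5
  set r : ℂ := (Real.sqrt 2 : ℂ) with hr
  have k1 : c 0 2 = 0 := by
    refine (mul_eq_zero.1 (?_ : r * c 0 2 = 0)).resolve_left n2
    linear_combination (3 * r / 4) * h1 - (3 / 2) * h4
  have k2 : c 1 2 = 0 := by linear_combination (3 / 2) * h1 - k1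
  have k3 : c 0 0 = r * c 0 1 := by
    refine mul_left_cancel₀ n2 ?_
    linear_combination (3 * r / 4) * h5 - (3 / 2) * h3 - (1 / 2) * (c 0 1 + c 1 1) * e2
  have k4 : c 1 0 = -r * c 1 1 := by
    refine mul_left_cancel₀ n2 ?_
    linear_combination (3 * r / 4) * h5 + (3 / 2) * h3 + (1 / 2) * (c 0 1 + c 1 1) * e2
  fin_cases s <;> simp [phi, k1, k2, k3, k4, ← hr] <;> constructor <;> field_simp

lemma PairCond.append_minus {c : Fin 4 → Fin 3 → ℂ}
    (h : PairCond fun t s => ∑ i, c i s * (phi i 2 * phi i t)) (s : Fin 3) :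
    c 2 s = (Real.sqrt 3 : ℂ) * c 2 1 * phi 2 s ∧ c 3 s = (Real.sqrt 3 : ℂ) * c 3 1 * phi 3 s := by
  have h' : PairCond fun t s => ∑ i : Fin 4, c (i + 2) s.rev * (phi i 0 * phi i t) := by
    convert h.rev using 3 with t s
    rw [← Equiv.sum_comp (Equiv.addRight (2 : Fin 4))]
    simp only [Equiv.coe_addRight, phi_add_two]
    rfl
  have := h'.append_plus s.rev
  rwa [Fin.rev_rev, ← phi_add_two, ← phi_add_two] at this

end PairCond

section ProductForm

variable {L : ℕ} {I : Finset (Fin L)} {χ : Chain L}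

/-- The vector `χ` is a combination of the four product states on the sites of `I`, with
coefficients `g i` that are states of the other sites. -/
def HasProductForm (I : Finset (Fin L)) (χ : Chain L) (g : Fin 4 → (Fin L → Fin 3) → ℂ) : Prop :=
  (∀ i, DependsOn (g i) (↑I)ᶜ) ∧ ∀ σ, χ σ = ∑ i, g i σ * ∏ x ∈ I, phi i (σ x)

lemma StringCond.hasProductForm {x y : Fin L} (hxy : x ≠ y) (h : StringCond x y χ) :
    HasProductForm {x, y} χ fun i σ => pairCoeff (fun s t => χ (upd2 σ x y s t)) i := by
  refine ⟨fun i σ τ hστ => ?_, fun σ => ?_⟩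
  · have : ∀ s t, upd2 σ x y s t = upd2 τ x y s t := fun s t => by
      funext z
      simp only [upd2, Function.update_apply]
      split_ifs with hy hx
      · rfl
      · rfl
      · exact hστ z (by simp [hx, hy])
    simp only [this]
  · rw [Finset.sum_congr rfl fun i _ => by rw [Finset.prod_pair hxy], ← (h σ).eq_sum (σ x) (σ y),
      upd2_self]

/-- To isolate the coefficients, evaluate at a configuration with a prescribed spin at `x` and zero
spin elsewhere on `I`. -/
lemma HasProductForm.pairCond {x y z : Fin L} (hx : x ∈ I) (hy : y ∈ I) (hxy : x ≠ y) (hz : z ∉ I)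
    {g : Fin 4 → (Fin L → Fin 3) → ℂ} (hg : HasProductForm I χ g) (h : StringCond y z χ)
    (v : Fin 3) (σ : Fin L → Fin 3) :
    PairCond fun t s => ∑ i, g i (Function.update σ z s) * (phi i v * phi i t) := by
  have hxz : x ≠ z := ne_of_mem_of_not_mem hx hz
  have hyz : y ≠ z := ne_of_mem_of_not_mem hy hz
  let ρ : Fin L → Fin 3 := fun w => if w ∈ I then (if w = x then v else 1) else σ w
  let κ : ℂ := ∏ _w ∈ (I.erase y).erase x, (Real.sqrt 3 : ℂ)⁻¹
  have hκ : κ ≠ 0 := Finset.prod_ne_zero_iff.2 fun _ _ => inv_ne_zero sqrt_three_ne_zero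
  have hcoeff : ∀ i t s, g i (upd2 ρ y z t s) = g i (Function.update σ z s) := fun i t s => by
    refine hg.1 i fun w hw => ?_
    have hwy : w ≠ y := by rintro rfl; exact hw hy
    by_cases hwz : w = z
    · subst hwz; simp
    · simp [upd2_of_ne hwy hwz, ρ, mt Finset.mem_coe.2 hw, hwz]
  have hprod : ∀ i t s, ∏ w ∈ I, phi i (upd2 ρ y z t s w) = κ * (phi i v * phi i t) :=
    fun i t s => by
      rw [← Finset.mul_prod_erase I _ hy,
        ← Finset.mul_prod_erase _ _ (Finset.mem_erase.2 ⟨hxy, hx⟩), upd2_left hyz,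
        upd2_of_ne hxy hxz, Finset.prod_congr rfl (g := fun _ => (Real.sqrt 3 : ℂ)⁻¹)]
      · simp only [ρ, hx, if_true, κ]
        ring
      · intro w hw
        simp only [Finset.mem_erase] at hw
        rw [upd2_of_ne hw.2.1 (ne_of_mem_of_not_mem hw.2.2 hz), ← phi_one i]
        simp [ρ, hw.2.2, hw.1]
  have hρ : ∀ t s, χ (upd2 ρ y z t s)
      = κ * ∑ i, g i (Function.update σ z s) * (phi i v * phi i t) := fun t s => by
    simp only [hg.2, hcoeff, hprod, Finset.mul_sum]
    exact Finset.sum_congr rfl fun i _ => by ring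
  simpa only [hρ, inv_mul_cancel_left₀ hκ] using (h ρ).const_mul κ⁻¹

lemma HasProductForm.insert {x y z : Fin L} (hx : x ∈ I) (hy : y ∈ I) (hxy : x ≠ y) (hz : z ∉ I)
    {g : Fin 4 → (Fin L → Fin 3) → ℂ} (hg : HasProductForm I χ g) (h : StringCond y z χ) :
    HasProductForm (insert z I) χ
      fun i σ => (Real.sqrt 3 : ℂ) * g i (Function.update σ z 1) := by
  have hfactor : ∀ i σ, g i σ
      = (Real.sqrt 3 : ℂ) * g i (Function.update σ z 1) * phi i (σ z) := fun i σ => by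
    have plus := (hg.pairCond hx hy hxy hz h 0 σ).append_plus (σ z)
    have minus := (hg.pairCond hx hy hxy hz h 2 σ).append_minus (σ z)
    simp only [Function.update_eq_self] at plus minus
    fin_cases i
    exacts [plus.1, plus.2, minus.1, minus.2]
  refine ⟨fun i σ τ hστ => congrArg _ (hg.1 i fun w hw => ?_), fun σ => ?_⟩
  · by_cases hwz : w = z
    · subst hwz; simp
    · rw [Function.update_of_ne hwz, Function.update_of_ne hwz]
      exact hστ w (by simpa [hwz] using hw)
  · rw [hg.2]
    refine Finset.sum_congr rfl fun i _ => ?_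
    rw [Finset.prod_insert hz, hfactor i σ, mul_assoc]

/-- The states that are combinations of the four product states `φ_i ⊗ ⋯ ⊗ φ_i` on the sites of
`I`, with arbitrary states on the other sites. -/
def productSpan (I : Finset (Fin L)) : Submodule ℂ (Chain L) :=
  Submodule.span ℂ {v | ∃ (i : Fin 4) (f : Fin L → Fin 3 → ℂ), (∀ x ∈ I, f x = phi i) ∧
    v = prodVec f}

lemma prodVec_mem_productSpan {i : Fin 4} {f : Fin L → Fin 3 → ℂ} (hf : ∀ x ∈ I, f x = phi i) :
    prodVec f ∈ productSpan I :=
  Submodule.subset_span ⟨i, f, hf, rfl⟩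

lemma prodVec_piecewise_single_apply (i : Fin 4) (τ σ : Fin L → Fin 3) :
    prodVec (I.piecewise (fun _ => phi i) fun x => Pi.single (τ x) 1) σ
      = if ∀ x ∉ I, σ x = τ x then ∏ x ∈ I, phi i (σ x) else 0 := by
  rw [prodVec_apply, ← Finset.prod_mul_prod_compl I,
    Finset.prod_congr rfl (g := fun x => phi i (σ x)) fun x hx => by simp [hx],
    Finset.prod_congr (s₁ := Iᶜ) rfl (g := fun x => if σ x = τ x then (1 : ℂ) else 0)
      fun x hx => by simp [Finset.mem_compl.1 hx, Pi.single_apply],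
    Finset.prod_ite_zero]
  simp

lemma HasProductForm.mem_productSpan {g : Fin 4 → (Fin L → Fin 3) → ℂ}
    (hg : HasProductForm I χ g) : χ ∈ productSpan I := by
  have hχ : χ = ∑ i, ∑ τ : Fin L → Fin 3, (if ∀ x ∈ I, τ x = 0 then g i τ else 0) •
      prodVec (I.piecewise (fun _ => phi i) fun x => Pi.single (τ x) 1) := by
    ext σ
    rw [hg.2]
    simp only [WithLp.ofLp_sum, Finset.sum_apply, PiLp.smul_apply, smul_eq_mul,
      prodVec_piecewise_single_apply]
    refine Finset.sum_congr rfl fun i _ => ?_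
    rw [Finset.sum_eq_single (I.piecewise (fun _ => 0) σ)]
    · rw [if_pos (by simp +contextual), if_pos (by simp +contextual)]
      congr 1
      exact hg.1 i fun x hx => (I.piecewise_eq_of_notMem _ _ hx).symm
    · intro τ _ hτ
      rw [ite_mul, zero_mul, mul_ite, mul_zero, ← ite_and, if_neg]
      rintro ⟨h0, hσ⟩
      refine hτ (funext fun x => ?_)
      by_cases hx : x ∈ I
      · simp [hx, h0 x hx]
      · simp [hx, hσ x hx]
    · exact fun h => absurd (Finset.mem_univ _) h
  rw [hχ]
  exact Submodule.sum_mem _ fun i _ => Submodule.sum_mem _ fun τ _ =>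
    Submodule.smul_mem _ _ (prodVec_mem_productSpan (i := i) fun x hx => by simp [hx])

end ProductForm

section StringSpace

/-- The sites of the interval `[a, b]`. -/
def sites (L a b : ℕ) : Finset (Fin L) := {x | a ≤ (x : ℕ) ∧ (x : ℕ) ≤ b}

variable {L a b : ℕ}

lemma mem_sites {x : Fin L} : x ∈ sites L a b ↔ a ≤ (x : ℕ) ∧ (x : ℕ) ≤ b := by
  simp [sites]

lemma card_sites (hab : a ≤ b) (hb : b < L) : #(sites L a b) = b - a + 1 := by
  have : (sites L a b).map Fin.valEmbedding = Finset.Icc a b := by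
    ext z
    simp only [Finset.mem_map, mem_sites, Fin.valEmbedding_apply, Finset.mem_Icc]
    exact ⟨fun ⟨_, hx, hz⟩ => hz ▸ hx, fun hz => ⟨⟨z, by omega⟩, hz, rfl⟩⟩
  rw [← Finset.card_map Fin.valEmbedding, this, Nat.card_Icc]
  omega

lemma stringSpace_anti {b' : ℕ} (h : b ≤ b') : stringSpace L a b' ≤ stringSpace L a b := by
  intro χ hχ
  rw [mem_stringSpace_iff] at hχ ⊢
  exact fun x y ha hxy hb => hχ x y ha hxy (hb.trans h)

lemma exists_hasProductForm (hab : a < b) (hb : b < L) {χ : Chain L}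
    (hχ : χ ∈ stringSpace L a b) : ∃ g, HasProductForm (sites L a b) χ g := by
  have ha : a < L := hab.trans hb
  induction b, Nat.succ_le_of_lt hab using Nat.le_induction with
  | base =>
    have hsites : sites L a (a + 1) = {⟨a, ha⟩, ⟨a + 1, hb⟩} := by
      ext z
      simp only [mem_sites, Finset.mem_insert, Finset.mem_singleton, Fin.ext_iff]
      omega
    rw [hsites]
    exact ⟨_, (mem_stringSpace_iff.1 hχ _ _ le_rfl rfl le_rfl).hasProductForm (by simp)⟩
  | succ b hab' ih =>
    obtain ⟨g, hg⟩ := ih hab' (by omega) (stringSpace_anti b.le_succ hχ)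
    have hsites : sites L a (b + 1) = insert ⟨b + 1, hb⟩ (sites L a b) := by
      ext z
      simp only [mem_sites, Finset.mem_insert, Fin.ext_iff]
      omega
    have hcond := mem_stringSpace_iff.1 hχ ⟨b, by omega⟩ ⟨b + 1, hb⟩ (by simp; omega) rfl le_rfl
    rw [hsites]
    refine ⟨_, hg.insert (x := ⟨a, ha⟩) ?_ ?_ ?_ ?_ hcond⟩ <;> simp [mem_sites] <;> omega

lemma stringSpace_eq_productSpan (hab : a < b) (hb : b < L) :
    stringSpace L a b = productSpan (sites L a b) := by
  refine le_antisymm (fun χ hχ => ?_) (Submodule.span_le.2 ?_)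
  · obtain ⟨g, hg⟩ := exists_hasProductForm hab hb hχ
    exact hg.mem_productSpan
  · rintro _ ⟨i, f, hf, rfl⟩
    rw [SetLike.mem_coe, mem_stringSpace_iff]
    intro x y hx hxy hy σ
    have hne : x ≠ y := by rintro rfl; omega
    simp only [prodVec_upd2 hne, hf x (mem_sites.2 ⟨hx, by omega⟩),
      hf y (mem_sites.2 ⟨by omega, hy⟩)]
    exact (pairCond_phi i).const_mul _

end StringSpace

section Gram

/-- Signs by which one has to multiply `φ_1, …, φ_4` to turn all the inner products of two
different ones, which are `±1 / 3`, into `-1 / 3`. -/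
def phiSign : Fin 4 → ℂ := ![1, 1, -1, -1]

lemma phiSign_mul_self (i : Fin 4) : phiSign i * phiSign i = 1 := by
  fin_cases i <;> simp [phiSign]

lemma siteInner_phi (i j : Fin 4) :
    siteInner (phi i) (phi j) = phiSign i * phiSign j * (if i = j then 1 else -1 / 3) := by
  fin_cases i <;> fin_cases j <;>
    simp [siteInner, phi, phiSign, Fin.sum_univ_three, Complex.conj_ofReal, div_mul_div_comm,
      sqrt_two_mul_self, sqrt_three_mul_self] <;>
    norm_num

lemma Phi_eq_prodVec (N : ℕ) (i : Fin 4) : Phi N i = prodVec fun _ => phi i := rfl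

lemma M_apply (N : ℕ) (i j : Fin 4) : M N i j = siteInner (phi i) (phi j) ^ N := by
  simp [M, Phi_eq_prodVec, inner_prodVec]

/-- The Gram matrix of four unit vectors with all mutual inner products equal to `x`. -/
def gram (x : ℂ) : Matrix (Fin 4) (Fin 4) ℂ := Matrix.of fun i j => if i = j then 1 else x

/-- The inverse of `gram x`. -/
def gramInv (x : ℂ) : Matrix (Fin 4) (Fin 4) ℂ :=
  Matrix.of fun i j => ((if i = j then 1 else 0) - x / (1 + 3 * x)) / (1 - x)

lemma gram_mul_gramInv {x : ℂ} (h1 : 1 - x ≠ 0) (h3 : 1 + 3 * x ≠ 0) : gram x * gramInv x = 1 := by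
  have hu : x / (1 + 3 * x) * (1 + 3 * x) = x := div_mul_cancel₀ _ h3
  ext i j
  simp only [Matrix.mul_apply, gram, gramInv, Fin.sum_univ_four, Matrix.of_apply]
  generalize x / (1 + 3 * x) = u at hu
  fin_cases i <;> fin_cases j <;> simp <;> field_simp <;> linear_combination -hu

/-- The diagonal matrix of the `N`-th powers of the signs. -/
def signMatrix (N : ℕ) : Matrix (Fin 4) (Fin 4) ℂ := Matrix.diagonal fun i => phiSign i ^ N

lemma signMatrix_mul_self (N : ℕ) : signMatrix N * signMatrix N = 1 := by
  simp [signMatrix, ← mul_pow, phiSign_mul_self]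

lemma M_eq_signMatrix_mul_gram (N : ℕ) :
    M N = signMatrix N * gram ((-1 / 3) ^ N) * signMatrix N := by
  ext i j
  rw [signMatrix, Matrix.mul_diagonal, Matrix.diagonal_mul, M_apply, siteInner_phi, mul_pow,
    mul_pow, mul_right_comm]
  congr 2
  by_cases h : i = j <;> simp [gram, h]

lemma neg_third_pow_mem_Icc {N : ℕ} (hN : 1 ≤ N) :
    (-1 / 3 : ℝ) ^ N ∈ Set.Icc (-(1 / 3)) (1 / 9) := by
  induction N, hN using Nat.le_induction with
  | base => norm_num
  | succ N _ ih =>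
    rw [pow_succ]
    constructor <;> linarith [ih.1, ih.2]

lemma one_sub_neg_third_pow_ne_zero {N : ℕ} (hN : 1 ≤ N) : 1 - (-1 / 3 : ℂ) ^ N ≠ 0 := by
  have h := (neg_third_pow_mem_Icc hN).2
  exact_mod_cast (by linarith : (0 : ℝ) < 1 - (-1 / 3) ^ N).ne'

lemma three_add_neg_third_pow_ne_zero {N : ℕ} (hN : 1 ≤ N) : 3 + (-1 / 3 : ℂ) ^ N ≠ 0 := by
  have h := (neg_third_pow_mem_Icc hN).1
  exact_mod_cast (by linarith : (0 : ℝ) < 3 + (-1 / 3) ^ N).ne'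

lemma one_add_three_mul_neg_third_pow_ne_zero {N : ℕ} (hN : 2 ≤ N) :
    1 + 3 * (-1 / 3 : ℂ) ^ N ≠ 0 := by
  obtain ⟨k, rfl⟩ := Nat.exists_eq_add_of_le' (by omega : 1 ≤ N)
  convert one_sub_neg_third_pow_ne_zero (N := k) (by omega) using 1
  ring

lemma M_mul_signMatrix_mul_gramInv {N : ℕ} (hN : 2 ≤ N) :
    M N * (signMatrix N * gramInv ((-1 / 3) ^ N) * signMatrix N) = 1 := by
  have h := gram_mul_gramInv (one_sub_neg_third_pow_ne_zero (by omega))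
    (one_add_three_mul_neg_third_pow_ne_zero hN)
  rw [M_eq_signMatrix_mul_gram]
  calc _ = signMatrix N * (gram ((-1 / 3) ^ N) * (signMatrix N * signMatrix N)
          * gramInv ((-1 / 3) ^ N)) * signMatrix N := by simp only [Matrix.mul_assoc]
    _ = 1 := by rw [signMatrix_mul_self, Matrix.mul_one, h, Matrix.mul_one, signMatrix_mul_self]

lemma W_eq_signMatrix_mul_gramInv {N : ℕ} (hN : 2 ≤ N) :
    W N = signMatrix N * gramInv ((-1 / 3) ^ N) * signMatrix N :=
  Matrix.inv_eq_right_inv (M_mul_signMatrix_mul_gramInv hN)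

lemma M_mul_W {N : ℕ} (hN : 2 ≤ N) : M N * W N = 1 := by
  rw [W_eq_signMatrix_mul_gramInv hN, M_mul_signMatrix_mul_gramInv hN]

lemma eq_zero_of_M_mulVec_eq_zero {N : ℕ} (hN : 2 ≤ N) {c : Fin 4 → ℂ}
    (h : (M N).mulVec c = 0) : c = 0 := by
  rw [← Matrix.one_mulVec c, ← mul_eq_one_comm.1 (M_mul_W hN), ← Matrix.mulVec_mulVec, h,
    Matrix.mulVec_zero]

lemma linearIndependent_Phi {N : ℕ} (hN : 2 ≤ N) : LinearIndependent ℂ (Phi N) := by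
  rw [Fintype.linearIndependent_iff]
  intro c hc
  refine congrFun (eq_zero_of_M_mulVec_eq_zero hN (funext fun i => ?_))
  have := congrArg (inner ℂ (Phi N i)) hc
  simp only [inner_zero_right, inner_sum, inner_smul_right, mul_comm (c _)] at this
  exact this

lemma map_groundSpace_eq_span_Phi {N : ℕ} (hN : 2 ≤ N) :
    (groundSpace N 0 (N - 1)).map (kennedyTasaki N : Chain N →ₗ[ℂ] Chain N)
      = Submodule.span ℂ (Set.range (Phi N)) := by
  have hsites : ∀ x, x ∈ sites N 0 (N - 1) := fun x => mem_sites.2 ⟨Nat.zero_le _, by omega⟩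
  refine (stringSpace_eq_productSpan (L := N) (a := 0) (b := N - 1) (by omega) (by omega)).trans ?_
  refine congrArg _ (Set.ext fun v => ⟨?_, ?_⟩)
  · rintro ⟨i, f, hf, rfl⟩
    exact ⟨i, by rw [Phi_eq_prodVec, funext fun x => hf x (hsites x)]⟩
  · rintro ⟨i, rfl⟩
    exact ⟨i, _, fun _ _ => rfl, rfl⟩

end Gram

section Projection

variable {L : ℕ} {I : Finset (Fin L)} {i k : Fin 4} {f g : Fin L → Fin 3 → ℂ}

lemma prod_siteInner_eq_M (l : Fin 4) (hf : ∀ x ∈ I, f x = phi i) :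
    ∏ x ∈ I, siteInner (phi l) (f x) = M #I l i := by
  rw [M_apply]
  exact Finset.prod_eq_pow_card fun x hx => by rw [hf x hx]

lemma prod_insert_siteInner_eq_M {z : Fin L} (hz : z ∉ I) (l : Fin 4) (hfz : f z = phi k)
    (hf : ∀ x ∈ I, f x = phi i) :
    ∏ x ∈ insert z I, siteInner (phi l) (f x) = M 1 l k * M #I l i := by
  rw [Finset.prod_insert hz, prod_siteInner_eq_M l hf, hfz, M_apply 1, pow_one]

lemma inner_prodVec_eq_mul (hg : ∀ x ∈ I, g x = phi i) (f : Fin L → Fin 3 → ℂ) :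
    inner ℂ (prodVec g) (prodVec f)
      = (∏ x ∈ I, siteInner (phi i) (f x)) * ∏ x ∈ Iᶜ, siteInner (g x) (f x) := by
  rw [inner_prodVec, ← Finset.prod_mul_prod_compl I]
  congr 1
  exact Finset.prod_congr rfl fun x hx => by rw [hg x hx]

lemma inner_prodVec_piecewise (hg : ∀ x ∈ I, g x = phi i) (f : Fin L → Fin 3 → ℂ) (k : Fin 4) :
    inner ℂ (prodVec g) (prodVec (I.piecewise (fun _ => phi k) f))
      = M #I i k * ∏ x ∈ Iᶜ, siteInner (g x) (f x) := by
  rw [inner_prodVec_eq_mul hg, prod_siteInner_eq_M i fun x hx => I.piecewise_eq_of_mem _ _ hx]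
  congr 1
  exact Finset.prod_congr rfl fun x hx => by
    rw [I.piecewise_eq_of_notMem _ _ (Finset.mem_compl.1 hx)]

lemma starProjection_productSpan_prodVec (hI : 2 ≤ #I) (f : Fin L → Fin 3 → ℂ) :
    (productSpan I).starProjection (prodVec f)
      = ∑ k, (∑ l, W #I k l * ∏ x ∈ I, siteInner (phi l) (f x))
        • prodVec (I.piecewise (fun _ => phi k) f) := by
  refine Submodule.eq_starProjection_of_mem_orthogonal ?_ ?_
  · exact Submodule.sum_mem _ fun k _ => Submodule.smul_mem _ _
      (prodVec_mem_productSpan fun x hx => I.piecewise_eq_of_mem _ _ hx)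
  · rw [productSpan, Submodule.mem_orthogonal]
    intro u hu
    induction hu using Submodule.span_induction with
    | zero => simp
    | add u v _ _ hu hv => rw [inner_add_left, hu, hv, add_zero]
    | smul c u _ hu => rw [inner_smul_left, hu, mul_zero]
    | mem u hu =>
      obtain ⟨i, g, hg, rfl⟩ := hu
      have hMW : ∑ k, M #I i k * ∑ l, W #I k l * ∏ x ∈ I, siteInner (phi l) (f x)
          = ∏ x ∈ I, siteInner (phi i) (f x) := by
        have h := Matrix.mulVec_mulVec (fun l => ∏ x ∈ I, siteInner (phi l) (f x)) (M #I) (W #I)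
        rw [M_mul_W hI, Matrix.one_mulVec] at h
        exact congrFun h i
      rw [inner_sub_right, inner_prodVec_eq_mul hg, inner_sum, sub_eq_zero]
      simp only [inner_smul_right, inner_prodVec_piecewise hg]
      rw [← hMW, Finset.sum_mul]
      exact Finset.sum_congr rfl fun k _ => by ring

lemma starProjection_stringSpace_prodVec {a b : ℕ} (hab : a < b) (hb : b < L)
    (f : Fin L → Fin 3 → ℂ) :
    (stringSpace L a b).starProjection (prodVec f)
      = ∑ k, (∑ l, W (b - a + 1) k l * ∏ x ∈ sites L a b, siteInner (phi l) (f x))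
        • prodVec ((sites L a b).piecewise (fun _ => phi k) f) := by
  have hcard := card_sites hab.le hb
  have := starProjection_productSpan_prodVec (I := sites L a b) (by omega) f
  rwa [← hcard, stringSpace_eq_productSpan hab hb]

lemma kennedyTasaki_groundProj_kennedyTasaki (a b : ℕ) (ψ : Chain L) :
    kennedyTasaki L (groundProj L a b (kennedyTasaki L ψ))
      = (stringSpace L a b).starProjection ψ := by
  refine (Submodule.eq_starProjection_of_mem_orthogonal ?_ ?_).symm
  · exact ⟨_, Submodule.starProjection_apply_mem _ _, rfl⟩
  · rw [Submodule.mem_orthogonal]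
    rintro _ ⟨u, hu, rfl⟩
    rw [ContinuousLinearMap.coe_coe, inner_kennedyTasaki_left, map_sub, kennedyTasaki_kennedyTasaki]
    exact (Submodule.mem_orthogonal _ _).1 (Submodule.sub_starProjection_mem_orthogonal _) u hu

end Projection

section Theta

variable {m n : ℕ}

lemma kennedyTasaki_K_apply (m n : ℕ) (ψ : Chain (m + n + 1)) :
    (kennedyTasaki (m + n + 1) * K m n * star (kennedyTasaki (m + n + 1))) ψ
      = (stringSpace (m + n + 1) 0 m).starProjection
        ((stringSpace (m + n + 1) m (m + n)).starProjection
          ((stringSpace (m + n + 1) 0 m).starProjection ψ)) := by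
  rw [star_kennedyTasaki]
  simp only [← kennedyTasaki_groundProj_kennedyTasaki, kennedyTasaki_kennedyTasaki]
  rfl

/-- The one-site factors of `Θ_{ij}`. -/
def thetaFactor (m n : ℕ) (ij : Fin 4 × Fin 4) (x : Fin (m + n + 1)) : Fin 3 → ℂ :=
  if (x : ℕ) ≤ m then phi ij.1 else phi ij.2

lemma Theta_eq_prodVec (m n : ℕ) (ij : Fin 4 × Fin 4) :
    Theta m n ij = prodVec (thetaFactor m n ij) := by
  ext σ
  simp only [Theta, prodVec_apply, thetaFactor]
  exact Finset.prod_congr rfl fun x _ => (ite_apply ..).symm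

lemma thetaFactor_of_mem {ij : Fin 4 × Fin 4} {x : Fin (m + n + 1)}
    (hx : x ∈ sites (m + n + 1) 0 m) : thetaFactor m n ij x = phi ij.1 :=
  if_pos (mem_sites.1 hx).2

lemma thetaFactor_of_lt {ij : Fin 4 × Fin 4} {x : Fin (m + n + 1)} (hx : m < (x : ℕ)) :
    thetaFactor m n ij x = phi ij.2 :=
  if_neg (not_le.2 hx)

lemma prodVec_piecewise_eq_Theta {f : Fin (m + n + 1) → Fin 3 → ℂ} {k : Fin 4} (r : Fin 4)
    (hf : ∀ x : Fin (m + n + 1), m < (x : ℕ) → f x = phi k) :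
    prodVec ((sites (m + n + 1) 0 m).piecewise (fun _ => phi r) f) = Theta m n (r, k) := by
  rw [Theta_eq_prodVec]
  congr 1
  funext x
  by_cases hx : (x : ℕ) ≤ m
  · simp [thetaFactor, mem_sites, hx]
  · simp [thetaFactor, mem_sites, hx, hf x (by omega)]

lemma Theta_mem_stringSpace (hm : 1 ≤ m) (ij : Fin 4 × Fin 4) :
    Theta m n ij ∈ stringSpace (m + n + 1) 0 m := by
  rw [stringSpace_eq_productSpan hm (by omega), Theta_eq_prodVec]
  exact prodVec_mem_productSpan fun x hx => thetaFactor_of_mem hx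

lemma sites_left (hm : 1 ≤ m) :
    sites (m + n + 1) 0 m = insert ⟨m, by omega⟩ (sites (m + n + 1) 0 (m - 1)) := by
  ext x
  simp only [mem_sites, Finset.mem_insert, Fin.ext_iff]
  omega

lemma sites_right :
    sites (m + n + 1) m (m + n) = insert ⟨m, by omega⟩ (sites (m + n + 1) (m + 1) (m + n)) := by
  ext x
  simp only [mem_sites, Finset.mem_insert, Fin.ext_iff]
  omega

lemma starProjection_right_Theta (hn : 1 ≤ n) (i j : Fin 4) :
    (stringSpace (m + n + 1) m (m + n)).starProjection (Theta m n (i, j))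
      = ∑ k, (∑ l, W (n + 1) k l * (M 1 l i * M n l j)) • prodVec
        ((sites (m + n + 1) m (m + n)).piecewise (fun _ => phi k) (thetaFactor m n (i, j))) := by
  rw [Theta_eq_prodVec, starProjection_stringSpace_prodVec (by omega) (by omega),
    Nat.add_sub_cancel_left]
  refine Finset.sum_congr rfl fun k _ => congrArg (· • _) (Finset.sum_congr rfl fun l _ => ?_)
  rw [sites_right, prod_insert_siteInner_eq_M (i := j) (k := i) (by simp [mem_sites]) l,
    card_sites (by omega) (by omega), show m + n - (m + 1) + 1 = n by omega]
  · exact thetaFactor_of_mem (by simp [mem_sites])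
  · exact fun x hx => thetaFactor_of_lt (by rw [mem_sites] at hx; omega)

lemma starProjection_left_prodVec (hm : 1 ≤ m) (i j k : Fin 4) :
    (stringSpace (m + n + 1) 0 m).starProjection (prodVec
        ((sites (m + n + 1) m (m + n)).piecewise (fun _ => phi k) (thetaFactor m n (i, j))))
      = ∑ r, (∑ s, W (m + 1) r s * (M 1 s k * M m s i)) • Theta m n (r, k) := by
  rw [starProjection_stringSpace_prodVec (by omega) (by omega), Nat.sub_zero]
  refine Finset.sum_congr rfl fun r _ => ?_
  congr 1
  · refine Finset.sum_congr rfl fun s _ => ?_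
    rw [sites_left hm, prod_insert_siteInner_eq_M (i := i) (k := k) (by simp [mem_sites]; omega) s,
      card_sites (by omega) (by omega), show m - 1 - 0 + 1 = m by omega]
    · simp [mem_sites]
    · intro x hx
      rw [mem_sites] at hx
      rw [Finset.piecewise_eq_of_notMem _ _ _ (by rw [mem_sites]; omega)]
      exact thetaFactor_of_mem (by rw [mem_sites]; omega)
  · refine prodVec_piecewise_eq_Theta r fun x hx => ?_
    exact Finset.piecewise_eq_of_mem _ _ _ (mem_sites.2 (by omega))

lemma kennedyTasaki_K_Theta (hm : 1 ≤ m) (hn : 1 ≤ n) (ij : Fin 4 × Fin 4) :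
    (kennedyTasaki (m + n + 1) * K m n * star (kennedyTasaki (m + n + 1))) (Theta m n ij)
      = ∑ rk, A m n ij rk • Theta m n rk := by
  obtain ⟨i, j⟩ := ij
  rw [kennedyTasaki_K_apply, Submodule.starProjection_eq_self_iff.2 (Theta_mem_stringSpace hm _),
    starProjection_right_Theta hn, map_sum]
  simp only [map_smul, starProjection_left_prodVec hm, Finset.smul_sum, smul_smul]
  rw [Fintype.sum_prod_type, Finset.sum_comm]
  refine Finset.sum_congr rfl fun r _ => Finset.sum_congr rfl fun k _ => congrArg (· • _) ?_
  simp only [A, Matrix.of_apply, Finset.sum_mul_sum]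
  exact Finset.sum_congr rfl fun l _ => Finset.sum_congr rfl fun s _ => by ring

lemma range_kennedyTasaki_K_le (hm : 1 ≤ m) (hn : 1 ≤ n) :
    LinearMap.range ((kennedyTasaki (m + n + 1) * K m n * star (kennedyTasaki (m + n + 1)) :
        Op (m + n + 1)) : Chain (m + n + 1) →ₗ[ℂ] Chain (m + n + 1))
      ≤ Submodule.span ℂ (Set.range (Theta m n)) := by
  have hright : ∀ v ∈ stringSpace (m + n + 1) m (m + n),
      (stringSpace (m + n + 1) 0 m).starProjection v
        ∈ Submodule.span ℂ (Set.range (Theta m n)) := by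
    rw [stringSpace_eq_productSpan (a := m) (by omega) (by omega), productSpan]
    intro v hv
    induction hv using Submodule.span_induction with
    | zero => simp
    | add u v _ _ hu hv => rw [map_add]; exact add_mem hu hv
    | smul c u _ hu => rw [map_smul]; exact Submodule.smul_mem _ _ hu
    | mem v hv =>
      obtain ⟨k, f, hf, rfl⟩ := hv
      rw [starProjection_stringSpace_prodVec (by omega) (by omega)]
      refine Submodule.sum_mem _ fun r _ =>
        Submodule.smul_mem _ _ (Submodule.subset_span ⟨(r, k), ?_⟩)
      exact (prodVec_piecewise_eq_Theta r fun x hx => hf x (mem_sites.2 (by omega))).symm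
  rintro _ ⟨ψ, rfl⟩
  rw [ContinuousLinearMap.coe_coe, kennedyTasaki_K_apply]
  exact hright _ (Submodule.starProjection_apply_mem _ _)

lemma inner_Theta (ij rk : Fin 4 × Fin 4) :
    inner ℂ (Theta m n ij) (Theta m n rk) = M (m + 1) ij.1 rk.1 * M n ij.2 rk.2 := by
  have hlt : ∀ x ∈ (sites (m + n + 1) 0 m)ᶜ, m < (x : ℕ) := fun x hx => by
    simp only [Finset.mem_compl, mem_sites] at hx
    omega
  rw [Theta_eq_prodVec, Theta_eq_prodVec, inner_prodVec_eq_mul fun x hx => thetaFactor_of_mem hx,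
    prod_siteInner_eq_M _ fun x hx => thetaFactor_of_mem hx,
    Finset.prod_congr rfl fun x hx => by rw [thetaFactor_of_lt (hlt x hx)],
    prod_siteInner_eq_M _ fun x hx => thetaFactor_of_lt (hlt x hx), Finset.card_compl,
    card_sites (by omega) (by omega), Fintype.card_fin, Nat.sub_zero,
    show m + n + 1 - (m + 1) = n by omega]

lemma M_mulVec_eq_zero_of_sum_smul_Theta_eq_zero (hm : 1 ≤ m) {c : Fin 4 × Fin 4 → ℂ}
    (hc : ∑ ij, c ij • Theta m n ij = 0) (i : Fin 4) :
    (M n).mulVec (fun j => c (i, j)) = 0 := by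
  funext l
  refine congrFun (?_ : (fun i => (M n).mulVec (fun j => c (i, j)) l) = 0) i
  refine eq_zero_of_M_mulVec_eq_zero (N := m + 1) (by omega) (funext fun r => ?_)
  have := congrArg (inner ℂ (Theta m n (r, l))) hc
  rw [inner_zero_right, inner_sum, Fintype.sum_prod_type] at this
  rw [Pi.zero_apply, ← this]
  simp only [Matrix.mulVec, dotProduct, Finset.mul_sum, inner_smul_right, inner_Theta]
  exact Finset.sum_congr rfl fun i _ => Finset.sum_congr rfl fun j _ => by ring

lemma linearIndependent_Theta (hm : 1 ≤ m) (hn : 2 ≤ n) : LinearIndependent ℂ (Theta m n) := by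
  rw [Fintype.linearIndependent_iff]
  rintro c hc ⟨i, j⟩
  exact congrFun (eq_zero_of_M_mulVec_eq_zero hn
    (M_mulVec_eq_zero_of_sum_smul_Theta_eq_zero hm hc i)) j

lemma vecMul_A_eq_zero (hm : 1 ≤ m) {c : Fin 4 × Fin 4 → ℂ}
    (hc : ∑ ij, c ij • Theta m n ij = 0) : Matrix.vecMul c (A m n) = 0 := by
  funext rk
  have hA : Matrix.vecMul c (A m n) rk = ∑ i, ∑ l, ∑ s, W (n + 1) rk.2 l * M 1 l i *
      W (m + 1) rk.1 s * M 1 s rk.2 * M m s i * (M n).mulVec (fun j => c (i, j)) l := by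
    simp only [Matrix.vecMul, Matrix.mulVec, dotProduct, A, Matrix.of_apply, Fintype.sum_prod_type,
      Finset.mul_sum]
    refine Finset.sum_congr rfl fun i _ => ?_
    rw [Finset.sum_comm]
    refine Finset.sum_congr rfl fun l _ => ?_
    rw [Finset.sum_comm]
    exact Finset.sum_congr rfl fun s _ => Finset.sum_congr rfl fun j _ => by ring
  simp [hA, M_mulVec_eq_zero_of_sum_smul_Theta_eq_zero hm hc]

end Theta

section Core

/-- The constant (`d = 0`) and the linear (`d = 1`) coefficient in `z` of
`3 (3 + z) ∑_l gramInv(-z/3)_{kl} gram(-1/3)_{li} gram(z)_{lj}`. -/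
def overlapCoeff (d : Fin 2) (k i j : Fin 4) : ℤ :=
  if d = 0 then (if k = i ∧ k = j then 12 else 0) - (if k = j then 3 else 0)
  else (if k = i then 12 else 0) + (if k = j then 3 else 0) + (if i = j then 4 else 0)
    - (if k = i ∧ k = j then 12 else 0) - 4

lemma sum_gramInv_mul_gram_mul_gram {z : ℂ} (h1 : 1 - z ≠ 0) (h3 : 3 + z ≠ 0) (k i j : Fin 4) :
    ∑ l, gramInv (-z / 3) k l * gram (-1 / 3) l i * gram z l j
      = (overlapCoeff 0 k i j + z * overlapCoeff 1 k i j) / (3 * (3 + z)) := by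
  have e1 : 1 + 3 * (-z / 3) = 1 - z := by ring
  have e2 : 1 - -z / 3 = (3 + z) / 3 := by ring
  have hu : (-z / 3) / (1 - z) * (1 - z) = -z / 3 := div_mul_cancel₀ _ h1
  have hv : (3 + z) * (3 + z)⁻¹ = 1 := mul_inv_cancel₀ h3
  simp only [gramInv, gram, Matrix.of_apply, e1, e2, Fin.sum_univ_four, overlapCoeff]
  generalize (-z / 3) / (1 - z) = u at hu
  simp only [div_eq_mul_inv, mul_inv, inv_inv]
  generalize (3 + z)⁻¹ = v at hv
  fin_cases k <;> fin_cases i <;> fin_cases j <;>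
    first
    | (simp; linear_combination v * hu)
    | (simp; linear_combination (-3 * v) * hu)

lemma signMatrix_mul_mul_signMatrix_apply (N : ℕ) (B : Matrix (Fin 4) (Fin 4) ℂ) (i j : Fin 4) :
    (signMatrix N * B * signMatrix N) i j = phiSign i ^ N * B i j * phiSign j ^ N := by
  rw [signMatrix, Matrix.mul_diagonal, Matrix.diagonal_mul]

lemma sum_W_mul_M_mul_M {N : ℕ} (hN : 1 ≤ N) (k i j : Fin 4) :
    ∑ l, W (N + 1) k l * M 1 l i * M N l j
      = phiSign k ^ (N + 1) * phiSign i * phiSign j ^ N *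
        ((overlapCoeff 0 k i j + (-1 / 3) ^ N * overlapCoeff 1 k i j)
          / (3 * (3 + (-1 / 3) ^ N))) := by
  rw [← sum_gramInv_mul_gram_mul_gram (one_sub_neg_third_pow_ne_zero hN)
    (three_add_neg_third_pow_ne_zero hN), Finset.mul_sum]
  refine Finset.sum_congr rfl fun l _ => ?_
  have hl : phiSign l ^ (N + 1) * phiSign l * phiSign l ^ N = 1 := by
    rw [pow_succ, mul_assoc (phiSign l ^ N), phiSign_mul_self, mul_one, ← mul_pow,
      phiSign_mul_self, one_pow]
  rw [W_eq_signMatrix_mul_gramInv (by omega), M_eq_signMatrix_mul_gram, M_eq_signMatrix_mul_gram,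
    show (-1 / 3 : ℂ) ^ (N + 1) = -(-1 / 3) ^ N / 3 by rw [pow_succ]; ring]
  simp only [signMatrix_mul_mul_signMatrix_apply, pow_one]
  linear_combination (phiSign k ^ (N + 1) * phiSign i * phiSign j ^ N *
    gramInv (-(-1 / 3) ^ N / 3) k l * gram (-1 / 3) l i * gram ((-1 / 3) ^ N) l j) * hl

/-- The matrix `∑_{d,e} x^d y^e B_{de}` with coefficients of degree at most one in each of `x` and
`y`. -/
def evalBilinear {ι κ : Type*} (B : Fin 2 → Fin 2 → Matrix ι κ ℤ) (x y : ℂ) : Matrix ι κ ℂ :=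
  Matrix.of fun p q => ∑ d : Fin 2, ∑ e : Fin 2, x ^ (d : ℕ) * y ^ (e : ℕ) * B d e p q

lemma evalBilinear_mul {ι κ μ : Type*} [Fintype κ] (B : Fin 2 → Fin 2 → Matrix ι κ ℤ)
    (P : Matrix κ μ ℤ) (x y : ℂ) :
    evalBilinear B x y * P.map (Int.cast : ℤ → ℂ) = evalBilinear (fun d e => B d e * P) x y := by
  ext i j
  simp only [evalBilinear, Matrix.mul_apply, Matrix.of_apply, Matrix.map_apply, Fin.sum_univ_two,
    add_mul, Finset.sum_add_distrib, mul_assoc, Finset.mul_sum, Int.cast_sum, Int.cast_mul]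

lemma mul_evalBilinear {ι κ μ : Type*} [Fintype κ] (P : Matrix ι κ ℤ)
    (B : Fin 2 → Fin 2 → Matrix κ μ ℤ) (x y : ℂ) :
    P.map (Int.cast : ℤ → ℂ) * evalBilinear B x y = evalBilinear (fun d e => P * B d e) x y := by
  ext i j
  simp only [evalBilinear, Matrix.mul_apply, Matrix.of_apply, Matrix.map_apply, Fin.sum_univ_two,
    mul_add, Finset.sum_add_distrib, mul_left_comm, Finset.mul_sum, Int.cast_sum, Int.cast_mul]

/-- The coefficients of the bilinear polynomial in `x = (-1/3)^m` and `y = (-1/3)^n` to which `𝒜`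
is similar, up to the factor `9 (3 + x) (3 + y)`. -/
def coreCoeff (d e : Fin 2) : Matrix (Fin 4 × Fin 4) (Fin 4 × Fin 4) ℤ :=
  Matrix.of fun ij rk => overlapCoeff e rk.2 ij.1 ij.2 * overlapCoeff d rk.1 rk.2 ij.1

/-- The diagonal matrix of the signs `sgn(φ_i)^{m+1} sgn(φ_j)^n` of the `Θ_{ij}`. -/
def thetaSignMatrix (m n : ℕ) : Matrix (Fin 4 × Fin 4) (Fin 4 × Fin 4) ℂ :=
  Matrix.diagonal fun ij => phiSign ij.1 ^ (m + 1) * phiSign ij.2 ^ n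

lemma thetaSignMatrix_mul_self (m n : ℕ) : thetaSignMatrix m n * thetaSignMatrix m n = 1 := by
  simp [thetaSignMatrix, mul_mul_mul_comm _ _ (phiSign _ ^ (m + 1)), ← mul_pow, phiSign_mul_self]

lemma A_eq_conj_evalBilinear {m n : ℕ} (hm : 1 ≤ m) (hn : 1 ≤ n) :
    A m n = thetaSignMatrix m n * ((9 * (3 + (-1 / 3 : ℂ) ^ m) * (3 + (-1 / 3) ^ n))⁻¹ •
      evalBilinear coreCoeff ((-1 / 3) ^ m) ((-1 / 3) ^ n)) * thetaSignMatrix m n := by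
  ext ij rk
  have hfactor : A m n ij rk = (∑ l, W (n + 1) rk.2 l * M 1 l ij.1 * M n l ij.2)
      * ∑ s, W (m + 1) rk.1 s * M 1 s rk.2 * M m s ij.1 := by
    rw [Finset.sum_mul_sum, A, Matrix.of_apply]
    exact Finset.sum_congr rfl fun l _ => Finset.sum_congr rfl fun s _ => by ring
  have hk : phiSign rk.2 ^ (n + 1) * phiSign rk.2 = phiSign rk.2 ^ n := by
    rw [pow_succ, mul_assoc, phiSign_mul_self, mul_one]
  rw [hfactor, sum_W_mul_M_mul_M hn, sum_W_mul_M_mul_M hm, thetaSignMatrix, Matrix.mul_diagonal,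
    Matrix.diagonal_mul, ← hk]
  simp only [evalBilinear, coreCoeff, Matrix.smul_apply, Matrix.of_apply, Fin.sum_univ_two,
    Int.cast_mul, smul_eq_mul, Fin.val_zero, Fin.val_one, pow_zero, pow_one, one_mul]
  simp only [div_eq_mul_inv, mul_inv]
  ring

lemma charpoly_A_eq_charpoly_core {m n : ℕ} (hm : 1 ≤ m) (hn : 1 ≤ n) :
    (A m n).charpoly = ((9 * (3 + (-1 / 3 : ℂ) ^ m) * (3 + (-1 / 3) ^ n))⁻¹ •
      evalBilinear coreCoeff ((-1 / 3) ^ m) ((-1 / 3) ^ n)).charpoly := by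
  rw [A_eq_conj_evalBilinear hm hn, Matrix.charpoly_mul_comm, ← Matrix.mul_assoc,
    thetaSignMatrix_mul_self, Matrix.one_mul]

end Core

section SymmetryBasis

/-- The three nontrivial characters of `ℤ₂ × ℤ₂`. -/
def klein (a : Fin 3) : Fin 4 → ℤ :=
  ![![1, 1, -1, -1], ![1, -1, 1, -1], ![1, -1, -1, 1]] a

/-- The index set of a basis adapted to the permutation symmetry of the four product states: two
invariants, three vectors for each of the three nontrivial characters, and five more. -/
abbrev SymIndex : Type := Fin 2 ⊕ (Fin 3 ⊕ (Fin 3 ⊕ (Fin 3 ⊕ Fin 5)))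

/-- The three basis vectors that transform like the character `a`. -/
def symVec (a : Fin 3) (p : Fin 3) (r k : Fin 4) : ℤ :=
  ![klein a r, klein a k,
    klein (a + 1) r * klein (a + 2) k + klein (a + 2) r * klein (a + 1) k] p

/-- The matrix whose columns are the vectors of the adapted basis. -/
def symBasis : Matrix (Fin 4 × Fin 4) SymIndex ℤ :=
  Matrix.of fun rk => Sum.elim ![1, ∑ a, klein a rk.1 * klein a rk.2]
    (Sum.elim (fun p => symVec 0 p rk.1 rk.2) (Sum.elim (fun p => symVec 1 p rk.1 rk.2)
      (Sum.elim (fun p => symVec 2 p rk.1 rk.2)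
        ![klein 0 rk.1 * klein 0 rk.2 - klein 1 rk.1 * klein 1 rk.2,
          klein 0 rk.1 * klein 0 rk.2 + klein 1 rk.1 * klein 1 rk.2
            - 2 * (klein 2 rk.1 * klein 2 rk.2),
          klein 1 rk.1 * klein 2 rk.2 - klein 2 rk.1 * klein 1 rk.2,
          klein 2 rk.1 * klein 0 rk.2 - klein 0 rk.1 * klein 2 rk.2,
          klein 0 rk.1 * klein 1 rk.2 - klein 1 rk.1 * klein 0 rk.2])))

/-- The squared norms of the vectors of the adapted basis. -/
def symNormSq : SymIndex → ℤ :=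
  Sum.elim ![16, 48] (Sum.elim ![16, 16, 32] (Sum.elim ![16, 16, 32] (Sum.elim ![16, 16, 32]
    ![32, 96, 32, 32, 32])))

/-- The coefficients of the block on the two invariant vectors. -/
def blockTwo (d e : Fin 2) : Matrix (Fin 2) (Fin 2) ℤ :=
  ![![!![27, 54; 18, 63], !![81, 162; -18, -27]],
    ![!![9, -54; 6, 45], !![27, -162; -6, 63]]] d e

/-- The coefficients of the block on the three vectors of a character. -/
def blockThree (d e : Fin 2) : Matrix (Fin 3) (Fin 3) ℤ :=
  ![![!![27, 18, 36; 18, 27, 36; 18, 18, 45], !![81, 54, 108; -18, -15, -12; -18, -6, -21]],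
    ![!![9, 6, 36; -18, 9, -36; 18, 6, 27], !![27, 18, 108; 18, -5, 12; -18, -2, -51]]] d e

/-- The coefficients of the scalar block on the remaining five vectors. -/
def blockFive (d e : Fin 2) : Matrix (Fin 5) (Fin 5) ℤ :=
  Matrix.diagonal fun _ => ![![9, -9], ![-9, 9]] d e

/-- The matrix of `coreCoeff` in the adapted basis. -/
def symBlock (d e : Fin 2) : Matrix SymIndex SymIndex ℤ :=
  Matrix.fromBlocks (blockTwo d e) 0 0 (Matrix.fromBlocks (blockThree d e) 0 0
    (Matrix.fromBlocks (blockThree d e) 0 0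
      (Matrix.fromBlocks (blockThree d e) 0 0 (blockFive d e))))

lemma coreCoeff_mul_symBasis :
    ∀ d e : Fin 2, coreCoeff d e * symBasis = symBasis * symBlock d e := by
  decide +kernel

lemma symBasis_transpose_mul_symBasis :
    symBasis.transpose * symBasis = Matrix.diagonal symNormSq := by
  decide +kernel

lemma charpoly_eq_of_mul_eq_mul {ι κ R : Type*} [CommRing R] [Nontrivial R] [Fintype ι]
    [DecidableEq ι] [Fintype κ] [DecidableEq κ] {A : Matrix ι ι R} {B : Matrix κ κ R}
    {P : Matrix ι κ R} {Q : Matrix κ ι R} (hcard : Fintype.card ι = Fintype.card κ)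
    (hQP : Q * P = 1) (h : A * P = P * B) : A.charpoly = B.charpoly := by
  have hPQ : P * Q = 1 := (Matrix.mul_eq_one_comm_of_card_eq _ _ _ hcard).2 hQP
  calc A.charpoly = (P * (B * Q)).charpoly := by
        rw [← Matrix.mul_assoc, ← h, Matrix.mul_assoc, hPQ, Matrix.mul_one]
    _ = B.charpoly := by
        rw [Matrix.charpoly_mul_comm_of_le _ _ hcard.ge, hcard, Nat.sub_self, pow_zero, one_mul,
          Matrix.mul_assoc, hQP, Matrix.mul_one]

lemma charpoly_smul_core (c x y : ℂ) :
    (c • evalBilinear coreCoeff x y).charpoly = (c • evalBilinear symBlock x y).charpoly := by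
  have hnorm : ∀ p, (symNormSq p : ℂ) ≠ 0 := fun p =>
    Int.cast_ne_zero.2 ((by decide : ∀ p, symNormSq p ≠ 0) p)
  refine charpoly_eq_of_mul_eq_mul (P := symBasis.map (Int.cast : ℤ → ℂ))
    (Q := Matrix.diagonal (fun p => (symNormSq p : ℂ)⁻¹)
      * symBasis.transpose.map (Int.cast : ℤ → ℂ)) (by simp) ?_ ?_
  · have h := congrArg (fun B => B.map (Int.castRingHom ℂ)) symBasis_transpose_mul_symBasis
    rw [Matrix.map_mul, Matrix.diagonal_map (map_zero _)] at h
    rw [Matrix.mul_assoc]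
    refine (congrArg _ h).trans ?_
    simp [hnorm]
  · rw [Matrix.smul_mul, Matrix.mul_smul, evalBilinear_mul, mul_evalBilinear]
    simp only [coreCoeff_mul_symBasis]

end SymmetryBasis

section Eigenvalues

open Polynomial

lemma charpoly_eq_of_esymm_fin_two {R : Type*} [CommRing R] [Nontrivial R]
    {B : Matrix (Fin 2) (Fin 2) R} {p q : R}
    (htrace : B.trace = p + q) (hdet : B.det = p * q) : B.charpoly = (X - C p) * (X - C q) := by
  rw [Matrix.charpoly_fin_two, htrace, hdet, map_add, map_mul]
  ring

lemma charpoly_eq_of_esymm_fin_three {R : Type*} [CommRing R] {B : Matrix (Fin 3) (Fin 3) R}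
    {p q r : R} (htrace : B.trace = p + q + r)
    (hminors : B 0 0 * B 1 1 - B 0 1 * B 1 0 + B 0 0 * B 2 2 - B 0 2 * B 2 0 + B 1 1 * B 2 2
      - B 1 2 * B 2 1 = p * q + p * r + q * r)
    (hdet : B.det = p * q * r) : B.charpoly = (X - C p) * (X - C q) * (X - C r) := by
  have e1 := congrArg (C : R →+* R[X]) htrace
  have e2 := congrArg (C : R →+* R[X]) hminors
  have e3 := congrArg (C : R →+* R[X]) hdet
  rw [Matrix.trace_fin_three] at e1
  rw [Matrix.det_fin_three] at e3
  simp only [map_add, map_mul, map_sub] at e1 e2 e3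
  rw [Matrix.charpoly, Matrix.det_fin_three]
  simp
  linear_combination (-X ^ 2) * e1 + X * e2 - e3

variable {x y v w : ℂ}

lemma charpoly_blockTwo (hv : (3 + x) * (3 + y) * v = 1) :
    ((v / 9) • evalBilinear blockTwo x y).charpoly
      = (X - C 1) * (X - C ((1 + 3 * x) * (1 + 3 * y) * v)) := by
  apply charpoly_eq_of_esymm_fin_two
  · simp [Matrix.trace_fin_two, evalBilinear, blockTwo, Fin.sum_univ_two]
    linear_combination hv
  · simp [Matrix.det_fin_two, evalBilinear, blockTwo, Fin.sum_univ_two]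
    linear_combination (v * (1 + 3 * x) * (1 + 3 * y)) * hv

lemma charpoly_blockThree (hv : (3 + x) * (3 + y) * v = 1)
    (hw : w ^ 2 = (x - y) ^ 2 - 128 / 81 * x ^ 2 * y ^ 2
      + 4 / 9 * x * y * (1 + x) * (1 + y)) :
    ((v / 9) • evalBilinear blockThree x y).charpoly
      = (X - C 1) * (X - C ((1 + x + y - 19 / 9 * x * y + 2 * w) * v))
        * (X - C ((1 + x + y - 19 / 9 * x * y - 2 * w) * v)) := by
  apply charpoly_eq_of_esymm_fin_three
  · simp [Matrix.trace_fin_three, evalBilinear, blockThree, Fin.sum_univ_two]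
    linear_combination hv
  · simp [evalBilinear, blockThree, Fin.sum_univ_two]
    linear_combination (v * 2 * (1 + x + y - 19 / 9 * x * y)) * hv + 4 * v ^ 2 * hw
  · simp [Matrix.det_fin_three, evalBilinear, blockThree, Fin.sum_univ_two]
    linear_combination (v ^ 2 * ((1 + x + y - 19 / 9 * x * y) ^ 2 - 4 * w ^ 2)) * hv
      + 4 * v ^ 3 * (3 + x) * (3 + y) * hw

lemma charpoly_blockFive (x y v : ℂ) :
    ((v / 9) • evalBilinear blockFive x y).charpoly = (X - C ((1 - x) * (1 - y) * v)) ^ 5 := by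
  have hscalar : (v / 9) • evalBilinear blockFive x y
      = Matrix.diagonal fun _ : Fin 5 => (1 - x) * (1 - y) * v := by
    ext p q
    rcases eq_or_ne p q with rfl | hpq
    · simp [evalBilinear, blockFive, Fin.sum_univ_two]
      ring
    · simp [evalBilinear, blockFive, hpq]
  rw [hscalar, Matrix.charpoly_diagonal, Finset.prod_const, Finset.card_univ, Fintype.card_fin]

lemma smul_evalBilinear_symBlock (c x y : ℂ) :
    c • evalBilinear symBlock x y = Matrix.fromBlocks (c • evalBilinear blockTwo x y) 0 0
      (Matrix.fromBlocks (c • evalBilinear blockThree x y) 0 0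
        (Matrix.fromBlocks (c • evalBilinear blockThree x y) 0 0
          (Matrix.fromBlocks (c • evalBilinear blockThree x y) 0 0
            (c • evalBilinear blockFive x y)))) := by
  ext (p | p | p | p | p) (q | q | q | q | q) <;> simp [evalBilinear, symBlock]

lemma charpoly_symBlock (hv : (3 + x) * (3 + y) * v = 1)
    (hw : w ^ 2 = (x - y) ^ 2 - 128 / 81 * x ^ 2 * y ^ 2
      + 4 / 9 * x * y * (1 + x) * (1 + y)) :
    ((v / 9) • evalBilinear symBlock x y).charpoly
      = (X - C 1) ^ 4 * (X - C ((1 - x) * (1 - y) * v)) ^ 5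
        * (X - C ((1 + 3 * x) * (1 + 3 * y) * v))
        * (X - C ((1 + x + y - 19 / 9 * x * y + 2 * w) * v)) ^ 3
        * (X - C ((1 + x + y - 19 / 9 * x * y - 2 * w) * v)) ^ 3 := by
  rw [smul_evalBilinear_symBlock]
  simp only [Matrix.charpoly_fromBlocks_zero₁₂, charpoly_blockTwo hv, charpoly_blockThree hv hw,
    charpoly_blockFive]
  ring

variable {m n : ℕ}

lemma lamDen_eq (m n : ℕ) : lamDen m n = (3 + (-1 / 3) ^ m) * (3 + (-1 / 3) ^ n) / 9 := by
  rw [lamDen, pow_succ, pow_succ]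
  ring

lemma lamR_eq (m n : ℕ) : lamR m n = ((-1 / 3) ^ m - (-1 / 3) ^ n) ^ 2
    - 128 / 81 * ((-1 / 3) ^ m) ^ 2 * ((-1 / 3) ^ n) ^ 2
    + 4 / 9 * (-1 / 3) ^ m * (-1 / 3) ^ n * (1 + (-1 / 3) ^ m) * (1 + (-1 / 3) ^ n) := by
  rw [lamR]
  ring

lemma lam5_eq (m n : ℕ) : lam5 m n = (1 - (-1 / 3) ^ m) * (1 - (-1 / 3) ^ n)
    / ((3 + (-1 / 3) ^ m) * (3 + (-1 / 3) ^ n)) := by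
  rw [lam5, lamDen_eq, div_div_eq_mul_div]
  ring

lemma lam1_eq (hm : 1 ≤ m) (hn : 1 ≤ n) :
    lam1 m n = (1 + 3 * (-1 / 3) ^ m) * (1 + 3 * (-1 / 3) ^ n)
      / ((3 + (-1 / 3) ^ m) * (3 + (-1 / 3) ^ n)) := by
  obtain ⟨m, rfl⟩ := Nat.exists_eq_add_of_le' hm
  obtain ⟨n, rfl⟩ := Nat.exists_eq_add_of_le' hn
  rw [lam1, lamDen_eq, div_div_eq_mul_div, Nat.add_sub_cancel, Nat.add_sub_cancel,
    pow_succ (-1 / 3 : ℝ) m, pow_succ (-1 / 3 : ℝ) n]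
  ring

/-- The rational part of the numerator of `λ_{3±}`. -/
def lamQ (m n : ℕ) : ℝ :=
  1 + (-1 / 3) ^ m + (-1 / 3) ^ n - 19 / 9 * (-1 / 3) ^ m * (-1 / 3) ^ n

lemma lam3plus_eq (m n : ℕ) : lam3plus m n = (lamQ m n + 2 * Real.sqrt (lamR m n))
    / ((3 + (-1 / 3) ^ m) * (3 + (-1 / 3) ^ n)) := by
  rw [lam3plus, lamDen_eq, div_div_eq_mul_div, lamQ, pow_add, pow_add]
  ring

lemma lam3minus_eq (m n : ℕ) : lam3minus m n = (lamQ m n - 2 * Real.sqrt (lamR m n))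
    / ((3 + (-1 / 3) ^ m) * (3 + (-1 / 3) ^ n)) := by
  rw [lam3minus, lamDen_eq, div_div_eq_mul_div, lamQ, pow_add, pow_add]
  ring

lemma lamR_nonneg (hm : 1 ≤ m) (hn : 1 ≤ n) : 0 ≤ lamR m n := by
  rw [lamR_eq]
  obtain ⟨h1, h2⟩ := neg_third_pow_mem_Icc hm
  obtain ⟨h3, h4⟩ := neg_third_pow_mem_Icc hn
  generalize (-1 / 3 : ℝ) ^ m = x at *
  generalize (-1 / 3 : ℝ) ^ n = y at *
  have hp : 4 / 9 ≤ (1 + x) * (1 + y) := by nlinarith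
  have hq : (1 + x) * (1 + y) ≤ 100 / 81 := by nlinarith
  have hxy : x * y ≤ 1 / 9 := by nlinarith
  have hxy' : -(1 / 9) ≤ x * y := by nlinarith
  rcases le_total 0 (x * y) with h | h
  · nlinarith [sq_nonneg (x - y), mul_nonneg h (sub_nonneg.2 hp), mul_nonneg h (sub_nonneg.2 hxy)]
  · nlinarith [sq_nonneg (x + y), mul_nonneg (neg_nonneg.2 h) (sub_nonneg.2 hq),
      mul_nonneg (neg_nonneg.2 h) (by linarith : (0 : ℝ) ≤ 1 / 9 + x * y)]

theorem charpoly_A (hm : 1 ≤ m) (hn : 1 ≤ n) :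
    (A m n).charpoly = (X - C 1) ^ 4 * (X - C (lam5 m n : ℂ)) ^ 5 * (X - C (lam1 m n : ℂ))
        * (X - C (lam3plus m n : ℂ)) ^ 3 * (X - C (lam3minus m n : ℂ)) ^ 3 := by
  have hx := three_add_neg_third_pow_ne_zero hm
  have hy := three_add_neg_third_pow_ne_zero hn
  have hw := congrArg (fun r : ℝ => (r : ℂ))
    ((Real.sq_sqrt (lamR_nonneg hm hn)).trans (lamR_eq m n))
  rw [charpoly_A_eq_charpoly_core hm hn, charpoly_smul_core, lam5_eq, lam1_eq hm hn, lam3plus_eq,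
    lam3minus_eq, lamQ]
  push_cast at hw ⊢
  have hc : (9 * (3 + (-1 / 3 : ℂ) ^ m) * (3 + (-1 / 3) ^ n))⁻¹
      = ((3 + (-1 / 3) ^ m) * (3 + (-1 / 3) ^ n))⁻¹ / 9 := by
    rw [mul_assoc, mul_inv]
    ring
  simp only [hc, div_eq_mul_inv _ ((3 + (-1 / 3 : ℂ) ^ m) * (3 + (-1 / 3) ^ n))]
  exact charpoly_symBlock (mul_inv_cancel₀ (mul_ne_zero hx hy)) hw

end Eigenvalues

section TwoProjections

variable {E : Type*} [NormedAddCommGroup E] [InnerProductSpace ℂ E] [FiniteDimensional ℂ E]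

lemma re_inner_apply_eq_sum_eigenvalues {T : E →ₗ[ℂ] E} (hT : T.IsSymmetric) (v : E) :
    (inner ℂ v (T v)).re
      = ∑ i, hT.eigenvalues rfl i * ‖inner ℂ (hT.eigenvectorBasis rfl i) v‖ ^ 2 := by
  rw [← (hT.eigenvectorBasis rfl).sum_inner_mul_inner, Complex.re_sum]
  refine Finset.sum_congr rfl fun i _ => ?_
  rw [← hT, hT.apply_eigenvectorBasis, inner_smul_left, RCLike.conj_ofReal, mul_left_comm,
    ← inner_conj_symm v, Complex.conj_mul', ← Complex.ofReal_pow]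
  exact Complex.re_ofReal_mul _ _

/-- The operator `P_S P_T P_S` made from the orthogonal projections onto `S` and `T`. Its
eigenvalues are the squared cosines of the principal angles between `S` and `T`. -/
def sandwich (S T : Submodule ℂ E) : Module.End ℂ E :=
  (S.starProjection * T.starProjection * S.starProjection : E →L[ℂ] E)

variable {S T : Submodule ℂ E}

lemma sandwich_apply (v : E) :
    sandwich S T v = S.starProjection (T.starProjection (S.starProjection v)) := rfl

lemma isSymmetric_sandwich : (sandwich S T).IsSymmetric := by
  intro u v
  simp only [sandwich_apply, Submodule.inner_starProjection_left_eq_right]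

lemma inner_sandwich_of_mem {u v : E} (hu : u ∈ S) (hv : v ∈ S) :
    inner ℂ u (sandwich S T v) = inner ℂ u (T.starProjection v) := by
  rw [sandwich_apply, ← Submodule.inner_starProjection_left_eq_right,
    Submodule.starProjection_eq_self_iff.2 hu, Submodule.starProjection_eq_self_iff.2 hv]

lemma sandwich_of_mem_inf {u : E} (hu : u ∈ S ⊓ T) : sandwich S T u = u := by
  rw [sandwich_apply, Submodule.starProjection_eq_self_iff.2 hu.1,
    Submodule.starProjection_eq_self_iff.2 hu.2, Submodule.starProjection_eq_self_iff.2 hu.1]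

lemma mem_of_sandwich_eq_smul {t : ℂ} (ht : t ≠ 0) {v : E} (h : sandwich S T v = t • v) :
    v ∈ S := by
  rw [← S.smul_mem_iff ht, ← h]
  exact Submodule.starProjection_apply_mem _ _

lemma mem_inf_of_sandwich_eq_self {v : E} (h : sandwich S T v = v) : v ∈ S ⊓ T := by
  have hS : v ∈ S := mem_of_sandwich_eq_smul one_ne_zero (h.trans (one_smul ℂ v).symm)
  refine ⟨hS, (Submodule.mem_iff_norm_starProjection _ _).2
    (le_antisymm (Submodule.norm_starProjection_apply_le _ _) ?_)⟩
  rw [sandwich_apply, Submodule.starProjection_eq_self_iff.2 hS] at h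
  calc ‖v‖ = ‖S.starProjection (T.starProjection v)‖ := by rw [h]
    _ ≤ _ := Submodule.norm_starProjection_apply_le _ _

lemma mem_orthogonal_inf_of_sandwich_eq_smul {t : ℂ} (ht : t ≠ 1) {v : E}
    (h : sandwich S T v = t • v) : v ∈ (S ⊓ T)ᗮ := by
  intro u hu
  have huv : inner ℂ u v = t * inner ℂ u v := by
    rw [← inner_smul_right, ← h, ← isSymmetric_sandwich, sandwich_of_mem_inf hu]
  by_contra hne
  exact ht (mul_right_cancel₀ hne (by rw [← huv, one_mul]))

lemma re_inner_starProjection_of_sandwich_eq_smul {t : ℝ} (ht : t ≠ 0) {v : E}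
    (h : sandwich S T v = (t : ℂ) • v) :
    (inner ℂ v (T.starProjection v)).re = t * ‖v‖ ^ 2 := by
  have hS : v ∈ S := mem_of_sandwich_eq_smul (Complex.ofReal_ne_zero.2 ht) h
  rw [← inner_sandwich_of_mem hS hS, h, inner_smul_right, inner_self_eq_norm_sq_to_K,
    Complex.re_ofReal_mul]
  norm_cast

lemma re_inner_starProjection_le {c : ℝ}
    (hc : ∀ t : ℝ, (sandwich S T).HasEigenvalue (t : ℂ) → t = 1 ∨ t ≤ c) {v : E} (hS : v ∈ S)
    (hv : v ∈ (S ⊓ T)ᗮ) : (inner ℂ v (T.starProjection v)).re ≤ c * ‖v‖ ^ 2 := by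
  have hsym : (sandwich S T).IsSymmetric := isSymmetric_sandwich
  rw [← inner_sandwich_of_mem hS hS, re_inner_apply_eq_sum_eigenvalues hsym,
    ← (hsym.eigenvectorBasis rfl).sum_sq_norm_inner_right, Finset.mul_sum]
  refine Finset.sum_le_sum fun i _ => ?_
  rcases hc (hsym.eigenvalues rfl i) (hsym.hasEigenvalue_eigenvalues rfl i) with h | h
  · have hmem : hsym.eigenvectorBasis rfl i ∈ S ⊓ T :=
      mem_inf_of_sandwich_eq_self (by
        rw [hsym.apply_eigenvectorBasis, h, RCLike.ofReal_one, one_smul])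
    simp [hv _ hmem]
  · exact mul_le_mul_of_nonneg_right h (sq_nonneg _)

theorem isGreatest_re_inner_starProjection {c : ℝ} (hc0 : c ≠ 0) (hc1 : c ≠ 1)
    (hc : (sandwich S T).HasEigenvalue (c : ℂ))
    (hmax : ∀ t : ℝ, (sandwich S T).HasEigenvalue (t : ℂ) → t = 1 ∨ t ≤ c) :
    IsGreatest {r : ℝ | ∃ v : E, v ∈ S ∧ v ∈ (S ⊓ T)ᗮ ∧ ‖v‖ = 1 ∧
      r = (inner ℂ v (T.starProjection v)).re} c := by
  constructor
  · obtain ⟨w, hw⟩ := hc.exists_hasEigenvector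
    have hv : sandwich S T (((‖w‖⁻¹ : ℝ) : ℂ) • w) = (c : ℂ) • ((‖w‖⁻¹ : ℝ) : ℂ) • w := by
      rw [map_smul, hw.apply_eq_smul, smul_comm]
    have hnorm : ‖((‖w‖⁻¹ : ℝ) : ℂ) • w‖ = 1 := by
      rw [norm_smul, Complex.norm_real, norm_inv, norm_norm,
        inv_mul_cancel₀ (norm_ne_zero_iff.2 hw.2)]
    refine ⟨_, mem_of_sandwich_eq_smul (Complex.ofReal_ne_zero.2 hc0) hv,
      mem_orthogonal_inf_of_sandwich_eq_smul (by exact_mod_cast hc1) hv, hnorm, ?_⟩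
    rw [re_inner_starProjection_of_sandwich_eq_smul hc0 hv, hnorm, one_pow, mul_one]
  · rintro _ ⟨v, hS, hv, hnorm, rfl⟩
    simpa only [hnorm, one_pow, mul_one] using re_inner_starProjection_le hmax hS hv

end TwoProjections

section Eigenvalues

variable {k V ι : Type*} [Field k] [AddCommGroup V] [Module k V] [Fintype ι]
  {f : Module.End k V} {v : ι → V} {B : Matrix ι ι k}

lemma apply_linearCombination_eq_vecMul (hf : ∀ i, f (v i) = ∑ j, B i j • v j) (c : ι → k) :
    f (Fintype.linearCombination k v c) = Fintype.linearCombination k v (Matrix.vecMul c B) := by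
  simp only [Fintype.linearCombination_apply, map_sum, map_smul, hf, Finset.smul_sum, smul_smul,
    Matrix.vecMul, dotProduct, Finset.sum_smul]
  exact Finset.sum_comm

variable [DecidableEq ι]

lemma isRoot_charpoly_iff_exists_vecMul {t : k} :
    B.charpoly.IsRoot t ↔ ∃ c, c ≠ 0 ∧ Matrix.vecMul c B = t • c := by
  rw [← Matrix.charpoly_transpose, ← Matrix.charpoly_toLin',
    ← Module.End.hasEigenvalue_iff_isRoot_charpoly]
  refine ⟨fun h => ?_, fun ⟨c, hc0, hc⟩ => ?_⟩
  · obtain ⟨c, hc⟩ := h.exists_hasEigenvector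
    exact ⟨c, hc.2, by rw [← hc.apply_eq_smul, Matrix.toLin'_apply, Matrix.mulVec_transpose]⟩
  · refine Module.End.hasEigenvalue_of_hasEigenvector (x := c)
      (Module.End.hasEigenvector_iff.2 ⟨Module.End.mem_eigenspace_iff.2 ?_, hc0⟩)
    rw [Matrix.toLin'_apply, Matrix.mulVec_transpose, hc]

/-- The `v i` need not be linearly independent: it suffices that `B` kills their relations. -/
lemma hasEigenvalue_iff_isRoot_charpoly_of_apply_eq_sum
    (hf : ∀ i, f (v i) = ∑ j, B i j • v j)
    (hrange : LinearMap.range f ≤ Submodule.span k (Set.range v))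
    (hker : ∀ c, Fintype.linearCombination k v c = 0 → Matrix.vecMul c B = 0) {t : k}
    (ht : t ≠ 0) : f.HasEigenvalue t ↔ B.charpoly.IsRoot t := by
  rw [isRoot_charpoly_iff_exists_vecMul]
  refine ⟨fun h => ?_, fun ⟨c, hc0, hc⟩ => ?_⟩
  · obtain ⟨w, hw⟩ := h.exists_hasEigenvector
    have hmem : w ∈ Submodule.span k (Set.range v) := by
      rw [← Submodule.smul_mem_iff _ ht, ← hw.apply_eq_smul]
      exact hrange ⟨w, rfl⟩
    obtain ⟨c, rfl⟩ := Fintype.range_linearCombination k v ▸ hmem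
    have hcB : Fintype.linearCombination k v (Matrix.vecMul c B)
        = t • Fintype.linearCombination k v c := by
      rw [← apply_linearCombination_eq_vecMul hf, hw.apply_eq_smul]
    refine ⟨Matrix.vecMul c B, fun h0 => ?_, ?_⟩
    · rw [h0, map_zero] at hcB
      exact smul_ne_zero ht hw.2 hcB.symm
    · have := hker (Matrix.vecMul c B - t • c) (by rw [map_sub, map_smul, hcB, sub_self])
      rwa [Matrix.sub_vecMul, Matrix.smul_vecMul, sub_eq_zero] at this
  · refine Module.End.hasEigenvalue_of_hasEigenvector (x := Fintype.linearCombination k v c)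
      (Module.End.hasEigenvector_iff.2 ⟨Module.End.mem_eigenspace_iff.2 ?_, fun h0 => ?_⟩)
    · rw [apply_linearCombination_eq_vecMul hf, hc, map_smul]
    · exact hc0 ((smul_eq_zero.1 (hc ▸ hker c h0)).resolve_left ht)

end Eigenvalues

section Eps

variable {m n : ℕ}

lemma groundSpace_inf_groundSpace (m n : ℕ) :
    groundSpace (m + n + 1) 0 m ⊓ groundSpace (m + n + 1) m (m + n)
      = groundSpace (m + n + 1) 0 (m + n) := by
  ext ψ
  simp only [Submodule.mem_inf, mem_groundSpace_iff]
  refine ⟨fun ⟨hl, hr⟩ x y _ hxy _ => ?_, fun h => ⟨fun x y hx hxy _ => h x y hx hxy (by omega),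
    fun x y _ hxy hy => h x y (Nat.zero_le _) hxy hy⟩⟩
  rcases le_or_gt (y : ℕ) m with hm | hm
  · exact hl x y (Nat.zero_le _) hxy hm
  · exact hr x y (by omega) hxy (by omega)

lemma kennedyTasaki_conj_apply (ψ : Chain (m + n + 1)) :
    (kennedyTasaki (m + n + 1) * K m n * star (kennedyTasaki (m + n + 1))) ψ
      = kennedyTasaki (m + n + 1) (sandwich (groundSpace (m + n + 1) 0 m)
        (groundSpace (m + n + 1) m (m + n)) (kennedyTasaki (m + n + 1) ψ)) := by
  rw [star_kennedyTasaki]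
  rfl

lemma hasEigenvalue_kennedyTasaki_conj_iff {t : ℂ} :
    Module.End.HasEigenvalue ((kennedyTasaki (m + n + 1) * K m n *
        star (kennedyTasaki (m + n + 1)) : Op (m + n + 1)) : Module.End ℂ (Chain (m + n + 1))) t
      ↔ (sandwich (groundSpace (m + n + 1) 0 m)
        (groundSpace (m + n + 1) m (m + n))).HasEigenvalue t := by
  have hinj : Function.Injective (kennedyTasaki (m + n + 1)) :=
    Function.LeftInverse.injective kennedyTasaki_kennedyTasaki
  constructor <;> intro h <;> obtain ⟨w, hw⟩ := h.exists_hasEigenvector <;>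
    refine Module.End.hasEigenvalue_of_hasEigenvector (x := kennedyTasaki (m + n + 1) w)
      (Module.End.hasEigenvector_iff.2 ⟨Module.End.mem_eigenspace_iff.2 ?_,
        (map_ne_zero_iff _ hinj).2 hw.2⟩)
  · apply hinj
    rw [← kennedyTasaki_conj_apply, map_smul, kennedyTasaki_kennedyTasaki]
    exact hw.apply_eq_smul
  · rw [ContinuousLinearMap.coe_coe, kennedyTasaki_conj_apply, kennedyTasaki_kennedyTasaki,
      hw.apply_eq_smul, map_smul]

lemma hasEigenvalue_sandwich_groundSpace_iff (hm : 1 ≤ m) (hn : 1 ≤ n) {t : ℝ} (ht : t ≠ 0) :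
    (sandwich (groundSpace (m + n + 1) 0 m) (groundSpace (m + n + 1) m (m + n))).HasEigenvalue
      (t : ℂ) ↔ t = 1 ∨ t = lam5 m n ∨ t = lam1 m n ∨ t = lam3plus m n ∨ t = lam3minus m n := by
  rw [← hasEigenvalue_kennedyTasaki_conj_iff, hasEigenvalue_iff_isRoot_charpoly_of_apply_eq_sum
    (kennedyTasaki_K_Theta hm hn) (range_kennedyTasaki_K_le hm hn)
    (fun c hc => vecMul_A_eq_zero hm hc) (Complex.ofReal_ne_zero.2 ht), charpoly_A hm hn]
  simp only [Polynomial.IsRoot, Polynomial.eval_mul, Polynomial.eval_pow, Polynomial.eval_sub,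
    Polynomial.eval_X, Polynomial.eval_C, mul_eq_zero, pow_eq_zero_iff, ne_eq, OfNat.ofNat_ne_zero,
    not_false_eq_true, sub_eq_zero, Complex.ofReal_inj, Complex.ofReal_eq_one]
  tauto

lemma three_add_mul_three_add_pos (hm : 1 ≤ m) (hn : 1 ≤ n) :
    0 < (3 + (-1 / 3 : ℝ) ^ m) * (3 + (-1 / 3 : ℝ) ^ n) :=
  mul_pos (by linarith [(neg_third_pow_mem_Icc hm).1]) (by linarith [(neg_third_pow_mem_Icc hn).1])

lemma lam5_pos (hm : 1 ≤ m) (hn : 1 ≤ n) : 0 < lam5 m n := by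
  have hx := (neg_third_pow_mem_Icc hm).2
  have hy := (neg_third_pow_mem_Icc hn).2
  rw [lam5_eq]
  exact div_pos (mul_pos (by linarith) (by linarith)) (three_add_mul_three_add_pos hm hn)

lemma lam3minus_le_lam3plus (hm : 1 ≤ m) (hn : 1 ≤ n) : lam3minus m n ≤ lam3plus m n := by
  rw [lam3plus_eq, lam3minus_eq]
  refine div_le_div_of_nonneg_right ?_ (three_add_mul_three_add_pos hm hn).le
  linarith [Real.sqrt_nonneg (lamR m n)]

lemma lam3plus_le {c d : ℝ} (hm : 1 ≤ m) (hn : 1 ≤ n) (hd : 0 ≤ d) (hR : 4 * lamR m n ≤ d ^ 2)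
    (h : lamQ m n + d ≤ c * ((3 + (-1 / 3 : ℝ) ^ m) * (3 + (-1 / 3 : ℝ) ^ n))) :
    lam3plus m n ≤ c := by
  rw [lam3plus_eq, div_le_iff₀ (three_add_mul_three_add_pos hm hn)]
  have : Real.sqrt (lamR m n) ≤ d / 2 := Real.sqrt_le_iff.2 ⟨by linarith, by nlinarith⟩
  linarith

lemma lamR_le_one (hm : 1 ≤ m) (hn : 1 ≤ n) : lamR m n ≤ 1 := by
  obtain ⟨hx, hx'⟩ := neg_third_pow_mem_Icc hm
  obtain ⟨hy, hy'⟩ := neg_third_pow_mem_Icc hn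
  rw [lamR_eq]
  generalize (-1 / 3 : ℝ) ^ m = x at *
  generalize (-1 / 3 : ℝ) ^ n = y at *
  have hdiff : (x - y) ^ 2 ≤ (4 / 9) ^ 2 := sq_le_sq' (by linarith) (by linarith)
  have hxy : x * y ≤ 1 / 9 := by nlinarith
  have hprod : 0 ≤ (1 + x) * (1 + y) := by nlinarith
  have hprod' : (1 + x) * (1 + y) ≤ 100 / 81 := by nlinarith
  have hmixed : x * y * ((1 + x) * (1 + y)) ≤ 1 / 9 * (100 / 81) := by
    nlinarith [mul_nonneg hprod (sub_nonneg.2 hxy)]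
  nlinarith [sq_nonneg (x * y)]

lemma lam_lt_one (hm : 1 ≤ m) (hn : 1 ≤ n) :
    max (lam5 m n) (max (lam1 m n) (lam3plus m n)) < 1 := by
  have hden := three_add_mul_three_add_pos hm hn
  obtain ⟨hx, hx'⟩ := neg_third_pow_mem_Icc hm
  obtain ⟨hy, hy'⟩ := neg_third_pow_mem_Icc hn
  refine max_lt ?_ (max_lt ?_ ?_)
  · rw [lam5_eq, div_lt_one hden]
    nlinarith
  · rw [lam1_eq hm hn, div_lt_one hden]
    nlinarith
  · have h : lam3plus m n ≤ 9 / 10 := by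
      refine lam3plus_le (d := 2) hm hn (by norm_num) (by linarith [lamR_le_one hm hn]) ?_
      rw [lamQ]
      nlinarith
    linarith

theorem eps_eq (hm : 1 ≤ m) (hn : 1 ≤ n) :
    eps m n = max (lam5 m n) (max (lam1 m n) (lam3plus m n)) := by
  set c := max (lam5 m n) (max (lam1 m n) (lam3plus m n))
  have hpos : 0 < c := (lam5_pos hm hn).trans_le (le_max_left _ _)
  have hsqrt := lam3minus_le_lam3plus hm hn
  unfold eps
  rw [← groundSpace_inf_groundSpace]
  refine (isGreatest_re_inner_starProjection hpos.ne' (lam_lt_one hm hn).ne ?_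
    fun t ht => ?_).csSup_eq
  · rw [hasEigenvalue_sandwich_groundSpace_iff hm hn hpos.ne']
    grind
  · rcases eq_or_ne t 0 with rfl | ht0
    · exact Or.inr hpos.le
    · have := (hasEigenvalue_sandwich_groundSpace_iff hm hn ht0).1 ht
      grind

lemma lam5_one_one : lam5 1 1 = 1 / 4 := by rw [lam5_eq]; norm_num

lemma lam5_three_three : lam5 3 3 = (7 / 20) ^ 2 := by rw [lam5_eq]; norm_num

lemma eps_one_right_le (hm : 1 ≤ m) : eps m 1 ≤ 1 / 4 := by
  have hden := three_add_mul_three_add_pos hm le_rfl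
  obtain ⟨hx, hx'⟩ := neg_third_pow_mem_Icc hm
  rw [eps_eq hm le_rfl]
  refine max_le ?_ (max_le ?_ ?_)
  · rw [lam5_eq, div_le_iff₀ hden]
    nlinarith
  · rw [lam1_eq hm le_rfl, div_le_iff₀ hden]
    nlinarith
  · refine lam3plus_le (d := 2 / 3 + 46 / 27 * (-1 / 3) ^ m) hm le_rfl (by linarith) ?_ ?_
    · rw [lamR_eq]
      nlinarith
    · rw [lamQ]
      nlinarith

lemma eps_three_right_le (hm : 3 ≤ m) : eps m 3 ≤ (7 / 20) ^ 2 := by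
  have hm1 : 1 ≤ m := by omega
  have hden := three_add_mul_three_add_pos hm1 (by norm_num : 1 ≤ 3)
  obtain ⟨hx, hx'⟩ : (-1 / 3 : ℝ) ^ m ∈ Set.Icc (-(1 / 27)) (1 / 81) := by
    obtain ⟨k, rfl⟩ := Nat.exists_eq_add_of_le' hm
    obtain ⟨h, h'⟩ := neg_third_pow_mem_Icc (N := k + 1) (by omega)
    rw [show k + 3 = k + 1 + 2 by ring, pow_add]
    constructor <;> linarith
  rw [eps_eq hm1 (by norm_num)]
  refine max_le ?_ (max_le ?_ ?_)
  · rw [lam5_eq, div_le_iff₀ hden]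
    norm_num at *
    nlinarith
  · rw [lam1_eq hm1 (by norm_num), div_le_iff₀ hden]
    norm_num at *
    nlinarith
  · refine lam3plus_le (d := 12 / 100 - 7 / 10 * (-1 / 3) ^ m) hm1 (by norm_num) (by linarith) ?_ ?_
    · rw [lamR_eq]
      norm_num at *
      nlinarith
    · rw [lamQ]
      norm_num at *
      nlinarith

lemma eps_one_one : eps 1 1 = 1 / 4 :=
  le_antisymm (eps_one_right_le le_rfl)
    (eps_eq (le_refl 1) (le_refl 1) ▸ lam5_one_one ▸ le_max_left _ _)

lemma eps_three_three : eps 3 3 = (7 / 20) ^ 2 :=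
  le_antisymm (eps_three_right_le le_rfl)
    (eps_eq (m := 3) (n := 3) (by norm_num) (by norm_num) ▸ lam5_three_three ▸ le_max_left _ _)

lemma epsSup_eq_eps_of_forall_le (h : ∀ k, m ≤ k → eps k n ≤ eps m n) :
    epsSup m n = eps m n :=
  IsLUB.ciSup_eq ⟨by rintro _ ⟨k, rfl⟩; exact h k k.2, fun _ hb => hb ⟨⟨m, le_refl m⟩, rfl⟩⟩

lemma epsSup_one_one : epsSup 1 1 = 1 / 4 :=
  (epsSup_eq_eps_of_forall_le fun _ hk => eps_one_one ▸ eps_one_right_le hk).trans eps_one_one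

lemma epsSup_three_three : epsSup 3 3 = (7 / 20) ^ 2 :=
  (epsSup_eq_eps_of_forall_le fun _ hk => eps_three_three ▸ eps_three_right_le hk).trans
    eps_three_three

end Eps

section LocalEstimates

/-- The projection of real two-site functions onto total spin 2. -/
def twoProj (h : Fin 3 → Fin 3 → ℝ) (a b : Fin 3) : ℝ :=
  ∑ s, ∑ t, (spinTwoInt (a, b) (s, t) : ℝ) / 6 * h s t

/-- The inner products of a real two-site function with the vectors `|+-⟩ - |00⟩ + |-+⟩` (spin 0)
and `|+0⟩ - |0+⟩`, `|+-⟩ - |-+⟩`, `|0-⟩ - |-0⟩` (spin 1), which are orthogonal to spin 2. -/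
def lowPart (i : Fin 4) (h : Fin 3 → Fin 3 → ℝ) : ℝ :=
  ![h 0 2 - h 1 1 + h 2 0, h 0 1 - h 1 0, h 0 2 - h 2 0, h 1 2 - h 2 1] i

/-- The inverse square norms of the vectors of `lowPart`. -/
def lowWeight : Fin 4 → ℝ := ![1 / 3, 1 / 2, 1 / 2, 1 / 2]

lemma twoProj_eq (h : Fin 3 → Fin 3 → ℝ) (a b : Fin 3) :
    twoProj h a b = ![![h 0 0, (h 0 1 + h 1 0) / 2, (h 0 2 + 2 * h 1 1 + h 2 0) / 6],
      ![(h 0 1 + h 1 0) / 2, (h 0 2 + 2 * h 1 1 + h 2 0) / 3, (h 1 2 + h 2 1) / 2],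
      ![(h 0 2 + 2 * h 1 1 + h 2 0) / 6, (h 1 2 + h 2 1) / 2, h 2 2]] a b := by
  fin_cases a <;> fin_cases b <;>
    simp [twoProj, Fin.sum_univ_three, spinTwoInt, spinTwoCoeff, Fin.ofNat] <;> ring

lemma twoProj_sub (h k : Fin 3 → Fin 3 → ℝ) (a b : Fin 3) :
    twoProj (fun a b => h a b - k a b) a b = twoProj h a b - twoProj k a b := by
  simp only [twoProj, mul_sub, Finset.sum_sub_distrib]

lemma lowPart_sub (i : Fin 4) (h k : Fin 3 → Fin 3 → ℝ) :
    lowPart i (fun a b => h a b - k a b) = lowPart i h - lowPart i k := by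
  fin_cases i <;> simp [lowPart] <;> ring

lemma lowPart_twoProj (i : Fin 4) (g : Fin 3 → Fin 3 → Fin 3 → Fin 3 → ℝ) (c d : Fin 3) :
    lowPart i (fun a b => twoProj (g a b) c d)
      = twoProj (fun c d => lowPart i fun a b => g a b c d) c d := by
  simp only [twoProj, Fin.sum_univ_three]
  fin_cases i <;> simp [lowPart] <;> ring

lemma sum_sq_sub_twoProj (h : Fin 3 → Fin 3 → ℝ) :
    ∑ a, ∑ b, (h a b - twoProj h a b) ^ 2 = ∑ i, lowWeight i * lowPart i h ^ 2 := by
  simp only [twoProj_eq, Fin.sum_univ_three, Fin.sum_univ_four, lowPart, lowWeight]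
  simp
  ring

lemma sum_sq_twoProj (h : Fin 3 → Fin 3 → ℝ) :
    ∑ a, ∑ b, twoProj h a b ^ 2 = h 0 0 ^ 2 + (h 0 1 + h 1 0) ^ 2 / 2
      + (h 0 2 + 2 * h 1 1 + h 2 0) ^ 2 / 6 + (h 1 2 + h 2 1) ^ 2 / 2 + h 2 2 ^ 2 := by
  simp only [twoProj_eq, Fin.sum_univ_three]
  simp
  ring

lemma eq_of_twoProj_eq_zero {h : Fin 3 → Fin 3 → ℝ} (h0 : ∀ a b, twoProj h a b = 0) :
    h 0 0 = 0 ∧ h 2 2 = 0 ∧ h 1 0 = -h 0 1 ∧ h 2 1 = -h 1 2 ∧ h 1 1 = -(h 0 2 + h 2 0) / 2 := by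
  simp only [twoProj_eq] at h0
  have h00 : h 0 0 = 0 := h0 0 0
  have h22 : h 2 2 = 0 := h0 2 2
  have h01 : (h 0 1 + h 1 0) / 2 = 0 := h0 0 1
  have h12 : (h 1 2 + h 2 1) / 2 = 0 := h0 1 2
  have h11 : (h 0 2 + 2 * h 1 1 + h 2 0) / 3 = 0 := h0 1 1
  exact ⟨h00, h22, by linarith, by linarith, by linarith⟩

lemma sum_sq_sub_twoProj_sub_twoProj (g : Fin 3 → Fin 3 → Fin 3 → Fin 3 → ℝ) :
    ∑ a, ∑ b, ∑ c, ∑ d, (g a b c d - twoProj (fun a b => g a b c d) a b - twoProj (g a b) c d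
        + twoProj (fun a b => twoProj (g a b) c d) a b) ^ 2
      = ∑ i, lowWeight i * ∑ j, lowWeight j *
          lowPart j (fun c d => lowPart i fun a b => g a b c d) ^ 2 := by
  let k (c d a b : Fin 3) : ℝ := g a b c d - twoProj (g a b) c d
  calc
    _ = ∑ a, ∑ b, ∑ c, ∑ d, (k c d a b - twoProj (k c d) a b) ^ 2 := by
      simp only [k, twoProj_sub]
      simp only [sub_sub_eq_add_sub, sub_add_eq_add_sub, sub_right_comm]
    _ = ∑ c, ∑ d, ∑ a, ∑ b, (k c d a b - twoProj (k c d) a b) ^ 2 := by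
      simp only [Fin.sum_univ_three]
      ring
    _ = ∑ i, lowWeight i * ∑ c, ∑ d, lowPart i (k c d) ^ 2 := by
      simp only [sum_sq_sub_twoProj, Finset.mul_sum]
      exact (Finset.sum_congr rfl fun c _ => Finset.sum_comm).trans Finset.sum_comm
    _ = _ := by simp only [k, lowPart_sub, lowPart_twoProj, sum_sq_sub_twoProj]

/-- The sum of squares comes from the Cholesky decomposition of the difference of the two sides, in
the coordinates left free by `eq_of_twoProj_eq_zero`. -/
lemma sum_sq_twoProj_le_three_site {f g : Fin 3 → Fin 3 → Fin 3 → ℝ}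
    (hf : ∀ a b c, twoProj (f a) b c = 0)
    (hg : ∀ a b c, g a b c = twoProj (fun a b => f a b c) a b) :
    2 / 3 * ∑ a, ∑ b, ∑ c, g a b c ^ 2 ≤ ∑ a, ∑ b, ∑ c, (g a b c - twoProj (g a) b c) ^ 2 := by
  have hleft : ∑ a, ∑ b, ∑ c, g a b c ^ 2
      = ∑ c, ∑ a, ∑ b, twoProj (fun a b => f a b c) a b ^ 2 := by
    simp only [hg, Fin.sum_univ_three]
    ring
  simp only [hleft, sum_sq_sub_twoProj, sum_sq_twoProj]
  have h00 := fun a => (eq_of_twoProj_eq_zero (hf a)).1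
  have h22 := fun a => (eq_of_twoProj_eq_zero (hf a)).2.1
  have h10 := fun a => (eq_of_twoProj_eq_zero (hf a)).2.2.1
  have h21 := fun a => (eq_of_twoProj_eq_zero (hf a)).2.2.2.1
  have h11 := fun a => (eq_of_twoProj_eq_zero (hf a)).2.2.2.2
  have sum_of_squares : ∑ a, ∑ i, lowWeight i * lowPart i (g a) ^ 2
      - 2 / 3 * ∑ c, (f 0 0 c ^ 2 + (f 0 1 c + f 1 0 c) ^ 2 / 2
      + (f 0 2 c + 2 * f 1 1 c + f 2 0 c) ^ 2 / 6 + (f 1 2 c + f 2 1 c) ^ 2 / 2 + f 2 2 c ^ 2)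
      = 1/8 * f 0 0 1 ^ 2
        + 29/96 * (f 0 0 2 + 23/87 * f 0 2 0 - 46/87 * f 1 0 1) ^ 2
        + 4/27 * (f 0 1 2 + f 1 0 2 + 23/32 * f 1 2 0 - 23/32 * f 2 0 1) ^ 2
        + 55/2088 * (f 0 2 0 - 2 * f 1 0 1) ^ 2
        + 41/216 * (f 1 1 2 + 1/2 * f 2 0 2 + 69/82 * f 2 2 0) ^ 2
        + 55/768 * (f 1 2 0 - f 2 0 1) ^ 2
        + 1/8 * f 2 1 2 ^ 2
        + 55/328 * f 2 2 0 ^ 2 := by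
    simp only [hg, twoProj_eq, Fin.sum_univ_three, Fin.sum_univ_four, lowPart, lowWeight, h00, h22,
      h10, h21, h11]
    simp
    ring
  rw [← sub_nonneg, sum_of_squares]
  positivity

/-- As in `sum_sq_twoProj_le_three_site`, by a Cholesky decomposition. -/
lemma sum_sq_twoProj_le_four_site {f g : Fin 3 → Fin 3 → Fin 3 → Fin 3 → ℝ}
    (hfl : ∀ a b c d, twoProj (fun a b => f a b c d) a b = 0)
    (hfr : ∀ a b c d, twoProj (f a b) c d = 0)
    (hg : ∀ a b c d, g a b c d = twoProj (fun b c => f a b c d) b c) :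
    2 / 3 * ∑ a, ∑ b, ∑ c, ∑ d, g a b c d ^ 2
      ≤ ∑ a, ∑ b, ∑ c, ∑ d, (g a b c d - twoProj (fun a b => g a b c d) a b - twoProj (g a b) c d
          + twoProj (fun a b => twoProj (g a b) c d) a b) ^ 2 := by
  have hleft : ∑ a, ∑ b, ∑ c, ∑ d, g a b c d ^ 2
      = ∑ a, ∑ d, ∑ b, ∑ c, twoProj (fun b c => f a b c d) b c ^ 2 := by
    simp only [hg, Fin.sum_univ_three]
    ring
  simp only [hleft, sum_sq_sub_twoProj_sub_twoProj, sum_sq_twoProj]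
  have hl := fun c d => eq_of_twoProj_eq_zero fun a b => hfl a b c d
  have hr := fun a b => eq_of_twoProj_eq_zero (hfr a b)
  simp only [forall_and] at hl hr
  obtain ⟨l00, l22, l10, l21, l11⟩ := hl
  obtain ⟨r00, r22, r10, r21, r11⟩ := hr
  have sum_of_squares : ∑ i, lowWeight i * ∑ j, lowWeight j *
        lowPart j (fun c d => lowPart i fun a b => g a b c d) ^ 2
      - 2 / 3 * ∑ a, ∑ d, (f a 0 0 d ^ 2 + (f a 0 1 d + f a 1 0 d) ^ 2 / 2
      + (f a 0 2 d + 2 * f a 1 1 d + f a 2 0 d) ^ 2 / 6 + (f a 1 2 d + f a 2 1 d) ^ 2 / 2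
      + f a 2 2 d ^ 2)
      = 55/432 * (f 0 1 0 2 + 9/11 * f 0 1 2 0 - 9/11 * f 0 2 0 1 - 7/11 * f 2 0 0 1) ^ 2
        + 125/648 * (f 0 1 1 2 + 1/2 * f 0 2 0 2 + 22/25 * f 0 2 2 0
          + 19/25 * f 1 2 0 1 + 22/25 * f 2 0 0 2 + 19/50 * f 2 0 2 0) ^ 2
        + 5/264 * (f 0 1 2 0 - f 0 2 0 1 - 2 * f 2 0 0 1) ^ 2
        + 55/432 * (f 0 2 1 2 - 9/11 * f 1 2 0 2 - 7/11 * f 1 2 2 0 + 9/11 * f 2 0 1 2) ^ 2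
        + 269/2160 * (f 0 2 2 0 + 88/269 * f 1 2 0 1 - 181/269 * f 2 0 0 2 + 44/269 * f 2 0 2 0) ^ 2
        + 55/807 * (f 1 2 0 1 + f 2 0 0 2 + 1/2 * f 2 0 2 0) ^ 2
        + 5/264 * (f 1 2 0 2 + 2 * f 1 2 2 0 - f 2 0 1 2) ^ 2 := by
    simp only [hg, twoProj_eq, Fin.sum_univ_three, Fin.sum_univ_four, lowPart, lowWeight]
    simp [l00, l22, l10, l21, l11, r00, r22, r10, r21, r11]
    ring
  rw [← sub_nonneg, sum_of_squares]
  positivity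

end LocalEstimates

section Slices

variable {ι κ α : Type*} [DecidableEq ι] [DecidableEq κ] {e : κ → ι}

lemma upd2_extend (he : e.Injective) (i j : κ) (a : κ → α) (σ : ι → α) (s t : α) :
    upd2 (Function.extend e a σ) (e i) (e j) s t = Function.extend e (upd2 a i j s t) σ := by
  ext x
  by_cases hx : ∃ k, e k = x
  · obtain ⟨k, rfl⟩ := hx
    simp only [upd2, Function.update_apply, he.extend_apply, he.eq_iff]
  · have hxe : ∀ k, x ≠ e k := fun k hk => hx ⟨k, hk.symm⟩
    rw [upd2_of_ne (hxe i) (hxe j), Function.extend_apply' _ _ _ hx,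
      Function.extend_apply' _ _ _ hx]

/-- `(σ, a) ↦ (extend e a σ, σ ∘ e)` is an involution. -/
lemma card_nsmul_sum_eq_sum_extend [Fintype ι] [Fintype κ] [Fintype α] {β : Type*}
    [AddCommMonoid β] (he : e.Injective) (F : (ι → α) → β) :
    Fintype.card (κ → α) • ∑ σ, F σ = ∑ σ, ∑ a : κ → α, F (Function.extend e a σ) := by
  let swap (p : (ι → α) × (κ → α)) : (ι → α) × (κ → α) :=
    (Function.extend e p.2 p.1, p.1 ∘ e)
  have hswap : Function.Involutive swap := by
    rintro ⟨σ, a⟩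
    refine Prod.ext (funext fun x => ?_) (funext fun k => he.extend_apply _ _ _)
    by_cases hx : ∃ k, e k = x
    · obtain ⟨k, rfl⟩ := hx
      simp [swap, he.extend_apply]
    · simp [swap, Function.extend_apply' _ _ _ hx]
  calc Fintype.card (κ → α) • ∑ σ, F σ
      = ∑ σ, ∑ _a : κ → α, F σ := by
        simp only [Finset.sum_const, Finset.card_univ, Finset.smul_sum]
    _ = ∑ σ, ∑ a : κ → α, F (Function.extend e a σ) := by
        rw [← Fintype.sum_prod_type', ← Fintype.sum_prod_type']
        exact (Fintype.sum_equiv hswap.toPerm _ _ fun p => rfl).symm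

lemma sum_vecCons {n : ℕ} {α β : Type*} [Fintype α] [AddCommMonoid β]
    (F : (Fin (n + 1) → α) → β) :
    ∑ a, F a = ∑ s, ∑ a : Fin n → α, F (Matrix.vecCons s a) := by
  rw [← Fintype.sum_prod_type']
  exact (Fintype.sum_equiv (Fin.consEquiv fun _ => α) _ _ fun _ => rfl).symm

end Slices

section BondEstimates

variable {L : ℕ} {x y z w : Fin L}

lemma apply_bond_extend (hxy : x ≠ y) {κ : Type*} [DecidableEq κ] {e : κ → Fin L}
    (he : e.Injective) {i j : κ} (hi : e i = x) (hj : e j = y) (ρ : ℂ →ₗ[ℝ] ℝ) (ψ : Chain L)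
    (a : κ → Fin 3) (σ : Fin L → Fin 3) :
    ρ (bond x y ψ (Function.extend e a σ))
      = twoProj (fun s t => ρ (ψ (Function.extend e (upd2 a i j s t) σ))) (a i) (a j) := by
  subst hi hj
  simp only [bond_apply hxy, he.extend_apply, upd2_extend he, twoProj, map_sum]
  refine Finset.sum_congr rfl fun s _ => Finset.sum_congr rfl fun t _ => ?_
  rw [← smul_eq_mul (a := (_ / 6 : ℝ)), ← map_smul, Complex.real_smul]
  push_cast
  rfl

lemma norm_sq_eq_sum_re_add_sum_im (ψ : Chain L) :
    ‖ψ‖ ^ 2 = ∑ σ, reLm (ψ σ) ^ 2 + ∑ σ, imLm (ψ σ) ^ 2 := by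
  rw [EuclideanSpace.norm_sq_eq, ← Finset.sum_add_distrib]
  refine Finset.sum_congr rfl fun σ _ => ?_
  rw [← Complex.normSq_eq_norm_sq, Complex.normSq_apply]
  simp only [reLm_coe, imLm_coe, sq]

/-- An inequality of norms follows from the same inequality on the real and imaginary parts of all
slices in which only the values at the sites `e i` vary. -/
lemma mul_norm_sq_le_of_forall_extend {κ : Type*} [Fintype κ] [DecidableEq κ] {e : κ → Fin L}
    (he : e.Injective) {c : ℝ} {ψ χ : Chain L}
    (h : ∀ (ρ : ℂ →ₗ[ℝ] ℝ) (σ : Fin L → Fin 3),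
      c * ∑ a : κ → Fin 3, ρ (ψ (Function.extend e a σ)) ^ 2
        ≤ ∑ a : κ → Fin 3, ρ (χ (Function.extend e a σ)) ^ 2) :
    c * ‖ψ‖ ^ 2 ≤ ‖χ‖ ^ 2 := by
  have part (ρ : ℂ →ₗ[ℝ] ℝ) : c * ∑ σ, ρ (ψ σ) ^ 2 ≤ ∑ σ, ρ (χ σ) ^ 2 := by
    have hcard : (0 : ℝ) < Fintype.card (κ → Fin 3) := by exact_mod_cast Fintype.card_pos
    refine le_of_mul_le_mul_left ?_ hcard
    rw [mul_left_comm, ← nsmul_eq_mul, ← nsmul_eq_mul, card_nsmul_sum_eq_sum_extend he,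
      card_nsmul_sum_eq_sum_extend he, Finset.mul_sum]
    exact Finset.sum_le_sum fun σ _ => h ρ σ
  rw [norm_sq_eq_sum_re_add_sum_im, norm_sq_eq_sum_re_add_sum_im, mul_add]
  exact add_le_add (part reLm) (part imLm)

lemma norm_sq_bond_le_three_site (hxy : x ≠ y) (hxz : x ≠ z) (hyz : y ≠ z) {ψ : Chain L}
    (h : bond y z ψ = 0) :
    2 / 3 * ‖bond x y ψ‖ ^ 2 ≤ ‖bond x y ψ - bond y z (bond x y ψ)‖ ^ 2 := by
  have he : Function.Injective ![x, y, z] := by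
    intro i j
    fin_cases i <;> fin_cases j <;> simp [hxy, hxz, hyz, hxy.symm, hxz.symm, hyz.symm]
  have upd01 (a b c s t : Fin 3) : upd2 ![a, b, c] 0 1 s t = ![s, t, c] := by
    ext i; fin_cases i <;> rfl
  have upd12 (a b c s t : Fin 3) : upd2 ![a, b, c] 1 2 s t = ![a, s, t] := by
    ext i; fin_cases i <;> rfl
  refine mul_norm_sq_le_of_forall_extend he fun ρ σ => ?_
  have hbxy (χ : Chain L) (a b c : Fin 3) :=
    apply_bond_extend hxy he (i := 0) (j := 1) rfl rfl ρ χ ![a, b, c] σ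
  have hbyz (χ : Chain L) (a b c : Fin 3) :=
    apply_bond_extend hyz he (i := 1) (j := 2) rfl rfl ρ χ ![a, b, c] σ
  simp only [upd01, upd12] at hbxy hbyz
  simp only [sum_vecCons, Fintype.sum_unique, Matrix.empty_eq, PiLp.sub_apply, map_sub,
    hbyz (bond _ _ _)]
  exact sum_sq_twoProj_le_three_site
    (fun a b c => (hbyz ψ a b c).symm.trans (by simp [h])) (hbxy ψ)

lemma norm_sq_bond_le_four_site (hxy : x ≠ y) (hxz : x ≠ z) (hyz : y ≠ z) (hxw : x ≠ w)
    (hyw : y ≠ w) (hzw : z ≠ w) {ψ : Chain L} (hψl : bond x y ψ = 0) (hψr : bond z w ψ = 0) :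
    2 / 3 * ‖bond y z ψ‖ ^ 2 ≤ ‖bond y z ψ - bond x y (bond y z ψ) - bond z w (bond y z ψ)
      + bond x y (bond z w (bond y z ψ))‖ ^ 2 := by
  have he : Function.Injective ![x, y, z, w] := by
    intro i j
    fin_cases i <;> fin_cases j <;> simp [hxy, hxz, hyz, hxw, hyw, hzw, hxy.symm, hxz.symm,
      hyz.symm, hxw.symm, hyw.symm, hzw.symm]
  have upd01 (a b c d s t : Fin 3) : upd2 ![a, b, c, d] 0 1 s t = ![s, t, c, d] := by
    ext i; fin_cases i <;> rfl
  have upd12 (a b c d s t : Fin 3) : upd2 ![a, b, c, d] 1 2 s t = ![a, s, t, d] := by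
    ext i; fin_cases i <;> rfl
  have upd23 (a b c d s t : Fin 3) : upd2 ![a, b, c, d] 2 3 s t = ![a, b, s, t] := by
    ext i; fin_cases i <;> rfl
  refine mul_norm_sq_le_of_forall_extend he fun ρ σ => ?_
  have hbxy (χ : Chain L) (a b c d : Fin 3) :=
    apply_bond_extend hxy he (i := 0) (j := 1) rfl rfl ρ χ ![a, b, c, d] σ
  have hbyz (χ : Chain L) (a b c d : Fin 3) :=
    apply_bond_extend hyz he (i := 1) (j := 2) rfl rfl ρ χ ![a, b, c, d] σ
  have hbzw (χ : Chain L) (a b c d : Fin 3) :=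
    apply_bond_extend hzw he (i := 2) (j := 3) rfl rfl ρ χ ![a, b, c, d] σ
  simp only [upd01, upd12, upd23] at hbxy hbyz hbzw
  simp only [sum_vecCons, Fintype.sum_unique, Matrix.empty_eq, PiLp.sub_apply, PiLp.add_apply,
    map_sub, map_add, hbxy (bond _ _ _), hbzw (bond _ _ _)]
  exact sum_sq_twoProj_le_four_site (fun a b c d => (hbxy ψ a b c d).symm.trans (by simp [hψl]))
    (fun a b c d => (hbzw ψ a b c d).symm.trans (by simp [hψr])) (hbyz ψ)

lemma bond_comm (x y : Fin L) : bond x y = bond y x := by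
  simp only [bond, totalSpinSq, add_comm]

lemma commute_bond (hxy : x ≠ y) (hzw : z ≠ w) (hxz : x ≠ z) (hxw : x ≠ w) (hyz : y ≠ z)
    (hyw : y ≠ w) : Commute (bond x y) (bond z w) := by
  ext ψ σ
  simp only [mul_apply_eq_comp, bond_apply hxy, bond_apply hzw, upd2_of_ne hxz.symm hyz.symm,
    upd2_of_ne hxw.symm hyw.symm, upd2_of_ne hxz hxw, upd2_of_ne hyz hyw,
    upd2_comm hxz hxw hyz hyw, Fin.sum_univ_three]
  ring

end BondEstimates

section Window

variable {E : Type*} [NormedAddCommGroup E] [InnerProductSpace ℝ E]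

lemma inner_apply_apply_of_isSymmetricProjection {p : E →ₗ[ℝ] E} (hp : p.IsSymmetricProjection)
    (u v : E) : inner ℝ (p u) (p v) = inner ℝ u (p v) := by
  rw [hp.isSymmetric, ← Module.End.mul_apply, hp.isIdempotentElem.eq]

lemma inner_apply_self_of_isSymmetricProjection {p : E →ₗ[ℝ] E} (hp : p.IsSymmetricProjection)
    (u : E) : inner ℝ u (p u) = ‖p u‖ ^ 2 := by
  rw [← inner_apply_apply_of_isSymmetricProjection hp, real_inner_self_eq_norm_sq]

lemma norm_sq_sub_apply_of_isSymmetricProjection {p : E →ₗ[ℝ] E} (hp : p.IsSymmetricProjection)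
    (u : E) : ‖u - p u‖ ^ 2 = ‖u‖ ^ 2 - ‖p u‖ ^ 2 := by
  rw [norm_sub_sq_real, inner_apply_self_of_isSymmetricProjection hp]
  ring

lemma isSymmetricProjection_mul {p q : E →ₗ[ℝ] E} (hp : p.IsSymmetricProjection)
    (hq : q.IsSymmetricProjection) (hpq : Commute p q) : (p * q).IsSymmetricProjection where
  isIdempotentElem := hp.isIdempotentElem.mul_of_commute hpq hq.isIdempotentElem
  isSymmetric := hp.isSymmetric.mul_of_commute hq.isSymmetric hpq

lemma isSymmetricProjection_add_sub_mul {p q : E →ₗ[ℝ] E} (hp : p.IsSymmetricProjection)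
    (hq : q.IsSymmetricProjection) (hpq : Commute p q) :
    (p + q - p * q).IsSymmetricProjection where
  isIdempotentElem := hp.isIdempotentElem.add_sub_mul_of_commute hpq hq.isIdempotentElem
  isSymmetric := (hp.isSymmetric.add hq.isSymmetric).sub (hp.isSymmetric.mul_of_commute
    hq.isSymmetric hpq)

lemma mul_add_sub_mul_of_isIdempotentElem {A : Type*} [Ring A] {a : A} (ha : IsIdempotentElem a)
    (b : A) : a * (a + b - a * b) = a := by
  rw [mul_sub, mul_add, ← mul_assoc, ha.eq, add_sub_cancel_right]

lemma add_sub_mul_mul_mul_of_isIdempotentElem {A : Type*} [Ring A] {a b : A}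
    (ha : IsIdempotentElem a) (hab : Commute a b) : (a + b - a * b) * (a * b) = a * b := by
  have h : Commute (a + b - a * b) a :=
    ((Commute.refl a).add_left hab.symm).sub_left ((Commute.refl a).mul_left hab.symm)
  rw [← mul_assoc, h.eq, mul_add_sub_mul_of_isIdempotentElem ha]

lemma norm_sq_add_norm_sq_of_commute {p q : E →ₗ[ℝ] E} (hp : p.IsSymmetricProjection)
    (hq : q.IsSymmetricProjection) (hpq : Commute p q) (u : E) :
    ‖p u‖ ^ 2 + ‖q u‖ ^ 2 = ‖(p + q - p * q) u‖ ^ 2 + ‖(p * q) u‖ ^ 2 := by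
  rw [← inner_apply_self_of_isSymmetricProjection (isSymmetricProjection_mul hp hq hpq),
    ← inner_apply_self_of_isSymmetricProjection (isSymmetricProjection_add_sub_mul hp hq hpq),
    ← inner_apply_self_of_isSymmetricProjection hp,
    ← inner_apply_self_of_isSymmetricProjection hq, ← inner_add_right, ← inner_add_right,
    LinearMap.sub_apply, sub_add_cancel, LinearMap.add_apply]

/-- `w` is the projection of `q x` onto the image under `q` of the kernel of `p`; the orthogonal
complement of this image in the range of `q` lies in the range of `p`. -/
lemma exists_add_eq_apply_of_angle_le [FiniteDimensional ℝ E] {p q : E →ₗ[ℝ] E}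
    (hp : p.IsSymmetricProjection) (hq : q.IsSymmetricProjection) {δ : ℝ}
    (h : ∀ u, p u = 0 → δ * ‖q u‖ ^ 2 ≤ ‖q u - p (q u)‖ ^ 2) (x : E) :
    ∃ w z, w + z = q x ∧ inner ℝ w z = 0 ∧ p z = z ∧ inner ℝ (p x) z = ‖z‖ ^ 2 ∧
      ‖p w‖ ^ 2 ≤ (1 - δ) * ‖w‖ ^ 2 := by
  let R : Submodule ℝ E := (LinearMap.ker p).map q
  set w := R.starProjection (q x)
  set z := q x - w with hz
  obtain ⟨u, hu, huw⟩ : w ∈ R := Submodule.starProjection_apply_mem _ _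
  have hort (v : E) (hv : p v = 0) : inner ℝ (q v) z = 0 :=
    R.sub_starProjection_mem_orthogonal (q x) _ (Submodule.mem_map_of_mem hv)
  have hpp (v : E) : p (p v) = p v := congrArg (· v) hp.isIdempotentElem.eq
  have hqq (v : E) : q (q v) = q v := congrArg (· v) hq.isIdempotentElem.eq
  have hqz : q z = z := by rw [hz, map_sub, ← huw, hqq, hqq]
  have hpz : p z = z := by
    have hv : p (z - p z) = 0 := by rw [map_sub, hpp, sub_self]
    rw [eq_comm, ← sub_eq_zero, ← inner_self_eq_zero (𝕜 := ℝ)]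
    nth_rw 1 [inner_sub_left]
    rw [hp.isSymmetric, hv, inner_zero_right, sub_zero, ← hqz, hq.isSymmetric, hqz,
      real_inner_comm, hort _ hv]
  have hwz : inner ℝ w z = 0 := huw ▸ hort u hu
  refine ⟨w, z, add_sub_cancel _ _, hwz, hpz, ?_, ?_⟩
  · rw [hp.isSymmetric, hpz]
    nth_rw 1 [← hqz]
    rw [← hq.isSymmetric, ← add_sub_cancel w (q x), inner_add_left, hwz, zero_add,
      real_inner_self_eq_norm_sq]
  · have := h u hu
    rw [huw, norm_sq_sub_apply_of_isSymmetricProjection hp] at this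
    linarith

lemma quadratic_nonneg_of_inner_eq {v d z b : E} (hvz : inner ℝ v z = ‖z‖ ^ 2)
    (hvd : inner ℝ v d = ‖d‖ ^ 2) (hzb : inner ℝ z b = 0) :
    0 ≤ 0.205 * (‖v‖ ^ 2 + ‖d‖ ^ 2) + 0.41 * (3 * ‖b‖ ^ 2 + ‖z‖ ^ 2)
      + (inner ℝ (v + d) b + ‖z‖ ^ 2 + inner ℝ d z) + 2 * ‖d‖ ^ 2 := by
  have h₁ : 0 ≤ ‖v - z + d + (100 / 41 : ℝ) • b‖ ^ 2 := sq_nonneg _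
  have h₂ : 0 ≤ ‖z + d‖ ^ 2 := sq_nonneg _
  simp only [norm_add_sq_real, norm_sub_sq_real, inner_add_left, inner_sub_left, inner_smul_right,
    norm_smul, mul_pow, Real.norm_eq_abs, sq_abs, real_inner_comm d z, hvz, hvd, hzb] at h₁ h₂ ⊢
  linarith [sq_nonneg ‖b‖, sq_nonneg ‖d‖, sq_nonneg ‖z‖]

/-- Write `v = (P₁ + P₃ - P₁ P₃) x` and `P₂ x = w + z` as in `exists_add_eq_apply_of_angle_le`. The
mixed terms not absorbed by `z` are at least `-‖v‖ ‖w‖ / √3`; the weight `c = 0.205` suffices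
because `8 c ^ 2 ≥ 1 / 3`. -/
theorem window_nonneg [FiniteDimensional ℝ E] {P₁ P₂ P₃ : E →ₗ[ℝ] E}
    (h₁ : P₁.IsSymmetricProjection) (h₂ : P₂.IsSymmetricProjection)
    (h₃ : P₃.IsSymmetricProjection) (hc : Commute P₁ P₃)
    (h : ∀ u, P₁ u = 0 → P₃ u = 0 → 2 / 3 * ‖P₂ u‖ ^ 2
      ≤ ‖P₂ u - P₁ (P₂ u) - P₃ (P₂ u) + P₁ (P₃ (P₂ u))‖ ^ 2) (x : E) :
    0 ≤ 0.205 * (‖P₁ x‖ ^ 2 + ‖P₃ x‖ ^ 2) + 0.41 * ‖P₂ x‖ ^ 2 + inner ℝ (P₁ x) (P₂ x)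
      + inner ℝ (P₂ x) (P₃ x) + 2 * inner ℝ (P₁ x) (P₃ x) := by
  set p := P₁ + P₃ - P₁ * P₃ with hp_def
  have hp : p.IsSymmetricProjection := isSymmetricProjection_add_sub_mul h₁ h₃ hc
  have hker₁ (u : E) (hu : p u = 0) : P₁ u = 0 := by
    rw [← mul_add_sub_mul_of_isIdempotentElem h₁.isIdempotentElem P₃, Module.End.mul_apply, hu,
      map_zero]
  have hker₃ (u : E) (hu : p u = 0) : P₃ u = 0 := by
    rw [← mul_add_sub_mul_of_isIdempotentElem h₃.isIdempotentElem P₁, ← hc.eq, add_comm,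
      Module.End.mul_apply, hu, map_zero]
  obtain ⟨w, z, hwz, hort, hpz, hvz, hw⟩ := exists_add_eq_apply_of_angle_le hp h₂ (δ := 2 / 3)
    (fun u hu => (h u (hker₁ u hu) (hker₃ u hu)).trans_eq (by
      congr 2; simp only [hp_def, LinearMap.sub_apply, LinearMap.add_apply,
        Module.End.mul_apply]; abel)) x
  set d := (P₁ * P₃) x with hd
  have hpd : p d = d :=
    congrArg (· x) (add_sub_mul_mul_mul_of_isIdempotentElem h₁.isIdempotentElem hc)
  have hdiag : ‖P₁ x‖ ^ 2 + ‖P₃ x‖ ^ 2 = ‖p x‖ ^ 2 + ‖d‖ ^ 2 :=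
    norm_sq_add_norm_sq_of_commute h₁ h₃ hc x
  have hfar : inner ℝ x d = ‖d‖ ^ 2 :=
    inner_apply_self_of_isSymmetricProjection (isSymmetricProjection_mul h₁ h₃ hc) x
  have hmid : ‖P₂ x‖ ^ 2 = ‖w‖ ^ 2 + ‖z‖ ^ 2 := by
    rw [← hwz, norm_add_sq_real, hort]; ring
  have hcross : inner ℝ (P₁ x) (P₂ x) + inner ℝ (P₂ x) (P₃ x)
      = inner ℝ (p x + d) (p w) + ‖z‖ ^ 2 + inner ℝ d z := by
    have hsum : P₁ x + P₃ x = p x + d := (sub_add_cancel _ _).symm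
    have hpw : inner ℝ (p x + d) (p w) = inner ℝ (p x + d) w := by
      rw [← hp.isSymmetric, map_add, hpd, ← Module.End.mul_apply, hp.isIdempotentElem.eq]
    rw [real_inner_comm (P₃ x), ← inner_add_left, hsum, ← hwz, inner_add_right, hpw,
      inner_add_left (p x) d z, hvz, add_assoc]
  have key := quadratic_nonneg_of_inner_eq (v := p x) (d := d) (b := p w) hvz
    (by rw [hp.isSymmetric, hpd, hfar]) (by rw [← hp.isSymmetric, hpz, real_inner_comm, hort])
  rw [h₁.isSymmetric x (P₃ x), ← Module.End.mul_apply, ← hd, hdiag, hmid, hfar]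
  linarith

lemma sum_range_succ_shift {M : Type*} [AddCommGroup M] {F : ℕ → M} {n : ℕ} (h0 : F 0 = 0)
    (hn : F n = 0) : ∑ k ∈ Finset.range n, F (k + 1) = ∑ k ∈ Finset.range n, F k := by
  rw [← add_zero (∑ k ∈ Finset.range n, F (k + 1)), ← h0, ← Finset.sum_range_succ',
    Finset.sum_range_succ, hn, add_zero]

lemma sum_inner_le_norm_sq_sum_of_far_nonneg {v : ℕ → E} (h0 : v 0 = 0) (h1 : v 1 = 0)
    (hfar : ∀ j k, j + 3 ≤ k → 0 ≤ inner ℝ (v j) (v k)) (n : ℕ) :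
    ∑ k ∈ Finset.range n, (‖v (k + 2)‖ ^ 2 + 2 * inner ℝ (v (k + 1)) (v (k + 2))
      + 2 * inner ℝ (v k) (v (k + 2))) ≤ ‖∑ k ∈ Finset.range n, v (k + 2)‖ ^ 2 := by
  induction n with
  | zero => simp
  | succ n ih =>
    have key : inner ℝ (v (n + 1)) (v (n + 2)) + inner ℝ (v n) (v (n + 2))
        ≤ inner ℝ (∑ k ∈ Finset.range n, v (k + 2)) (v (n + 2)) := by
      match n with
      | 0 => simp [h0, h1]
      | 1 => simp [h1]
      | n + 2 =>
        have : 0 ≤ ∑ k ∈ Finset.range n, inner ℝ (v (k + 2)) (v (n + 2 + 2)) :=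
          Finset.sum_nonneg fun k hk => hfar _ _ (by have := Finset.mem_range.1 hk; omega)
        rw [Finset.sum_range_succ, Finset.sum_range_succ, inner_add_left, inner_add_left, sum_inner]
        linarith
    rw [Finset.sum_range_succ, Finset.sum_range_succ, norm_add_sq_real]
    linarith

theorem inner_sum_le_norm_sq_sum [FiniteDimensional ℝ E] {P : ℕ → E →ₗ[ℝ] E}
    (hP : ∀ k, (P k).IsSymmetricProjection) (hc : ∀ j k, j + 2 ≤ k → Commute (P j) (P k))
    (hw : ∀ k u, P k u = 0 → P (k + 2) u = 0 → 2 / 3 * ‖P (k + 1) u‖ ^ 2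
      ≤ ‖P (k + 1) u - P k (P (k + 1) u) - P (k + 2) (P (k + 1) u)
        + P k (P (k + 2) (P (k + 1) u))‖ ^ 2)
    (h0 : P 0 = 0) (h1 : P 1 = 0) {n : ℕ} (hn : ∀ k, n ≤ k → P k = 0) (x : E) :
    0.18 * inner ℝ x (∑ k ∈ Finset.range n, P k x) ≤ ‖∑ k ∈ Finset.range n, P k x‖ ^ 2 := by
  have hfar (j k : ℕ) (hjk : j + 3 ≤ k) : 0 ≤ inner ℝ (P j x) (P k x) := by
    rw [(hP j).isSymmetric, ← Module.End.mul_apply, inner_apply_self_of_isSymmetricProjection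
      (isSymmetricProjection_mul (hP j) (hP k) (hc j k (by omega)))]
    exact sq_nonneg _
  have hz (k : ℕ) (hk : n ≤ k) : P k x = 0 := by rw [hn k hk, LinearMap.zero_apply]
  have hz0 : P 0 x = 0 := by rw [h0, LinearMap.zero_apply]
  have hz1 : P 1 x = 0 := by rw [h1, LinearMap.zero_apply]
  have hsum := sum_inner_le_norm_sq_sum_of_far_nonneg (v := fun k => P k x) hz0 hz1 hfar n
  have hwin := Finset.sum_nonneg fun k (_ : k ∈ Finset.range n) =>
    window_nonneg (hP k) (hP (k + 1)) (hP (k + 2)) (hc k (k + 2) le_rfl) (hw k) x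
  have hv : ∑ k ∈ Finset.range n, P (k + 2) x = ∑ k ∈ Finset.range n, P k x :=
    (sum_range_succ_shift (F := fun k => P (k + 1) x) hz1 (hz _ n.le_succ)).trans
      (sum_range_succ_shift (F := fun k => P k x) hz0 (hz _ le_rfl))
  have hsq₁ : ∑ k ∈ Finset.range n, ‖P (k + 1) x‖ ^ 2 = ∑ k ∈ Finset.range n, ‖P k x‖ ^ 2 :=
    sum_range_succ_shift (F := fun k => ‖P k x‖ ^ 2) (by simp [hz0]) (by simp [hz])
  have hsq₂ : ∑ k ∈ Finset.range n, ‖P (k + 2) x‖ ^ 2 = ∑ k ∈ Finset.range n, ‖P (k + 1) x‖ ^ 2 :=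
    sum_range_succ_shift (F := fun k => ‖P (k + 1) x‖ ^ 2) (by simp [hz1]) (by simp [hz])
  have hcross : ∑ k ∈ Finset.range n, inner ℝ (P (k + 1) x) (P (k + 2) x)
      = ∑ k ∈ Finset.range n, inner ℝ (P k x) (P (k + 1) x) :=
    sum_range_succ_shift (F := fun k => inner ℝ (P k x) (P (k + 1) x)) (by simp [hz0])
      (by simp [hz])
  simp only [Finset.sum_add_distrib, ← Finset.mul_sum] at hwin hsum
  simp only [inner_sum, inner_apply_self_of_isSymmetricProjection (hP _)]
  rw [hv] at hsum
  linarith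

end Window

section SpectralGap

variable {E : Type*} [NormedAddCommGroup E] [InnerProductSpace ℂ E]

lemma inner_eq_zero_of_apply_eq_smul {T : E →ₗ[ℂ] E} (hT : T.IsSymmetric) {t : ℝ} (ht : t ≠ 0)
    {v u : E} (hv : T v = (t : ℂ) • v) (hu : T u = 0) : inner ℂ v u = 0 := by
  have h := hT v u
  rw [hv, hu, inner_zero_right, inner_smul_left, Complex.conj_ofReal, mul_eq_zero] at h
  exact h.resolve_left (Complex.ofReal_ne_zero.2 ht)

variable [FiniteDimensional ℂ E]

lemma re_inner_sum_le_norm_sq_sum {P : ℕ → E →ₗ[ℂ] E} (hP : ∀ k, (P k).IsSymmetricProjection)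
    (hc : ∀ j k, j + 2 ≤ k → Commute (P j) (P k))
    (hw : ∀ k u, P k u = 0 → P (k + 2) u = 0 → 2 / 3 * ‖P (k + 1) u‖ ^ 2
      ≤ ‖P (k + 1) u - P k (P (k + 1) u) - P (k + 2) (P (k + 1) u)
        + P k (P (k + 2) (P (k + 1) u))‖ ^ 2)
    (h0 : P 0 = 0) (h1 : P 1 = 0) {n : ℕ} (hn : ∀ k, n ≤ k → P k = 0) (x : E) :
    0.18 * (inner ℂ x (∑ k ∈ Finset.range n, P k x)).re
      ≤ ‖∑ k ∈ Finset.range n, P k x‖ ^ 2 := by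
  let _ : InnerProductSpace ℝ E := InnerProductSpace.complexToReal
  exact inner_sum_le_norm_sq_sum (P := fun k => (P k).restrictScalars ℝ)
    (fun k => ⟨LinearMap.ext fun u => congrArg (· u) (hP k).isIdempotentElem.eq,
      fun u v => congrArg Complex.re ((hP k).isSymmetric u v)⟩)
    (fun j k hjk => LinearMap.ext fun u => congrArg (· u) (hc j k hjk).eq) hw
    (by rw [h0]; rfl) (by rw [h1]; rfl) (fun k hk => by rw [hn k hk]; rfl) x

/-- `T² ≥ g T ≥ 0` leaves no eigenvalue of `T` in the interval `(0, g)`. -/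
theorem mul_norm_sq_sub_starProjection_ker_le {T : E →ₗ[ℂ] E} (hT : T.IsPositive) {g : ℝ}
    (hg : ∀ u, g * (inner ℂ u (T u)).re ≤ ‖T u‖ ^ 2) (u : E) :
    g * ‖u - (LinearMap.ker T).starProjection u‖ ^ 2 ≤ (inner ℂ u (T u)).re := by
  let b := hT.isSymmetric.eigenvectorBasis rfl
  let t := hT.isSymmetric.eigenvalues rfl
  have hb (i) : T (b i) = (t i : ℂ) • b i := hT.isSymmetric.apply_eigenvectorBasis rfl i
  rw [re_inner_apply_eq_sum_eigenvalues hT.isSymmetric, ← b.sum_sq_norm_inner_right,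
    Finset.mul_sum]
  refine Finset.sum_le_sum fun i _ => ?_
  have ht : 0 ≤ t i := hT.nonneg_eigenvalues rfl i
  rcases ht.eq_or_lt with h | h
  · have hmem : b i ∈ LinearMap.ker T := by
      rw [LinearMap.mem_ker, hb, ← h, Complex.ofReal_zero, zero_smul]
    rw [Submodule.sub_starProjection_mem_orthogonal u _ hmem]
    simp [← h, t]
  · have hort : inner ℂ (b i) ((LinearMap.ker T).starProjection u) = 0 :=
      inner_eq_zero_of_apply_eq_smul hT.isSymmetric h.ne' (hb i)
        (Submodule.starProjection_apply_mem (LinearMap.ker T) u)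
    have hgt : g ≤ t i := by
      have := hg (b i)
      rw [hb, inner_smul_right, inner_self_eq_norm_sq_to_K, norm_smul, b.norm_eq_one] at this
      simp only [RCLike.ofReal_one, one_pow, mul_one, ofReal_re, norm_real, Real.norm_eq_abs,
        sq_abs] at this
      nlinarith
    rw [inner_sub_right, hort, sub_zero]
    exact mul_le_mul_of_nonneg_right hgt (sq_nonneg _)

lemma smul_one_sub_starProjection_le_iff {T : E →L[ℂ] E} (hT : T.IsSymmetric) {g : ℝ}
    (S : Submodule ℂ E) : (g : ℂ) • (1 - S.starProjection) ≤ T ↔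
      ∀ u, g * ‖u - S.starProjection u‖ ^ 2 ≤ (inner ℂ u (T u)).re := by
  have hform (u : E) : (inner ℂ u ((T - (g : ℂ) • (1 - S.starProjection)) u)).re
      = (inner ℂ u (T u)).re - g * ‖u - S.starProjection u‖ ^ 2 := by
    have hsq := Sᗮ.re_inner_starProjection_eq_normSq u
    rw [inner_re_symm, Submodule.coe_norm, ← Submodule.starProjection_apply,
      Submodule.starProjection_orthogonal_val] at hsq
    rw [sub_apply, inner_sub_right, smul_apply, inner_smul_right, sub_apply, one_apply_eq_self,
      Complex.sub_re, Complex.re_ofReal_mul, ← hsq, RCLike.re_eq_complex_re]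
  have hsymm : (T - (g : ℂ) • (1 - S.starProjection)).IsSymmetric := by
    rw [← S.starProjection_orthogonal']
    exact hT.sub (Sᗮ.isSymmetricProjection_starProjection.isSymmetric.smul (conj_ofReal g))
  rw [ContinuousLinearMap.le_def, ContinuousLinearMap.isPositive_def, and_iff_right hsymm]
  refine forall_congr' fun u => ?_
  rw [ContinuousLinearMap.reApplyInnerSelf_apply, inner_re_symm, RCLike.re_eq_complex_re, hform,
    sub_nonneg]

lemma smul_one_sub_starProjection_ker_le {T : E →L[ℂ] E} (hT : T.IsPositive) {g : ℝ}
    (hg : ∀ u, g * (inner ℂ u (T u)).re ≤ ‖T u‖ ^ 2) :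
    (g : ℂ) • (1 - (LinearMap.ker (T : E →ₗ[ℂ] E)).starProjection) ≤ T :=
  (smul_one_sub_starProjection_le_iff hT.isSymmetric _).2
    (mul_norm_sq_sub_starProjection_ker_le hT.toLinearMap hg)

lemma le_of_apply_eq_smul {T : E →L[ℂ] E} (hT : T.IsSymmetric) {t : ℝ} (ht : t ≠ 0) {v : E}
    (hv : v ≠ 0) (h : T v = (t : ℂ) • v) {g : ℝ}
    (hg : (g : ℂ) • (1 - (LinearMap.ker (T : E →ₗ[ℂ] E)).starProjection) ≤ T) : g ≤ t := by
  have hort : (LinearMap.ker (T : E →ₗ[ℂ] E)).starProjection v = 0 := by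
    rw [Submodule.starProjection_apply_eq_zero_iff, Submodule.mem_orthogonal']
    exact fun u hu => inner_eq_zero_of_apply_eq_smul hT ht h hu
  have hform := (smul_one_sub_starProjection_le_iff hT _).1 hg v
  rw [hort, sub_zero, h, inner_smul_right, Complex.re_ofReal_mul, ← RCLike.re_eq_complex_re,
    inner_self_eq_norm_sq] at hform
  exact le_of_mul_le_mul_right hform (by positivity)

end SpectralGap

section Gap

variable {N : ℕ}

lemma isSymmetricProjection_bond (x y : Fin N) :
    (bond x y : Chain N →ₗ[ℂ] Chain N).IsSymmetricProjection :=
  Submodule.isSymmetricProjection_starProjection _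

lemma isPositive_ham (a b : ℕ) : (ham N a b).IsPositive :=
  ContinuousLinearMap.isPositive_sum _ fun p _ =>
    (isSymmetricProjection_bond p.1 p.2).isPositive

/-- The padded bond `P k` between the sites `k - 2` and `k - 1`, and `0` if there are no such
sites. The shift by two gives every bond two predecessors, so that all windows of three consecutive
bonds can be treated alike. -/
def chainBond (N k : ℕ) : Op N :=
  if h : 2 ≤ k ∧ k ≤ N then bond ⟨k - 2, by omega⟩ ⟨k - 1, by omega⟩ else 0

lemma chainBond_of_not {k : ℕ} (hk : ¬(2 ≤ k ∧ k ≤ N)) : chainBond N k = 0 := dif_neg hk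

lemma chainBond_of_val {k : ℕ} {x y : Fin N} (hx : (x : ℕ) + 2 = k) (hy : (y : ℕ) + 1 = k) :
    chainBond N k = bond x y := by
  rw [chainBond, dif_pos ⟨by omega, by omega⟩]
  exact congrArg₂ bond (Fin.ext (by simp only; omega)) (Fin.ext (by simp only; omega))

lemma chainBond_cases (k : ℕ) : chainBond N k = 0 ∨ ∃ x y : Fin N, (x : ℕ) + 2 = k ∧
    (y : ℕ) + 1 = k ∧ chainBond N k = bond x y := by
  by_cases h : 2 ≤ k ∧ k ≤ N
  · exact Or.inr ⟨⟨k - 2, by omega⟩, ⟨k - 1, by omega⟩, Nat.sub_add_cancel h.1,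
      Nat.sub_add_cancel (by omega), dif_pos h⟩
  · exact Or.inl (chainBond_of_not h)

lemma isSymmetricProjection_chainBond (k : ℕ) :
    (chainBond N k : Chain N →ₗ[ℂ] Chain N).IsSymmetricProjection := by
  rcases chainBond_cases (N := N) k with h | ⟨x, y, -, -, h⟩
  · rw [h]
    exact ⟨IsIdempotentElem.zero, LinearMap.IsSymmetric.zero⟩
  · rw [h]
    exact isSymmetricProjection_bond x y

lemma commute_chainBond {j k : ℕ} (hjk : j + 2 ≤ k) : Commute (chainBond N j) (chainBond N k) := by
  rcases chainBond_cases (N := N) j with h | ⟨x, y, hx, hy, h⟩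
  · rw [h]; exact Commute.zero_left _
  rcases chainBond_cases (N := N) k with h' | ⟨z, w, hz, hw, h'⟩
  · rw [h']; exact Commute.zero_right _
  rw [h, h']
  apply commute_bond <;> simp only [ne_eq, Fin.ext_iff] <;> omega

lemma ham_eq_sum_chainBond (ψ : Chain N) :
    ham N 0 (N - 1) ψ = ∑ k ∈ Finset.range (N + 1), chainBond N k ψ := by
  rw [ham_apply]
  refine Finset.sum_of_injOn (fun p => (p.1 : ℕ) + 2) ?_ ?_ ?_ ?_
  · rintro ⟨x, y⟩ h ⟨x', y'⟩ h' he
    simp only [Finset.coe_filter, Finset.mem_univ, true_and, Set.mem_ofPred_eq] at h h' he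
    obtain rfl : x = x' := Fin.ext (by omega)
    obtain rfl : y = y' := Fin.ext (by omega)
    rfl
  · rintro ⟨x, y⟩ h
    simp only [Finset.coe_filter, Finset.mem_univ, true_and, Set.mem_ofPred_eq] at h
    simp only [Finset.coe_range, Set.mem_Iio]
    omega
  · intro k _ hk
    rcases chainBond_cases (N := N) k with h | ⟨x, y, hx, hy, -⟩
    · rw [h, zero_apply]
    · refine absurd ⟨(x, y), ?_, hx⟩ hk
      simp only [Finset.coe_filter, Finset.mem_univ, true_and, Set.mem_ofPred_eq]
      omega
  · rintro ⟨x, y⟩ h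
    simp only [Finset.mem_filter, Finset.mem_univ, true_and] at h
    rw [chainBond_of_val (x := x) (y := y) rfl (by omega)]

lemma norm_sq_chainBond_le (k : ℕ) (ψ : Chain N) (h₁ : chainBond N k ψ = 0)
    (h₂ : chainBond N (k + 2) ψ = 0) :
    2 / 3 * ‖chainBond N (k + 1) ψ‖ ^ 2 ≤ ‖chainBond N (k + 1) ψ
      - chainBond N k (chainBond N (k + 1) ψ) - chainBond N (k + 2) (chainBond N (k + 1) ψ)
      + chainBond N k (chainBond N (k + 2) (chainBond N (k + 1) ψ))‖ ^ 2 := by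
  rcases chainBond_cases (N := N) (k + 1) with h | ⟨y, z, hy, hz, h⟩
  · simp [h]
  have hyz : y ≠ z := by simp only [ne_eq, Fin.ext_iff]; omega
  rw [h]
  rcases chainBond_cases (N := N) k with hk | ⟨x, y', hx, hy', hk⟩ <;>
    rcases chainBond_cases (N := N) (k + 2) with hk' | ⟨z', w, hz', hw, hk'⟩ <;>
    rw [hk] at h₁ ⊢ <;> rw [hk'] at h₂ ⊢
  · simp only [zero_apply, sub_zero, add_zero]
    linarith [sq_nonneg ‖bond y z ψ‖]
  · obtain rfl : z' = z := Fin.ext (by omega)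
    simpa using norm_sq_bond_le_three_site hyz (by simp only [ne_eq, Fin.ext_iff]; omega)
      (by simp only [ne_eq, Fin.ext_iff]; omega) h₂
  · obtain rfl : y' = y := Fin.ext (by omega)
    rw [bond_comm] at h₁
    simpa [bond_comm] using norm_sq_bond_le_three_site hyz.symm
      (by simp only [ne_eq, Fin.ext_iff]; omega) (by simp only [ne_eq, Fin.ext_iff]; omega) h₁
  · obtain rfl : y' = y := Fin.ext (by omega)
    obtain rfl : z' = z := Fin.ext (by omega)
    apply norm_sq_bond_le_four_site _ _ hyz _ _ _ h₁ h₂ <;>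
      simp only [ne_eq, Fin.ext_iff] <;> omega

lemma re_inner_ham_le_norm_sq (ψ : Chain N) :
    0.18 * (inner ℂ ψ (ham N 0 (N - 1) ψ)).re ≤ ‖ham N 0 (N - 1) ψ‖ ^ 2 := by
  rw [ham_eq_sum_chainBond]
  exact re_inner_sum_le_norm_sq_sum (P := fun k => (chainBond N k : Chain N →ₗ[ℂ] Chain N))
    isSymmetricProjection_chainBond
    (fun j k hjk => LinearMap.ext fun u => congrArg (· u) (commute_chainBond hjk).eq)
    norm_sq_chainBond_le (by rw [chainBond_of_not (by omega)]; rfl)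
    (by rw [chainBond_of_not (by omega)]; rfl)
    (fun k hk => by rw [chainBond_of_not (by omega)]; rfl) ψ

/-- The ferromagnetic product state `|+⟩ ⊗ ⋯ ⊗ |+⟩`, which every bond fixes. -/
def allUp (L : ℕ) : Chain L := EuclideanSpace.single (fun _ => 0) 1

lemma allUp_ne_zero (L : ℕ) : allUp L ≠ 0 := by simp [allUp]

lemma bond_allUp {x y : Fin N} (hxy : x ≠ y) : bond x y (allUp N) = allUp N := by
  have hval (σ : Fin N → Fin 3) : allUp N σ = if σ = fun _ => 0 then 1 else 0 := by
    rw [allUp, PiLp.single_apply]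
  have hzero (σ : Fin N → Fin 3) (s t : Fin 3) (hst : (s, t) ≠ (0, 0)) :
      allUp N (upd2 σ x y s t) = 0 := by
    rw [hval, if_neg]
    intro h
    exact hst (Prod.ext (by simpa only [upd2_left hxy] using congrFun h x)
      (by simpa only [upd2_right] using congrFun h y))
  ext σ
  rw [bond_apply hxy, ← Fintype.sum_prod_type' (f := fun s t =>
      (spinTwoInt (σ x, σ y) (s, t) : ℂ) / 6 * allUp N (upd2 σ x y s t)),
    Finset.sum_eq_single ((0, 0) : Fin 3 × Fin 3)
      (fun p _ hp => by rw [hzero σ p.1 p.2 hp, mul_zero]) (by simp)]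
  by_cases h : σ x = 0 ∧ σ y = 0
  · have hcoeff : spinTwoInt (0, 0) (0, 0) = 6 := by decide
    have hσ : upd2 σ x y 0 0 = σ := by simpa only [h.1, h.2] using upd2_self (x := x) (y := y) σ
    rw [h.1, h.2, hcoeff, hσ]
    norm_num
  · have hcoeff : ∀ a b : Fin 3, ¬(a = 0 ∧ b = 0) → spinTwoInt (a, b) (0, 0) = 0 := by decide
    rw [hcoeff _ _ h, hval σ, if_neg (fun hσ => h (by simp [hσ]))]
    simp

lemma bddAbove_gap_set (hN : 2 ≤ N) :
    BddAbove {g : ℝ | (g : ℂ) • (1 - groundProj N 0 (N - 1)) ≤ ham N 0 (N - 1)} := by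
  set s : Finset (Fin N × Fin N) := {p | 0 ≤ (p.1 : ℕ) ∧ (p.2 : ℕ) = (p.1 : ℕ) + 1
    ∧ (p.2 : ℕ) ≤ N - 1} with hs
  have hcard : (#s : ℝ) ≠ 0 := Nat.cast_ne_zero.2 <| Finset.card_ne_zero.2
    ⟨(⟨0, by omega⟩, ⟨1, by omega⟩), by simp [hs]; omega⟩
  refine ⟨#s, fun g hg => le_of_apply_eq_smul (isPositive_ham _ _).isSymmetric hcard
    (allUp_ne_zero N) ?_ hg⟩
  rw [ham_apply, Finset.sum_congr rfl (g := fun _ => allUp N), Finset.sum_const,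
    ← Nat.cast_smul_eq_nsmul ℂ, Complex.ofReal_natCast]
  intro p hp
  refine bond_allUp fun h => ?_
  simp [h] at hp

lemma smul_one_sub_groundProj_le {g : ℝ}
    (hg : ∀ ψ : Chain N, g * (inner ℂ ψ (ham N 0 (N - 1) ψ)).re ≤ ‖ham N 0 (N - 1) ψ‖ ^ 2) :
    (g : ℂ) • (1 - groundProj N 0 (N - 1)) ≤ ham N 0 (N - 1) :=
  smul_one_sub_starProjection_ker_le (isPositive_ham _ _) hg

lemma le_gap (hN : 2 ≤ N) {g : ℝ}
    (hg : ∀ ψ : Chain N, g * (inner ℂ ψ (ham N 0 (N - 1) ψ)).re ≤ ‖ham N 0 (N - 1) ψ‖ ^ 2) :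
    g ≤ gap N :=
  le_csSup (bddAbove_gap_set hN) (smul_one_sub_groundProj_le hg)

lemma gap_le_of_apply_eq_smul {t : ℝ} (ht : t ≠ 0) {φ : Chain N} (hφ : φ ≠ 0)
    (h : ham N 0 (N - 1) φ = (t : ℂ) • φ) : gap N ≤ t :=
  csSup_le ⟨_, smul_one_sub_groundProj_le re_inner_ham_le_norm_sq⟩ fun _ hg =>
    le_of_apply_eq_smul (isPositive_ham _ _).isSymmetric ht hφ h hg

theorem gap_two : gap 2 = 1 := by
  have hham (ψ : Chain 2) : ham 2 0 (2 - 1) ψ = bond 0 1 ψ := by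
    rw [ham_eq_sum_chainBond]
    simp [Finset.sum_range_succ, chainBond_of_not, chainBond_of_val (N := 2) (x := 0) (y := 1)]
  refine le_antisymm (gap_le_of_apply_eq_smul one_ne_zero (allUp_ne_zero 2) ?_)
    (le_gap le_rfl fun ψ => ?_)
  · rw [hham, bond_allUp (by simp), Complex.ofReal_one, one_smul]
  · rw [hham, inner_bond_self, Complex.ofReal_re, one_mul]

/-- The coefficients of `|0++⟩ - 2 |+0+⟩ + |++0⟩`, an eigenvector of the three-site Hamiltonian for
the eigenvalue `1/2`. -/
def excitedCoeff (a b c : Fin 3) : ℤ :=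
  if (a, b, c) = (0, 0, 1) then 1 else if (a, b, c) = (0, 1, 0) then -2
    else if (a, b, c) = (1, 0, 0) then 1 else 0

lemma sum_spinTwoInt_mul_excitedCoeff : ∀ a b c : Fin 3,
    ∑ s, ∑ t, spinTwoInt (a, b) (s, t) * excitedCoeff s t c
      + ∑ s, ∑ t, spinTwoInt (b, c) (s, t) * excitedCoeff a s t = 3 * excitedCoeff a b c := by
  decide

/-- The eigenvector of the three-site Hamiltonian with coefficients `excitedCoeff`. -/
def excited : Chain 3 := WithLp.toLp 2 fun σ => (excitedCoeff (σ 0) (σ 1) (σ 2) : ℂ)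

lemma excited_apply (σ : Fin 3 → Fin 3) : excited σ = excitedCoeff (σ 0) (σ 1) (σ 2) := rfl

lemma ham_excited : ham 3 0 (3 - 1) excited = ((1 / 2 : ℝ) : ℂ) • excited := by
  have hham : ham 3 0 (3 - 1) excited = bond 0 1 excited + bond 1 2 excited := by
    rw [ham_eq_sum_chainBond]
    simp [Finset.sum_range_succ, chainBond_of_not, chainBond_of_val (N := 3) (x := 0) (y := 1),
      chainBond_of_val (N := 3) (x := 1) (y := 2)]
  ext σ
  have h := congrArg (fun z : ℤ => (z : ℂ) / 6)
    (sum_spinTwoInt_mul_excitedCoeff (σ 0) (σ 1) (σ 2))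
  push_cast [add_div, Finset.sum_div, mul_div_right_comm] at h
  have h₀₁ (s t : Fin 3) : excited (upd2 σ 0 1 s t) = excitedCoeff s t (σ 2) := rfl
  have h₁₂ (s t : Fin 3) : excited (upd2 σ 1 2 s t) = excitedCoeff (σ 0) s t := rfl
  rw [hham, PiLp.add_apply, bond_apply (by simp), bond_apply (by simp), PiLp.smul_apply,
    smul_eq_mul]
  simp only [h₀₁, h₁₂, h, excited_apply]
  push_cast
  ring

lemma gap_three_le : gap 3 ≤ 1 / 2 := by
  refine gap_le_of_apply_eq_smul (by norm_num) (φ := excited) (fun h => ?_) ham_excited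
  have := congrArg (fun ψ : Chain 3 => ψ ![1, 0, 0]) h
  simp [excited_apply, excitedCoeff] at this

lemma minGap_six_le : minGap 6 ≤ 1 / 2 :=
  (ciInf_le (f := fun n : Set.Icc (2 : ℕ) 6 => gap n) (Set.finite_range _).bddBelow
    ⟨3, Set.mem_Icc.2 (by norm_num)⟩).trans gap_three_le

theorem le_infGap : 0.18 ≤ infGap := by
  have : Nonempty (Set.Ici (2 : ℕ)) := ⟨⟨2, Set.mem_Ici.2 le_rfl⟩⟩
  exact le_ciInf fun N => le_gap N.2 re_inner_ham_le_norm_sq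

end Gap

end AKLT

end

open AKLT Polynomial in
theorem mainTheorem4 :
    -- the Kennedy–Tasaki unitary turns the ground states into the span of four product states
    (∀ N : ℕ, 2 ≤ N →
      kennedyTasaki N ∈ unitary (Op N) ∧
      LinearIndependent ℂ (Phi N) ∧
      (groundSpace N 0 (N - 1)).map (kennedyTasaki N : Chain N →ₗ[ℂ] Chain N)
        = Submodule.span ℂ (Set.range (Phi N))) ∧
    -- the matrix of `G(-m,0) G(0,n) G(-m,0)` (conjugated by the unitary), its eigenvalues, `ε(m,n)`
    (∀ m n : ℕ, 1 ≤ m → 1 ≤ n →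
      (∀ ij, (kennedyTasaki (m + n + 1) * K m n * star (kennedyTasaki (m + n + 1))) (Theta m n ij)
        = ∑ rk, A m n ij rk • Theta m n rk) ∧
      LinearMap.range ((kennedyTasaki (m + n + 1) * K m n * star (kennedyTasaki (m + n + 1)) :
          Op (m + n + 1)) : Chain (m + n + 1) →ₗ[ℂ] Chain (m + n + 1))
        ≤ Submodule.span ℂ (Set.range (Theta m n)) ∧
      (2 ≤ n → LinearIndependent ℂ (Theta m n)) ∧
      0 ≤ lamR m n ∧
      (A m n).charpoly = (X - C 1) ^ 4 * (X - C (lam5 m n : ℂ)) ^ 5 * (X - C (lam1 m n : ℂ))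
        * (X - C (lam3plus m n : ℂ)) ^ 3 * (X - C (lam3minus m n : ℂ)) ^ 3 ∧
      max (lam5 m n) (max (lam1 m n) (lam3plus m n)) < 1 ∧
      eps m n = max (lam5 m n) (max (lam1 m n) (lam3plus m n))) ∧
    -- the uniform gap bound
    (eps 1 1 = lam5 1 1 ∧ lam5 1 1 = 1 / 4 ∧ epsSup 1 1 = 1 / 4 ∧ gap 2 = 1 ∧
      1 - Real.sqrt 3 / 2 ≤ infGap) ∧
    -- the refinement
    (eps 3 3 = lam5 3 3 ∧ lam5 3 3 = (7 / 20) ^ 2 ∧ epsSup 3 3 = (7 / 20) ^ 2 ∧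
      minGap 6 * (1 - 2 * Real.sqrt (epsSup 3 3 * (1 - epsSup 3 3))) ≤ infGap ∧
      0.137194 ≤ infGap) := by
  refine ⟨fun N hN ↦ ⟨kennedyTasaki_mem_unitary N, linearIndependent_Phi hN,
      map_groundSpace_eq_span_Phi hN⟩,
    fun m n hm hn ↦ ⟨kennedyTasaki_K_Theta hm hn, range_kennedyTasaki_K_le hm hn,
      linearIndependent_Theta hm, lamR_nonneg hm hn, charpoly_A hm hn, lam_lt_one hm hn,
      eps_eq hm hn⟩,
    ⟨eps_one_one.trans lam5_one_one.symm, lam5_one_one, epsSup_one_one, gap_two, ?_⟩,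
    ⟨eps_three_three.trans lam5_three_three.symm, lam5_three_three, epsSup_three_three, ?_, ?_⟩⟩
  · have sqrt_three_ge : (1.64 : ℝ) ≤ √3 := Real.le_sqrt_of_sq_le (by norm_num)
    linarith [le_infGap]
  · have sqrt_ge : 0.32 ≤ √(epsSup 3 3 * (1 - epsSup 3 3)) := by
      rw [epsSup_three_three]; exact Real.le_sqrt_of_sq_le (by norm_num)
    have sqrt_le : √(epsSup 3 3 * (1 - epsSup 3 3)) ≤ 0.5 := by
      rw [epsSup_three_three]; exact Real.sqrt_le_iff.2 (by norm_num)
    nlinarith [le_infGap, minGap_six_le]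
  · linarith [le_infGap]
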